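/- Let $n \ge 0$ and let $q$ be a non-degenerate quadratic form on $\mathbb{R}^n$, regarded as the homogeneous quadratic polynomial $q(x_1,\dots,x_n)$ in the coordinates. For a commutative ring $R$ and $w \in R$, a matrix factorization of $w$ is a $\mathbb{Z}/2\mathbb{Z}$-graded free $R$-module $M = M_0 \oplus M_1$ of finite rank together with an odd $R$-linear endomorphism $d_M$ such that $d_M^2 = w \cdot \mathrm{id}_M$. Matrix factorizations of $w$ are the objects of the homotopy category $\mathrm{HMF}(R,w)$; the morphisms $M \to N$ are the even $R$-linear maps $f$ with $d_N f = f d_M$, modulo those of the form $d_N h + h d_M$ with $h : M \to N$ odd and $R$-linear. The shift functor is $\Sigma(M_0 \oplus M_1, d_M) = (M_1 \oplus M_0, -d_M)$, and the distinguished triangles are those isomorphic to $M \xrightarrow{f} N \to \mathrm{Cone}(f) \to \Sigma M$ for a morphism of matrix factorizations $f$, where $\mathrm{Cone}(f) = N \oplus \Sigma M$ has differential $(y, x) \mapsto (d_N y + f x, -d_M x)$ and the two unnamed maps are the inclusion and the projection. Then there is an $\mathbb{R}$-linear triangle equivalence (an $\mathbb{R}$-linear equivalence of categories which commutes with the shifts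 up to natural isomorphism and preserves distinguished triangles) $$\mathrm{HMF}\big(\mathbb{R}[[x_1,\dots,x_n]],\, q\big) \;\simeq\; \mathrm{HMF}\Big(\mathbb{R}[[x_1,\dots,x_{n+8}]],\; q + \sum_{i=1}^{8} x_{n+i}^2\Big).$$ -/

import Mathlib

open CategoryTheory Limits

universe u

noncomputable section

/-- A matrix factorization of `w` : a `ℤ/2`-graded free module `X₀ ⊕ X₁` of finite rank with an
odd linear endomorphism, given by `d₀` and `d₁`, which squares to `w`. -/
structure MatrixFactorization (R : Type u) [CommRing R] (w : R) where
  /-- the even part -/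
  X₀ : Type u
  /-- the odd part -/
  X₁ : Type u
  [addCommGroup₀ : AddCommGroup X₀]
  [addCommGroup₁ : AddCommGroup X₁]
  [module₀ : Module R X₀]
  [module₁ : Module R X₁]
  [free₀ : Module.Free R X₀]
  [free₁ : Module.Free R X₁]
  [finite₀ : Module.Finite R X₀]
  [finite₁ : Module.Finite R X₁]
  /-- the twisted differential on the even part -/
  d₀ : X₀ →ₗ[R] X₁
  /-- the twisted differential on the odd part -/
  d₁ : X₁ →ₗ[R] X₀
  d₁_d₀ : ∀ x, d₁ (d₀ x) = w • x
  d₀_d₁ : ∀ x, d₀ (d₁ x) = w • x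

namespace MatrixFactorization

attribute [instance] addCommGroup₀ addCommGroup₁ module₀ module₁ free₀ free₁ finite₀ finite₁
attribute [simp] d₁_d₀ d₀_d₁

variable {R : Type u} [CommRing R] {w : R}

/-- The closed morphisms of degree zero: even linear maps `f` with `d ∘ f - f ∘ d = 0`. -/
@[ext]
structure Hom (X Y : MatrixFactorization R w) where
  /-- the map on even parts -/
  f₀ : X.X₀ →ₗ[R] Y.X₀
  /-- the map on odd parts -/
  f₁ : X.X₁ →ₗ[R] Y.X₁
  comm₀ : ∀ x, Y.d₀ (f₀ x) = f₁ (X.d₀ x)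
  comm₁ : ∀ x, Y.d₁ (f₁ x) = f₀ (X.d₁ x)

attribute [simp] Hom.comm₀ Hom.comm₁

/-- The category of matrix factorizations and closed morphisms of degree zero. -/
instance : Category (MatrixFactorization R w) where
  Hom X Y := Hom X Y
  id X := ⟨LinearMap.id, LinearMap.id, by simp, by simp⟩
  comp f g := ⟨g.f₀ ∘ₗ f.f₀, g.f₁ ∘ₗ f.f₁, by simp, by simp⟩

@[ext]
lemma hom_ext {X Y : MatrixFactorization R w} {f g : X ⟶ Y}
    (h₀ : ∀ x, f.f₀ x = g.f₀ x) (h₁ : ∀ x, f.f₁ x = g.f₁ x) : f = g :=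
  Hom.ext (LinearMap.ext h₀) (LinearMap.ext h₁)

section
variable {X Y Z : MatrixFactorization R w}

@[simp] lemma id_f₀ (x : X.X₀) : Hom.f₀ (𝟙 X) x = x := rfl
@[simp] lemma id_f₁ (x : X.X₁) : Hom.f₁ (𝟙 X) x = x := rfl
@[simp] lemma comp_f₀ (f : X ⟶ Y) (g : Y ⟶ Z) (x : X.X₀) : (f ≫ g).f₀ x = g.f₀ (f.f₀ x) := rfl
@[simp] lemma comp_f₁ (f : X ⟶ Y) (g : Y ⟶ Z) (x : X.X₁) : (f ≫ g).f₁ x = g.f₁ (f.f₁ x) := rfl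

instance : Zero (X ⟶ Y) := ⟨⟨0, 0, by simp, by simp⟩⟩
instance : Add (X ⟶ Y) := ⟨fun f g => ⟨f.f₀ + g.f₀, f.f₁ + g.f₁, by simp, by simp⟩⟩
instance : Neg (X ⟶ Y) := ⟨fun f => ⟨-f.f₀, -f.f₁, by simp, by simp⟩⟩
instance : Sub (X ⟶ Y) := ⟨fun f g => ⟨f.f₀ - g.f₀, f.f₁ - g.f₁, by simp, by simp⟩⟩
/-- Scalars from a field `k` over which `R` is an algebra. -/
instance {k : Type*} [Field k] [Algebra k R] : SMul k (X ⟶ Y) :=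
  ⟨fun c f => ⟨algebraMap k R c • f.f₀, algebraMap k R c • f.f₁, by simp, by simp⟩⟩

@[simp] lemma zero_f₀ (x : X.X₀) : Hom.f₀ (0 : X ⟶ Y) x = 0 := rfl
@[simp] lemma zero_f₁ (x : X.X₁) : Hom.f₁ (0 : X ⟶ Y) x = 0 := rfl
@[simp] lemma add_f₀ (f g : X ⟶ Y) (x : X.X₀) : (f + g).f₀ x = f.f₀ x + g.f₀ x := rfl
@[simp] lemma add_f₁ (f g : X ⟶ Y) (x : X.X₁) : (f + g).f₁ x = f.f₁ x + g.f₁ x := rfl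
@[simp] lemma neg_f₀ (f : X ⟶ Y) (x : X.X₀) : (-f).f₀ x = -f.f₀ x := rfl
@[simp] lemma neg_f₁ (f : X ⟶ Y) (x : X.X₁) : (-f).f₁ x = -f.f₁ x := rfl
@[simp] lemma sub_f₀ (f g : X ⟶ Y) (x : X.X₀) : (f - g).f₀ x = f.f₀ x - g.f₀ x := rfl
@[simp] lemma sub_f₁ (f g : X ⟶ Y) (x : X.X₁) : (f - g).f₁ x = f.f₁ x - g.f₁ x := rfl
@[simp] lemma smul_f₀ {k : Type*} [Field k] [Algebra k R] (c : k) (f : X ⟶ Y) (x : X.X₀) :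
    (c • f).f₀ x = algebraMap k R c • f.f₀ x := rfl
@[simp] lemma smul_f₁ {k : Type*} [Field k] [Algebra k R] (c : k) (f : X ⟶ Y) (x : X.X₁) :
    (c • f).f₁ x = algebraMap k R c • f.f₁ x := rfl

instance : AddCommGroup (X ⟶ Y) where
  add_assoc f g h := by ext <;> simp [add_assoc]
  zero_add f := by ext <;> simp
  add_zero f := by ext <;> simp
  add_comm f g := by ext <;> simp [add_comm]
  neg_add_cancel f := by ext <;> simp
  sub_eq_add_neg f g := by ext <;> simp [sub_eq_add_neg]
  nsmul := nsmulRec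
  zsmul := zsmulRec

instance {k : Type*} [Field k] [Algebra k R] : Module k (X ⟶ Y) where
  one_smul f := by ext <;> simp
  mul_smul a b f := by ext <;> simp [mul_smul]
  smul_zero a := by ext <;> simp
  smul_add a f g := by ext <;> simp
  add_smul a b f := by ext <;> simp [add_smul]
  zero_smul f := by ext <;> simp

end


instance : Preadditive (MatrixFactorization R w) where
  add_comp _ _ _ f f' g := by ext <;> simp
  comp_add _ _ _ f g g' := by ext <;> simp

instance {k : Type*} [Field k] [Algebra k R] : Linear k (MatrixFactorization R w) where
  smul_comp X Y Z c f g := by ext <;> simp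
  comp_smul X Y Z f c g := by ext <;> simp

variable (w) in
/-- Two closed morphisms of degree zero are identified when their difference is the boundary
`D(h) = d ∘ h + h ∘ d` of an odd linear map `h = (h₀, h₁)`. -/
def homotopic : HomRel (MatrixFactorization R w) := fun X Y f g =>
  ∃ (h₀ : X.X₀ →ₗ[R] Y.X₁) (h₁ : X.X₁ →ₗ[R] Y.X₀),
    (∀ x, f.f₀ x - g.f₀ x = Y.d₁ (h₀ x) + h₁ (X.d₀ x)) ∧
    (∀ x, f.f₁ x - g.f₁ x = Y.d₀ (h₁ x) + h₀ (X.d₁ x))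

instance : Congruence (homotopic w) where
  equivalence :=
    { refl f := ⟨0, 0, by simp, by simp⟩
      symm := by
        rintro f g ⟨h₀, h₁, H₀, H₁⟩
        refine ⟨-h₀, -h₁, fun x => ?_, fun x => ?_⟩
        · rw [← neg_sub, H₀]; simp; abel
        · rw [← neg_sub, H₁]; simp; abel
      trans := by
        rintro f g k ⟨h₀, h₁, H₀, H₁⟩ ⟨h₀', h₁', H₀', H₁'⟩
        refine ⟨h₀ + h₀', h₁ + h₁', fun x => ?_, fun x => ?_⟩
        · rw [← sub_add_sub_cancel _ (g.f₀ x), H₀, H₀']; simp; abel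
        · rw [← sub_add_sub_cancel _ (g.f₁ x), H₁, H₁']; simp; abel }
  comp_left := by
    rintro X Y Z f g g' ⟨h₀, h₁, H₀, H₁⟩
    refine ⟨h₀ ∘ₗ f.f₀, h₁ ∘ₗ f.f₁, fun x => ?_, fun x => ?_⟩
    · simp [H₀]
    · simp [H₁]
  comp_right := by
    rintro X Y Z f f' g ⟨h₀, h₁, H₀, H₁⟩
    refine ⟨g.f₁ ∘ₗ h₀, g.f₀ ∘ₗ h₁, fun x => ?_, fun x => ?_⟩
    · simp [← map_sub, H₀]
    · simp [← map_sub, H₁]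

lemma homotopic.add {X Y : MatrixFactorization R w} {f g f' g' : X ⟶ Y}
    (h : homotopic w f g) (h' : homotopic w f' g') : homotopic w (f + f') (g + g') := by
  obtain ⟨h₀, h₁, H₀, H₁⟩ := h
  obtain ⟨h₀', h₁', H₀', H₁'⟩ := h'
  refine ⟨h₀ + h₀', h₁ + h₁', fun x => ?_, fun x => ?_⟩
  · simp only [add_f₀, add_sub_add_comm, H₀, H₀']; simp; abel
  · simp only [add_f₁, add_sub_add_comm, H₁, H₁']; simp; abel

lemma homotopic.smul {k : Type*} [Field k] [Algebra k R] (c : k)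
    {X Y : MatrixFactorization R w} {f g : X ⟶ Y}
    (h : homotopic w f g) : homotopic w (c • f) (c • g) := by
  obtain ⟨h₀, h₁, H₀, H₁⟩ := h
  refine ⟨algebraMap k R c • h₀, algebraMap k R c • h₁, fun x => ?_, fun x => ?_⟩
  · simp [← smul_sub, H₀]
  · simp [← smul_sub, H₁]

variable (w) in
/-- The functor `Σ` exchanging even and odd parts and changing the sign of the differential. -/
def sigma : MatrixFactorization R w ⥤ MatrixFactorization R w where
  obj X := { X₀ := X.X₁, X₁ := X.X₀, d₀ := -X.d₁, d₁ := -X.d₀,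
             d₁_d₀ := by simp, d₀_d₁ := by simp }
  map f := ⟨f.f₁, f.f₀, by simp, by simp⟩

variable (w) in
/-- `Σ ∘ Σ` is the identity, up to replacing `-(-d)` by `d`. -/
def sigmaSigma : 𝟭 (MatrixFactorization R w) ≅ sigma w ⋙ sigma w :=
  NatIso.ofComponents (fun X =>
    { hom := ⟨LinearMap.id, LinearMap.id, fun _ => neg_neg _, fun _ => neg_neg _⟩
      inv := ⟨LinearMap.id, LinearMap.id, fun _ => (neg_neg _).symm, fun _ => (neg_neg _).symm⟩ })

variable (w) in
/-- The powers of `Σ`, depending on the parity of the exponent. -/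
def sigmaPow : ZMod 2 → (MatrixFactorization R w ⥤ MatrixFactorization R w) :=
  fun (a : Fin 2) => match a with
  | 0 => 𝟭 _
  | 1 => sigma w

variable (w) in
/-- Powers of `Σ` add up; all components are identity maps of the underlying modules. -/
def sigmaPowAdd : ∀ a b : ZMod 2, sigmaPow w (a + b) ≅ sigmaPow w a ⋙ sigmaPow w b :=
  fun (a : Fin 2) (b : Fin 2) => match a, b with
  | 0, 0 => (Functor.leftUnitor (𝟭 _)).symm
  | 0, 1 => (Functor.leftUnitor (sigma w)).symm
  | 1, 0 => (Functor.rightUnitor (sigma w)).symm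
  | 1, 1 => sigmaSigma w

instance : HasShift (MatrixFactorization R w) (ZMod 2) :=
  hasShiftMk _ _
    { F := sigmaPow w
      zero := Iso.refl _
      add := sigmaPowAdd w
      assoc_hom_app := fun (a : Fin 2) (b : Fin 2) (c : Fin 2) X => by
        fin_cases a <;> fin_cases b <;> fin_cases c <;> (ext <;> rfl)
      zero_add_hom_app := fun (a : Fin 2) X => by
        fin_cases a <;> (ext <;> rfl)
      add_zero_hom_app := fun (a : Fin 2) X => by
        fin_cases a <;> (ext <;> rfl) }

instance : HasShift (MatrixFactorization R w) ℤ :=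
  inferInstanceAs (HasShift (PullbackShift (MatrixFactorization R w) (Int.castAddHom (ZMod 2))) ℤ)

lemma shiftFunctor_one : shiftFunctor (MatrixFactorization R w) (1 : ℤ) = sigma w := rfl

lemma sigmaPow_additive : ∀ a : ZMod 2, (sigmaPow w a).Additive :=
  fun (a : Fin 2) => match a with
  | 0 => inferInstanceAs (𝟭 (MatrixFactorization R w)).Additive
  | 1 => { map_add := by intros; rfl }

instance (n : ℤ) : (shiftFunctor (MatrixFactorization R w) n).Additive :=
  sigmaPow_additive (w := w) (Int.castAddHom (ZMod 2) n)

lemma homotopic.sigmaPow {X Y : MatrixFactorization R w} {f g : X ⟶ Y} (h : homotopic w f g) :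
    ∀ a : ZMod 2, homotopic w ((sigmaPow w a).map f) ((sigmaPow w a).map g) :=
  fun (a : Fin 2) => match a with
  | 0 => h
  | 1 => by
    obtain ⟨h₀, h₁, H₀, H₁⟩ := h
    refine ⟨-h₁, -h₀, fun x => (H₁ x).trans ?_, fun x => (H₀ x).trans ?_⟩
    · change _ = -(Y.d₀ (-(h₁ x))) + -(h₀ (-(X.d₁ x)))
      simp
    · change _ = -(Y.d₁ (-(h₀ x))) + -(h₁ (-(X.d₀ x)))
      simp

instance : (homotopic w).IsCompatibleWithShift ℤ where
  condition a _ _ _ _ h := h.sigmaPow (Int.castAddHom (ZMod 2) a)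

/-- The mapping cone `Y ⊕ ΣX` of `f : X ⟶ Y`, with differential `(y, x) ↦ (d y + f x, - d x)`. -/
def cone {X Y : MatrixFactorization R w} (f : X ⟶ Y) : MatrixFactorization R w where
  X₀ := Y.X₀ × X.X₁
  X₁ := Y.X₁ × X.X₀
  d₀ := LinearMap.prod (Y.d₀.coprod f.f₁) (-(X.d₁ ∘ₗ LinearMap.snd R _ _))
  d₁ := LinearMap.prod (Y.d₁.coprod f.f₀) (-(X.d₀ ∘ₗ LinearMap.snd R _ _))
  d₁_d₀ x := by ext <;> simp
  d₀_d₁ x := by ext <;> simp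

/-- The inclusion `Y ⟶ cone f`. -/
def coneIncl {X Y : MatrixFactorization R w} (f : X ⟶ Y) : Y ⟶ cone f where
  f₀ := LinearMap.inl R Y.X₀ X.X₁
  f₁ := LinearMap.inl R Y.X₁ X.X₀
  comm₀ x := by
    change (Y.d₀ x + f.f₁ 0, -X.d₁ 0) = (Y.d₀ x, (0 : X.X₀))
    simp
  comm₁ x := by
    change (Y.d₁ x + f.f₀ 0, -X.d₀ 0) = (Y.d₁ x, (0 : X.X₁))
    simp

/-- The projection `cone f ⟶ ΣX`. -/
def coneProj {X Y : MatrixFactorization R w} (f : X ⟶ Y) : cone f ⟶ X⟦(1 : ℤ)⟧ where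
  f₀ := LinearMap.snd R Y.X₀ X.X₁
  f₁ := LinearMap.snd R Y.X₁ X.X₀
  comm₀ _ := rfl
  comm₁ _ := rfl

/-- The standard triangle `X ⟶ Y ⟶ cone f ⟶ ΣX`. -/
abbrev coneTriangle {X Y : MatrixFactorization R w} (f : X ⟶ Y) :
    Pretriangulated.Triangle (MatrixFactorization R w) :=
  Pretriangulated.Triangle.mk f (coneIncl f) (coneProj f)

/-- The zero matrix factorization. -/
def zero (R : Type u) [CommRing R] (w : R) : MatrixFactorization R w where
  X₀ := PUnit
  X₁ := PUnit
  d₀ := 0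
  d₁ := 0
  d₁_d₀ _ := rfl
  d₀_d₁ _ := rfl

lemma isZero_zeroMF : IsZero (zero R w) :=
  (IsZero.iff_id_eq_zero _).2 rfl

end MatrixFactorization

/-- The homotopy category `H⁰` of matrix factorizations. -/
abbrev HMF (R : Type u) [CommRing R] (w : R) : Type (u + 1) :=
  CategoryTheory.Quotient (MatrixFactorization.homotopic (R := R) w)

namespace HMF

open MatrixFactorization Pretriangulated

variable {R : Type u} [CommRing R] {w : R}

variable (R w) in
/-- The functor from closed morphisms of degree zero to homotopy classes. -/
abbrev quotient : MatrixFactorization R w ⥤ HMF R w :=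
  Quotient.functor (homotopic w)

instance : Preadditive (HMF R w) :=
  Quotient.preadditive _ (fun _ _ _ _ _ _ h h' => h.add h')

instance : (quotient R w).Additive :=
  Quotient.functor_additive _ (fun _ _ _ _ _ _ h h' => h.add h')

instance {k : Type*} [Field k] [Algebra k R] : Linear k (HMF R w) :=
  Quotient.linear k _ (fun c _ _ _ _ h => h.smul c)

instance {k : Type*} [Field k] [Algebra k R] : (quotient R w).Linear k where

lemma quotient_map_eq_iff {X Y : MatrixFactorization R w} (f g : X ⟶ Y) :
    (quotient R w).map f = (quotient R w).map g ↔ homotopic w f g :=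
  Quotient.functor_map_eq_iff _ f g

instance : HasZeroObject (HMF R w) :=
  ⟨_, (quotient R w).map_isZero (isZero_zeroMF (R := R) (w := w))⟩

instance (n : ℤ) : (shiftFunctor (HMF R w) n).Additive := by
  have := Functor.additive_of_iso ((quotient R w).commShiftIso n)
  apply Functor.additive_of_full_essSurj_comp (quotient R w)

/-- The class of triangles isomorphic to standard ones. -/
def distinguishedTriangles (R : Type u) [CommRing R] (w : R) : Set (Triangle (HMF R w)) :=
  {T | ∃ (X Y : MatrixFactorization R w) (f : X ⟶ Y),
    Nonempty (T ≅ (quotient R w).mapTriangle.obj (coneTriangle f))}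

lemma isomorphic_distinguished (T₁ : Triangle (HMF R w))
    (hT₁ : T₁ ∈ distinguishedTriangles R w) (T₂ : Triangle (HMF R w)) (e : T₂ ≅ T₁) :
    T₂ ∈ distinguishedTriangles R w := by
  obtain ⟨X, Y, f, ⟨e'⟩⟩ := hT₁
  exact ⟨X, Y, f, ⟨e ≪≫ e'⟩⟩

lemma isZero_cone_id (X : MatrixFactorization R w) : IsZero ((quotient R w).obj (cone (𝟙 X))) := by
  rw [IsZero.iff_id_eq_zero, ← CategoryTheory.Functor.map_id, ← Functor.map_zero, quotient_map_eq_iff]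
  refine ⟨LinearMap.inr R X.X₁ X.X₀ ∘ₗ LinearMap.fst R X.X₀ X.X₁,
    LinearMap.inr R X.X₀ X.X₁ ∘ₗ LinearMap.fst R X.X₁ X.X₀, ?_, ?_⟩
  · rintro ⟨y, x⟩
    change (y - 0, x - 0) =
      (X.d₁ 0 + y, -X.d₀ y) + ((0 : X.X₀), X.d₀ y + x)
    ext <;> simp
  · rintro ⟨y, x⟩
    change (y - 0, x - 0) =
      (X.d₀ 0 + y, -X.d₁ y) + ((0 : X.X₁), X.d₁ y + x)
    ext <;> simp

lemma contractible_distinguished (X : HMF R w) :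
    contractibleTriangle X ∈ distinguishedTriangles R w := by
  obtain ⟨X⟩ := X
  refine ⟨_, _, 𝟙 X, ⟨?_⟩⟩
  have h := isZero_cone_id X
  exact Triangle.isoMk _ _ (Iso.refl _) (Iso.refl _)
    ((isZero_zero (HMF R w)).iso h) (by simp [coneTriangle]; rfl) (h.eq_of_tgt _ _) ((isZero_zero (HMF R w)).eq_of_src _ _)

lemma distinguished_cocone_triangle {X Y : HMF R w} (f : X ⟶ Y) :
    ∃ (Z : HMF R w) (g : Y ⟶ Z) (h : Z ⟶ X⟦(1 : ℤ)⟧),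
      Triangle.mk f g h ∈ distinguishedTriangles R w := by
  obtain ⟨f, rfl⟩ := (quotient R w).map_surjective f
  exact ⟨_, _, _, ⟨_, _, f, ⟨Iso.refl _⟩⟩⟩

/-- The morphism of cones induced by a square which commutes up to homotopy. -/
lemma exists_cone_map {X Y X' Y' : MatrixFactorization R w} (f : X ⟶ Y) (f' : X' ⟶ Y')
    (a : X ⟶ X') (b : Y ⟶ Y') (H : homotopic w (f ≫ b) (a ≫ f')) :
    ∃ c : cone f ⟶ cone f', coneIncl f ≫ c = b ≫ coneIncl f' ∧
      coneProj f ≫ a⟦(1 : ℤ)⟧' = c ≫ coneProj f' := by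
  obtain ⟨h₀, h₁, H₀, H₁⟩ := H
  refine ⟨⟨LinearMap.prod (b.f₀.coprod h₁) (a.f₁ ∘ₗ LinearMap.snd R _ _),
    LinearMap.prod (b.f₁.coprod h₀) (a.f₀ ∘ₗ LinearMap.snd R _ _), ?_, ?_⟩, ?_, ?_⟩
  · rintro ⟨y, x⟩
    have := H₁ x
    change (Y'.d₀ (b.f₀ y + h₁ x) + f'.f₁ (a.f₁ x), -X'.d₁ (a.f₁ x)) =
      (b.f₁ (Y.d₀ y + f.f₁ x) + h₀ (-X.d₁ x), a.f₀ (-X.d₁ x))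
    simp only [comp_f₁, sub_eq_iff_eq_add] at this
    ext
    · simp [this]; abel
    · simp
  · rintro ⟨y, x⟩
    have := H₀ x
    change (Y'.d₁ (b.f₁ y + h₀ x) + f'.f₀ (a.f₀ x), -X'.d₀ (a.f₀ x)) =
      (b.f₀ (Y.d₁ y + f.f₀ x) + h₁ (-X.d₀ x), a.f₁ (-X.d₀ x))
    simp only [comp_f₀, sub_eq_iff_eq_add] at this
    ext
    · simp [this]; abel
    · simp
  · ext x
    · change (b.f₀ x + h₁ 0, a.f₁ 0) = (b.f₀ x, (0 : X'.X₁))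
      simp
    · change (b.f₁ x + h₀ 0, a.f₀ 0) = (b.f₁ x, (0 : X'.X₀))
      simp
  · ext x <;> rfl

lemma exists_cone_map_quotient {X Y X' Y' : MatrixFactorization R w} (f : X ⟶ Y) (f' : X' ⟶ Y')
    (a : (quotient R w).obj X ⟶ (quotient R w).obj X')
    (b : (quotient R w).obj Y ⟶ (quotient R w).obj Y')
    (fac : (quotient R w).map f ≫ b = a ≫ (quotient R w).map f') :
    ∃ c : (quotient R w).obj (cone f) ⟶ (quotient R w).obj (cone f'),
      (quotient R w).map (coneIncl f) ≫ c = b ≫ (quotient R w).map (coneIncl f') ∧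
      ((quotient R w).map (coneProj f) ≫ ((quotient R w).commShiftIso (1 : ℤ)).hom.app X) ≫
          a⟦(1 : ℤ)⟧' =
        c ≫ (quotient R w).map (coneProj f') ≫
          ((quotient R w).commShiftIso (1 : ℤ)).hom.app X' := by
  obtain ⟨a, rfl⟩ := (quotient R w).map_surjective a
  obtain ⟨b, rfl⟩ := (quotient R w).map_surjective b
  rw [← Functor.map_comp, ← Functor.map_comp, quotient_map_eq_iff] at fac
  obtain ⟨c, hc₂, hc₃⟩ := exists_cone_map f f' a b fac
  refine ⟨(quotient R w).map c, ?_, ?_⟩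
  · rw [← Functor.map_comp, hc₂, Functor.map_comp]
  · rw [← Functor.map_comp_assoc, ← hc₃, Category.assoc,
      ← Functor.commShiftIso_hom_naturality, Functor.map_comp, Category.assoc]

lemma complete_of_iso {C : Type*} [Category* C] [HasShift C ℤ] {T₁ T₂ S₁ S₂ : Triangle C}
    (e₁ : T₁ ≅ S₁) (e₂ : T₂ ≅ S₂)
    (hS : ∀ (a : S₁.obj₁ ⟶ S₂.obj₁) (b : S₁.obj₂ ⟶ S₂.obj₂), S₁.mor₁ ≫ b = a ≫ S₂.mor₁ →
      ∃ c : S₁.obj₃ ⟶ S₂.obj₃, S₁.mor₂ ≫ c = b ≫ S₂.mor₂ ∧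
        S₁.mor₃ ≫ a⟦(1 : ℤ)⟧' = c ≫ S₂.mor₃)
    (a : T₁.obj₁ ⟶ T₂.obj₁) (b : T₁.obj₂ ⟶ T₂.obj₂) (fac : T₁.mor₁ ≫ b = a ≫ T₂.mor₁) :
    ∃ c : T₁.obj₃ ⟶ T₂.obj₃, T₁.mor₂ ≫ c = b ≫ T₂.mor₂ ∧
      T₁.mor₃ ≫ a⟦(1 : ℤ)⟧' = c ≫ T₂.mor₃ := by
  obtain ⟨c, h₂, h₃⟩ := hS (e₁.inv.hom₁ ≫ a ≫ e₂.hom.hom₁) (e₁.inv.hom₂ ≫ b ≫ e₂.hom.hom₂) (by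
    rw [e₁.inv.comm₁_assoc, reassoc_of% fac, e₂.hom.comm₁, Category.assoc, Category.assoc])
  let γ : S₁ ⟶ S₂ := Triangle.homMk S₁ S₂ (e₁.inv.hom₁ ≫ a ≫ e₂.hom.hom₁)
    (e₁.inv.hom₂ ≫ b ≫ e₂.hom.hom₂) c (by
      rw [e₁.inv.comm₁_assoc, reassoc_of% fac, e₂.hom.comm₁, Category.assoc, Category.assoc]) h₂ h₃
  have h₁ : (e₁.hom ≫ γ ≫ e₂.inv).hom₁ = a := by simp [γ]
  have h₂ : (e₁.hom ≫ γ ≫ e₂.inv).hom₂ = b := by simp [γ]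
  refine ⟨(e₁.hom ≫ γ ≫ e₂.inv).hom₃, ?_, ?_⟩
  · rw [TriangleMorphism.comm₂, h₂]
  · rw [← TriangleMorphism.comm₃, h₁]

lemma complete_distinguished_triangle_morphism (T₁ T₂ : Triangle (HMF R w))
    (hT₁ : T₁ ∈ distinguishedTriangles R w) (hT₂ : T₂ ∈ distinguishedTriangles R w)
    (a : T₁.obj₁ ⟶ T₂.obj₁) (b : T₁.obj₂ ⟶ T₂.obj₂) (fac : T₁.mor₁ ≫ b = a ≫ T₂.mor₁) :
    ∃ (c : T₁.obj₃ ⟶ T₂.obj₃), T₁.mor₂ ≫ c = b ≫ T₂.mor₂ ∧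
      T₁.mor₃ ≫ a⟦(1 : ℤ)⟧' = c ≫ T₂.mor₃ := by
  obtain ⟨X, Y, f, ⟨e₁⟩⟩ := hT₁
  obtain ⟨X', Y', f', ⟨e₂⟩⟩ := hT₂
  exact complete_of_iso e₁ e₂ (exists_cone_map_quotient f f') a b fac

section Rotate

variable {X Y : MatrixFactorization R w} (f : X ⟶ Y)

/-- The map `ΣX ⟶ cone (coneIncl f)`, `x ↦ ((0, x), - f x)`. -/
def toDoubleCone : X⟦(1 : ℤ)⟧ ⟶ cone (coneIncl f) where
  f₀ := LinearMap.prod (LinearMap.inr R Y.X₀ X.X₁) (-f.f₁)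
  f₁ := LinearMap.prod (LinearMap.inr R Y.X₁ X.X₀) (-f.f₀)
  comm₀ (x : X.X₁) := by
    change (((Y.d₀ 0 + f.f₁ x, -X.d₁ x) + (-f.f₁ x, 0), -Y.d₁ (-f.f₁ x)) :
      (Y.X₁ × X.X₀) × Y.X₀) = ((0, -X.d₁ x), -f.f₀ (-X.d₁ x))
    simp
  comm₁ (x : X.X₀) := by
    change (((Y.d₁ 0 + f.f₀ x, -X.d₀ x) + (-f.f₀ x, 0), -Y.d₀ (-f.f₀ x)) :
      (Y.X₀ × X.X₁) × Y.X₁) = ((0, -X.d₀ x), -f.f₁ (-X.d₀ x))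
    simp

/-- The map `cone (coneIncl f) ⟶ ΣX`, `((y, x), y') ↦ x`. -/
def ofDoubleCone : cone (coneIncl f) ⟶ X⟦(1 : ℤ)⟧ where
  f₀ := LinearMap.snd R Y.X₀ X.X₁ ∘ₗ LinearMap.fst R (Y.X₀ × X.X₁) Y.X₁
  f₁ := LinearMap.snd R Y.X₁ X.X₀ ∘ₗ LinearMap.fst R (Y.X₁ × X.X₀) Y.X₀
  comm₀ := by
    rintro ⟨⟨y, x⟩, y'⟩
    change -X.d₁ x = -X.d₁ x + 0
    simp
  comm₁ := by
    rintro ⟨⟨y, x⟩, y'⟩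
    change -X.d₀ x = -X.d₀ x + 0
    simp

lemma toDoubleCone_ofDoubleCone : toDoubleCone f ≫ ofDoubleCone f = 𝟙 _ := rfl

lemma ofDoubleCone_toDoubleCone : homotopic w (ofDoubleCone f ≫ toDoubleCone f) (𝟙 _) := by
  refine ⟨LinearMap.inr R (Y.X₁ × X.X₀) Y.X₀ ∘ₗ
      (-(LinearMap.fst R Y.X₀ X.X₁ ∘ₗ LinearMap.fst R (Y.X₀ × X.X₁) Y.X₁)),
    LinearMap.inr R (Y.X₀ × X.X₁) Y.X₁ ∘ₗ
      (-(LinearMap.fst R Y.X₁ X.X₀ ∘ₗ LinearMap.fst R (Y.X₁ × X.X₀) Y.X₀)), ?_, ?_⟩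
  · rintro ⟨⟨y, x⟩, y'⟩
    change (((0 : Y.X₀), x), -f.f₁ x) - ((y, x), y') =
      ((Y.d₁ 0 + f.f₀ 0, -X.d₀ 0) + (-y, 0), -Y.d₀ (-y)) +
        ((0 : Y.X₀ × X.X₁), -(Y.d₀ y + f.f₁ x + y'))
    ext <;> simp; abel
  · rintro ⟨⟨y, x⟩, y'⟩
    change (((0 : Y.X₁), x), -f.f₀ x) - ((y, x), y') =
      ((Y.d₀ 0 + f.f₁ 0, -X.d₁ 0) + (-y, 0), -Y.d₁ (-y)) +
        ((0 : Y.X₁ × X.X₀), -(Y.d₁ y + f.f₀ x + y'))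
    ext <;> simp; abel

lemma coneProj_toDoubleCone :
    homotopic w (coneProj f ≫ toDoubleCone f) (coneIncl (coneIncl f)) := by
  refine ⟨LinearMap.inr R (Y.X₁ × X.X₀) Y.X₀ ∘ₗ (-LinearMap.fst R Y.X₀ X.X₁),
    LinearMap.inr R (Y.X₀ × X.X₁) Y.X₁ ∘ₗ (-LinearMap.fst R Y.X₁ X.X₀), ?_, ?_⟩
  · rintro ⟨y, x⟩
    change (((0 : Y.X₀), x), -f.f₁ x) - ((y, x), 0) =
      ((Y.d₁ 0 + f.f₀ 0, -X.d₀ 0) + (-y, 0), -Y.d₀ (-y)) +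
        ((0 : Y.X₀ × X.X₁), -(Y.d₀ y + f.f₁ x))
    ext <;> simp; try abel
  · rintro ⟨y, x⟩
    change (((0 : Y.X₁), x), -f.f₀ x) - ((y, x), 0) =
      ((Y.d₀ 0 + f.f₁ 0, -X.d₁ 0) + (-y, 0), -Y.d₁ (-y)) +
        ((0 : Y.X₁ × X.X₀), -(Y.d₁ y + f.f₀ x))
    ext <;> simp; try abel

/-- Up to homotopy, `ΣX` is the cone of `Y ⟶ cone f`. -/
def doubleConeIso :
    (quotient R w).obj (X⟦(1 : ℤ)⟧) ≅ (quotient R w).obj (cone (coneIncl f)) where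
  hom := (quotient R w).map (toDoubleCone f)
  inv := (quotient R w).map (ofDoubleCone f)
  hom_inv_id := by rw [← Functor.map_comp, toDoubleCone_ofDoubleCone, CategoryTheory.Functor.map_id]
  inv_hom_id := by
    rw [← Functor.map_comp, ← CategoryTheory.Functor.map_id, quotient_map_eq_iff]
    exact ofDoubleCone_toDoubleCone f

lemma doubleConeIso_comm₃ :
    ((quotient R w).map (-f⟦(1 : ℤ)⟧') ≫ ((quotient R w).commShiftIso (1 : ℤ)).hom.app Y) ≫
        (𝟙 ((quotient R w).obj Y))⟦(1 : ℤ)⟧' =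
      (quotient R w).map (toDoubleCone f) ≫ (quotient R w).map (coneProj (coneIncl f)) ≫
        ((quotient R w).commShiftIso (1 : ℤ)).hom.app Y := by
  rw [CategoryTheory.Functor.map_id, ← Functor.map_comp_assoc]
  exact Category.comp_id _

/-- The rotation of a standard triangle is isomorphic to a standard triangle. -/
def rotateIso : ((quotient R w).mapTriangle.obj (coneTriangle f)).rotate ≅
    (quotient R w).mapTriangle.obj (coneTriangle (coneIncl f)) :=
  Iso.trans (Y := (quotient R w).mapTriangle.obj (coneTriangle f).rotate)
    ((quotient R w).mapTriangleRotateIso.app (coneTriangle f))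
    (Triangle.isoMk ((quotient R w).mapTriangle.obj (coneTriangle f).rotate) _ (Iso.refl _)
      (Iso.refl _) (doubleConeIso f)
      ((Category.comp_id _).trans (Category.id_comp _).symm)
      (((quotient R w).map_comp (coneProj f) (toDoubleCone f)).symm.trans
        (((quotient_map_eq_iff _ _).2 (coneProj_toDoubleCone f)).trans (Category.id_comp _).symm))
      (doubleConeIso_comm₃ f))

/-- The isomorphism `-1` between the shift of a cone and the cone of the negative of the shift. -/
def shiftConeIso : (cone f)⟦(-1 : ℤ)⟧ ≅ cone (-f⟦(-1 : ℤ)⟧') where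
  hom :=
    { f₀ := (-LinearMap.id : (Y.X₁ × X.X₀) →ₗ[R] (Y.X₁ × X.X₀))
      f₁ := (-LinearMap.id : (Y.X₀ × X.X₁) →ₗ[R] (Y.X₀ × X.X₁))
      comm₀ := by
        rintro ⟨y, x⟩
        change (-Y.d₁ (-y) + -f.f₀ (-x), - -X.d₀ (-x)) = -(-(Y.d₁ y + f.f₀ x, -X.d₀ x))
        ext <;> simp
      comm₁ := by
        rintro ⟨y, x⟩
        change (-Y.d₀ (-y) + -f.f₁ (-x), - -X.d₁ (-x)) = -(-(Y.d₀ y + f.f₁ x, -X.d₁ x))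
        ext <;> simp }
  inv :=
    { f₀ := (-LinearMap.id : (Y.X₁ × X.X₀) →ₗ[R] (Y.X₁ × X.X₀))
      f₁ := (-LinearMap.id : (Y.X₀ × X.X₁) →ₗ[R] (Y.X₀ × X.X₁))
      comm₀ := by
        intro z
        obtain ⟨y, x⟩ : Y.X₁ × X.X₀ := z
        change -(Y.d₁ (-y) + f.f₀ (-x), -X.d₀ (-x)) = -(-Y.d₁ y + -f.f₀ x, - -X.d₀ x)
        ext <;> simp
      comm₁ := by
        intro z
        obtain ⟨y, x⟩ : Y.X₀ × X.X₁ := z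
        change -(Y.d₀ (-y) + f.f₁ (-x), -X.d₁ (-x)) = -(-Y.d₀ y + -f.f₁ x, - -X.d₁ x)
        ext <;> simp }
  hom_inv_id := by
    refine hom_ext (fun x => ?_) (fun x => ?_)
    · exact neg_neg (show Y.X₁ × X.X₀ from x)
    · exact neg_neg (show Y.X₀ × X.X₁ from x)
  inv_hom_id := by
    refine hom_ext (fun x => ?_) (fun x => ?_)
    · exact neg_neg (show Y.X₁ × X.X₀ from x)
    · exact neg_neg (show Y.X₀ × X.X₁ from x)

lemma negOnePow_smul {C : Type*} [Category* C] [Preadditive C] {A B : C} (g : A ⟶ B) :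
    (-1 : ℤ).negOnePow • g = -g := by simp

lemma shiftConeIso_comm₁ : ((-1 : ℤ).negOnePow • f⟦(-1 : ℤ)⟧') ≫ 𝟙 _ = 𝟙 _ ≫ (-f⟦(-1 : ℤ)⟧') := by
  rw [negOnePow_smul, Category.comp_id, Category.id_comp]

lemma shiftConeIso_comm₂ : ((-1 : ℤ).negOnePow • (coneIncl f)⟦(-1 : ℤ)⟧') ≫ (shiftConeIso f).hom =
    𝟙 _ ≫ coneIncl (-f⟦(-1 : ℤ)⟧') := by
  rw [negOnePow_smul, Category.id_comp]
  refine hom_ext (fun y => ?_) (fun y => ?_)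
  · change - -(y, (0 : X.X₀)) = (y, 0)
    simp
  · change - -(y, (0 : X.X₁)) = (y, 0)
    simp

lemma shiftConeIso_comm₃ :
    ((-1 : ℤ).negOnePow • (coneProj f)⟦(-1 : ℤ)⟧' ≫ (shiftFunctorComm _ 1 (-1)).hom.app X) ≫
        (𝟙 (X⟦(-1 : ℤ)⟧))⟦(1 : ℤ)⟧' =
      (shiftConeIso f).hom ≫ coneProj (-f⟦(-1 : ℤ)⟧') := by
  rw [negOnePow_smul, CategoryTheory.Functor.map_id, Category.comp_id]
  refine hom_ext (fun x => ?_) (fun x => ?_)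
  · rfl
  · rfl

/-- The triangle `T⟦-1⟧` for a standard triangle `T` is isomorphic to a standard triangle. -/
def shiftIso : (Triangle.shiftFunctor _ (-1)).obj (coneTriangle f) ≅
    coneTriangle (-f⟦(-1 : ℤ)⟧') :=
  Triangle.isoMk _ _ (Iso.refl _) (Iso.refl _) (shiftConeIso f) (shiftConeIso_comm₁ f)
    (shiftConeIso_comm₂ f) (shiftConeIso_comm₃ f)

/-- The same in the homotopy category. -/
def shiftIso' : (Triangle.shiftFunctor _ (-1)).obj ((quotient R w).mapTriangle.obj (coneTriangle f))
    ≅ (quotient R w).mapTriangle.obj (coneTriangle (-f⟦(-1 : ℤ)⟧')) :=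
  ((quotient R w).mapTriangleCommShiftIso (-1)).symm.app (coneTriangle f) ≪≫
    (quotient R w).mapTriangle.mapIso (shiftIso f)

end Rotate

lemma rotate_distinguished' (T : Triangle (HMF R w)) (hT : T ∈ distinguishedTriangles R w) :
    T.rotate ∈ distinguishedTriangles R w := by
  obtain ⟨X, Y, f, ⟨e⟩⟩ := hT
  exact ⟨_, _, _, ⟨(rotate _).mapIso e ≪≫ rotateIso f⟩⟩

lemma shift_distinguished (T : Triangle (HMF R w)) (hT : T ∈ distinguishedTriangles R w) :
    (Triangle.shiftFunctor _ (-1)).obj T ∈ distinguishedTriangles R w := by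
  obtain ⟨X, Y, f, ⟨e⟩⟩ := hT
  exact ⟨_, _, _, ⟨(Triangle.shiftFunctor _ (-1)).mapIso e ≪≫ shiftIso' f⟩⟩

lemma rotate_distinguished_triangle (T : Triangle (HMF R w)) :
    T ∈ distinguishedTriangles R w ↔ T.rotate ∈ distinguishedTriangles R w := by
  refine ⟨rotate_distinguished' T, fun hT => ?_⟩
  refine isomorphic_distinguished _ (shift_distinguished _ (rotate_distinguished' _
    (rotate_distinguished' _ hT))) _ ((triangleRotation _).unitIso.app T ≪≫
      (invRotateIsoRotateRotateShiftFunctorNegOne _).app T.rotate)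

/-- The triangulated structure on the homotopy category: a triangle is distinguished when it is
isomorphic to a standard triangle `X ⟶ Y ⟶ cone f ⟶ ΣX`. -/
instance : Pretriangulated (HMF R w) where
  distinguishedTriangles := distinguishedTriangles R w
  isomorphic_distinguished := isomorphic_distinguished
  contractible_distinguished := contractible_distinguished
  distinguished_cocone_triangle := distinguished_cocone_triangle
  rotate_distinguished_triangle := rotate_distinguished_triangle
  complete_distinguished_triangle_morphism := complete_distinguished_triangle_morphism

end HMF

/-- A quadratic form `q` on `ℝⁿ` as a polynomial in the coordinates: `∑ i j, b(eᵢ, eⱼ) xᵢ xⱼ`, where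
`b` is the symmetric bilinear form with `b(v, v) = q v`. -/
def quadraticPolynomial {n : ℕ} (q : QuadraticForm ℝ (Fin n → ℝ)) : MvPolynomial (Fin n) ℝ :=
  ∑ i, ∑ j, MvPolynomial.C (q.toMatrix' i j) * MvPolynomial.X i * MvPolynomial.X j

lemma eval_quadraticPolynomial {n : ℕ} (q : QuadraticForm ℝ (Fin n → ℝ)) (v : Fin n → ℝ) :
    MvPolynomial.eval v (quadraticPolynomial q) = q v := by
  have h : ∑ i, ∑ j, v i * q.toMatrix' i j * v j = q v := by
    have := Matrix.toBilin'_apply (R₁ := ℝ) q.toMatrix' v v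
    rw [← this, QuadraticForm.toMatrix']
    change Matrix.toLinearMap₂' ℝ (LinearMap.toMatrix₂' ℝ (QuadraticMap.associated q)) v v = q v
    rw [Matrix.toLinearMap₂'_toMatrix']
    exact QuadraticMap.associated_eq_self_apply ℝ q v
  rw [← h]
  simp only [quadraticPolynomial, map_sum, map_mul, MvPolynomial.eval_C, MvPolynomial.eval_X]
  exact Finset.sum_congr rfl fun i _ => Finset.sum_congr rfl fun j _ => by ring

/-- The polynomial `q + x_{n+1}² + ⋯ + x_{n+8}²` in `n + 8` variables. -/
def quadraticPolynomialAddEight {n : ℕ} (q : QuadraticForm ℝ (Fin n → ℝ)) :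
    MvPolynomial (Fin (n + 8)) ℝ :=
  MvPolynomial.rename (Fin.castAdd 8) (quadraticPolynomial q) +
    ∑ i : Fin 8, MvPolynomial.X (Fin.natAdd n i) ^ 2

end

/-! The equivalence is M ↦ M ⊗ (A, A'), where A = ∑ xₙ₊ᵢ Lᵢ, Lᵢ is left multiplication by the i-th
octonion unit and A' is the transpose of A. The octonion norm is multiplicative, so A A' = A' A = ∑
xₙ₊ᵢ². Tensoring with any factorization respects homotopies, shifts, cones and scalars
(`TwistData`). What has to be proved is that this functor is an equivalence, and that is done by
comparison with Clifford modules.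

A graded module V over the Clifford algebra of q gives the factorization ∑ xᵢ γᵢ
(`CliffordData.toMF`). For nondegenerate q, every object of the homotopy category is isomorphic to
such a factorization, and homotopy classes of morphisms between two of them are exactly the
morphisms of Clifford modules. Both facts rest on one contraction. The complex of matrices of power
series from V to W is a Koszul complex for the graded commutators ιᵢ with γᵢ, and nondegeneracy
supplies operators εₖ with ιᵢ εₖ + εₖ ιᵢ = δᵢₖ. Dividing by one variable after another contracts the
complex onto constants (`exists_koszul_homotopy`). A cycle is therefore homotopic to a constant one
(`exists_homotopic_toMF`), and homotopic constants are equal (`Hom.eq_of_homotopic`). For objects,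
unit entries of the differential split off as contractible summands. What remains has no constant
terms, and a change of basis, found as a fixed point by means of the same contraction, carries it to
its linear part (`exists_toMF_iso_of_reduced`, `exists_toMF_iso`).

On Clifford modules the functor becomes V ↦ S ⊗ V, with S the spinor module of dimension 8 + 8 for
eight squares. The relation between ι and ε, applied now to real matrices S → U, shows that each of
the eight conditions ιᵢ φ = 0 halves the dimension. Hence dim U = 16 · dim Hom(S, U), where Hom
means graded intertwiners. For U = S only scalars remain, so morphisms S ⊗ V → S ⊗ W come from V → W
(`exists_eq_tensorSpinor`). For general U the same relation shows that intertwiners generate U.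
Evaluation S ⊗ Hom(S, U) → U is then a surjection between spaces of equal dimension
(`exists_inverse_eval`), which gives essential surjectivity. -/

noncomputable section

/-! ### Tensoring with a factorization (A, A'): functor, homotopies and shifts. -/

open scoped TensorProduct

/-- The action of a matrix over `S` on tuples of elements of an `S`-module. -/
def Matrix.tupleMap {S : Type*} [CommRing S] {κ κ' : Type*} [Fintype κ'] (A : Matrix κ κ' S)
    (X : Type*) [AddCommGroup X] [Module S X] : (κ' → X) →ₗ[S] (κ → X) :=
  LinearMap.pi fun a => ∑ b, A a b • LinearMap.proj b

section TupleMap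

variable {S : Type*} [CommRing S] {κ κ' κ'' : Type*} [Fintype κ'] [Fintype κ'']
  {X Y : Type*} [AddCommGroup X] [Module S X] [AddCommGroup Y] [Module S Y]

lemma Matrix.tupleMap_apply (A : Matrix κ κ' S) (x : κ' → X) (a : κ) :
    A.tupleMap X x a = ∑ b, A a b • x b := by
  simp [Matrix.tupleMap]

lemma Matrix.tupleMap_tupleMap (A : Matrix κ κ' S) (A' : Matrix κ' κ'' S) (x : κ'' → X) :
    A.tupleMap X (A'.tupleMap X x) = (A * A').tupleMap X x := by
  ext a
  simp only [Matrix.tupleMap_apply, Matrix.mul_apply, Finset.smul_sum, Finset.sum_smul, smul_smul]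
  exact Finset.sum_comm

lemma Matrix.tupleMap_smul_one [DecidableEq κ'] (c : S) (x : κ' → X) :
    (c • (1 : Matrix κ' κ' S)).tupleMap X x = c • x := by
  ext a
  simp [Matrix.tupleMap_apply, Matrix.one_apply, ite_smul]

lemma Matrix.tupleMap_compLeft (A : Matrix κ κ' S) (f : X →ₗ[S] Y) (x : κ' → X) :
    f.compLeft κ (A.tupleMap X x) = A.tupleMap Y (f.compLeft κ' x) := by
  ext a
  simp [Matrix.tupleMap_apply]

end TupleMap

/-- Tuples of the base change of a linear map. -/
abbrev LinearMap.tupleBaseChange {R : Type*} (S : Type*) [CommRing R] [CommRing S] [Algebra R S]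
    (κ : Type*) {X Y : Type*} [AddCommGroup X] [Module R X] [AddCommGroup Y] [Module R Y]
    (f : X →ₗ[R] Y) : (κ → S ⊗[R] X) →ₗ[S] (κ → S ⊗[R] Y) :=
  (f.baseChange S).compLeft κ

section TupleBaseChange

variable {R : Type*} (S : Type*) [CommRing R] [CommRing S] [Algebra R S]
    (κ : Type*) {X Y Z : Type*} [AddCommGroup X] [Module R X] [AddCommGroup Y] [Module R Y]
    [AddCommGroup Z] [Module R Z]

lemma LinearMap.tupleBaseChange_comp (g : Y →ₗ[R] Z) (f : X →ₗ[R] Y) :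
    (g ∘ₗ f).tupleBaseChange S κ = g.tupleBaseChange S κ ∘ₗ f.tupleBaseChange S κ := by
  ext x a
  simp [LinearMap.baseChange_comp]

lemma LinearMap.tupleBaseChange_id :
    (LinearMap.id : X →ₗ[R] X).tupleBaseChange S κ = LinearMap.id := by
  ext x a
  simp

lemma LinearMap.tupleBaseChange_add (f g : X →ₗ[R] Y) :
    (f + g).tupleBaseChange S κ = f.tupleBaseChange S κ + g.tupleBaseChange S κ := by
  ext x a
  simp [LinearMap.baseChange_add]

lemma LinearMap.tupleBaseChange_neg (f : X →ₗ[R] Y) :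
    (-f).tupleBaseChange S κ = -f.tupleBaseChange S κ := by
  ext x a
  simp [LinearMap.baseChange_neg]

lemma LinearMap.tupleBaseChange_sub (f g : X →ₗ[R] Y) :
    (f - g).tupleBaseChange S κ = f.tupleBaseChange S κ - g.tupleBaseChange S κ := by
  ext x a
  simp [LinearMap.baseChange_sub]

lemma LinearMap.tupleBaseChange_smul (r : R) (f : X →ₗ[R] Y) :
    (r • f).tupleBaseChange S κ = algebraMap R S r • f.tupleBaseChange S κ := by
  ext x a
  simp [LinearMap.baseChange_smul]

end TupleBaseChange

section TwistDiff

variable {R : Type*} {S : Type*} [CommRing R] [CommRing S] [Algebra R S]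
    {κ : Type*} [Fintype κ] {X₀ X₁ Y₀ Y₁ : Type*} [AddCommGroup X₀] [Module R X₀]
    [AddCommGroup X₁] [Module R X₁] [AddCommGroup Y₀] [Module R Y₀]
    [AddCommGroup Y₁] [Module R Y₁]

/-- The map `(a, b) ↦ (d₀ a + B b, A a + d₁ b)`. -/
def twistDiff (B A : Matrix κ κ S) (d₀ : X₀ →ₗ[R] X₁) (d₁ : X₁ →ₗ[R] X₀) :
    ((κ → S ⊗[R] X₀) × (κ → S ⊗[R] X₁)) →ₗ[S] ((κ → S ⊗[R] X₁) × (κ → S ⊗[R] X₀)) :=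
  (d₀.tupleBaseChange S κ ∘ₗ LinearMap.fst S _ _ + B.tupleMap _ ∘ₗ LinearMap.snd S _ _).prod
    (A.tupleMap _ ∘ₗ LinearMap.fst S _ _ + d₁.tupleBaseChange S κ ∘ₗ LinearMap.snd S _ _)

lemma twistDiff_apply (B A : Matrix κ κ S) (d₀ : X₀ →ₗ[R] X₁) (d₁ : X₁ →ₗ[R] X₀) (x) :
    twistDiff B A d₀ d₁ x = (d₀.tupleBaseChange S κ x.1 + B.tupleMap _ x.2,
      A.tupleMap _ x.1 + d₁.tupleBaseChange S κ x.2) := rfl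

lemma Matrix.tupleMap_neg (A : Matrix κ κ S) (X : Type*) [AddCommGroup X] [Module S X] :
    (-A).tupleMap X = -A.tupleMap X := by
  ext x a
  simp [Matrix.tupleMap_apply]

lemma LinearMap.tupleBaseChange_eq_smul (f : X₁ →ₗ[R] X₀) (g : X₀ →ₗ[R] X₁) (r : R)
    (h : ∀ x, f (g x) = r • x) (x : κ → S ⊗[R] X₀) :
    f.tupleBaseChange S κ (g.tupleBaseChange S κ x) = algebraMap R S r • x := by
  rw [← LinearMap.comp_apply, ← LinearMap.tupleBaseChange_comp,
    show f ∘ₗ g = r • LinearMap.id from LinearMap.ext h,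
    LinearMap.tupleBaseChange_smul, LinearMap.tupleBaseChange_id]
  rfl

/-- The matrices act S-linearly on the tuple index and so commute with base changed maps. The second
factor carries the opposite matrices, so the mixed terms cancel and only `d² = r` and `-B A = c`
survive. -/
lemma twistDiff_twistDiff [DecidableEq κ] (B A : Matrix κ κ S) (c : S) (hBA : B * A = -(c • 1))
    (hAB : A * B = -(c • 1)) (d₀ : X₀ →ₗ[R] X₁) (d₁ : X₁ →ₗ[R] X₀) (r : R)
    (h₁₀ : ∀ x, d₁ (d₀ x) = r • x) (h₀₁ : ∀ x, d₀ (d₁ x) = r • x) (x) :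
    twistDiff (-B) (-A) d₁ d₀ (twistDiff B A d₀ d₁ x) = (algebraMap R S r + c) • x := by
  simp only [twistDiff_apply]
  refine Prod.ext ?_ ?_
  · simp only [map_add, LinearMap.tupleBaseChange_eq_smul _ _ _ h₁₀, Matrix.tupleMap_neg,
      LinearMap.neg_apply, Matrix.tupleMap_tupleMap, hBA, Matrix.tupleMap_smul_one,
      Matrix.tupleMap_compLeft, add_smul,
      Prod.fst_add, Prod.smul_fst]
    abel
  · simp only [map_add, LinearMap.tupleBaseChange_eq_smul _ _ _ h₀₁, Matrix.tupleMap_neg,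
      LinearMap.neg_apply, Matrix.tupleMap_tupleMap, hAB, Matrix.tupleMap_smul_one,
      Matrix.tupleMap_compLeft, add_smul,
      Prod.snd_add, Prod.smul_snd]
    abel

/-- This is what makes tensoring commute with `Σ` strictly, through identity maps: the sign in `Σ`
turns (-A', A) into (A', -A). -/
lemma twistDiff_neg (B A : Matrix κ κ S) (d₀ : X₀ →ₗ[R] X₁) (d₁ : X₁ →ₗ[R] X₀) :
    twistDiff (-B) (-A) (-d₀) (-d₁) = -twistDiff B A d₀ d₁ := by
  refine LinearMap.ext fun x => ?_
  simp only [LinearMap.neg_apply, twistDiff_apply, LinearMap.tupleBaseChange_neg,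
    Matrix.tupleMap_neg, Prod.neg_mk, neg_add]

lemma twistDiff_prodMap (B A : Matrix κ κ S) (d₀ : X₀ →ₗ[R] X₁) (d₁ : X₁ →ₗ[R] X₀)
    (e₀ : Y₀ →ₗ[R] Y₁) (e₁ : Y₁ →ₗ[R] Y₀) (f₀ : X₀ →ₗ[R] Y₀) (f₁ : X₁ →ₗ[R] Y₁)
    (h₀ : ∀ x, e₀ (f₀ x) = f₁ (d₀ x)) (h₁ : ∀ x, e₁ (f₁ x) = f₀ (d₁ x)) (x) :
    twistDiff B A e₀ e₁ ((f₀.tupleBaseChange S κ).prodMap (f₁.tupleBaseChange S κ) x) =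
      (f₁.tupleBaseChange S κ).prodMap (f₀.tupleBaseChange S κ) (twistDiff B A d₀ d₁ x) := by
  have h₀' := fun x => LinearMap.congr_fun (congrArg (LinearMap.tupleBaseChange S κ)
    (show e₀ ∘ₗ f₀ = f₁ ∘ₗ d₀ from LinearMap.ext h₀)) x
  have h₁' := fun x => LinearMap.congr_fun (congrArg (LinearMap.tupleBaseChange S κ)
    (show e₁ ∘ₗ f₁ = f₀ ∘ₗ d₁ from LinearMap.ext h₁)) x
  simp only [LinearMap.tupleBaseChange_comp, LinearMap.comp_apply] at h₀' h₁'
  simp only [twistDiff_apply, LinearMap.prodMap_apply, map_add, Matrix.tupleMap_compLeft, h₀', h₁']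

/-- The homotopy h is extended without signs. The two differentials around it carry opposite
matrices, so the mixed terms cancel as in d² = w. -/
lemma twistDiff_homotopy (B A : Matrix κ κ S) (d₀ : X₀ →ₗ[R] X₁) (d₁ : X₁ →ₗ[R] X₀)
    (e₀ : Y₀ →ₗ[R] Y₁) (e₁ : Y₁ →ₗ[R] Y₀) (f₀ g₀ : X₀ →ₗ[R] Y₀) (f₁ g₁ : X₁ →ₗ[R] Y₁)
    (h₀ : X₀ →ₗ[R] Y₁) (h₁ : X₁ →ₗ[R] Y₀) (H₀ : ∀ x, f₀ x - g₀ x = e₁ (h₀ x) + h₁ (d₀ x))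
    (H₁ : ∀ x, f₁ x - g₁ x = e₀ (h₁ x) + h₀ (d₁ x)) (x) :
    (f₀.tupleBaseChange S κ).prodMap (f₁.tupleBaseChange S κ) x -
      (g₀.tupleBaseChange S κ).prodMap (g₁.tupleBaseChange S κ) x =
      twistDiff (-B) (-A) e₁ e₀ ((h₀.tupleBaseChange S κ).prodMap (h₁.tupleBaseChange S κ) x) +
      (h₁.tupleBaseChange S κ).prodMap (h₀.tupleBaseChange S κ) (twistDiff B A d₀ d₁ x) := by
  have e₀' := fun x => LinearMap.congr_fun (congrArg (LinearMap.tupleBaseChange S κ)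
    (show f₀ - g₀ = e₁ ∘ₗ h₀ + h₁ ∘ₗ d₀ from LinearMap.ext H₀)) x
  have e₁' := fun x => LinearMap.congr_fun (congrArg (LinearMap.tupleBaseChange S κ)
    (show f₁ - g₁ = e₀ ∘ₗ h₁ + h₀ ∘ₗ d₁ from LinearMap.ext H₁)) x
  simp only [LinearMap.tupleBaseChange_comp, LinearMap.tupleBaseChange_add,
    LinearMap.tupleBaseChange_sub, LinearMap.comp_apply, LinearMap.add_apply,
    LinearMap.sub_apply] at e₀' e₁'
  simp only [twistDiff_apply, LinearMap.prodMap_apply, map_add, Matrix.tupleMap_compLeft,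
    Prod.mk_sub_mk, Prod.mk_add_mk, e₀', e₁', Matrix.tupleMap_neg, LinearMap.neg_apply]
  refine Prod.ext ?_ ?_ <;> dsimp only <;> abel

end TwistDiff

namespace MatrixFactorization

/-- A matrix `A` with `A * A' = A' * A = c` over an `R`-algebra `S` in which the image of `w` plus
`c` is `w'`: the datum needed to tensor factorizations of `w` with the factorization `(A, A')`
of `c`. -/
structure TwistData {R S : Type u} [CommRing R] [CommRing S] [Algebra R S] (w : R) (w' : S)
    (κ : Type) [Fintype κ] [DecidableEq κ] where
  /-- the even differential -/
  A : Matrix κ κ S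
  /-- the odd differential -/
  A' : Matrix κ κ S
  /-- the additional potential -/
  c : S
  A_mul : A * A' = c • 1
  mul_A : A' * A = c • 1
  eq_add : w' = algebraMap R S w + c

namespace TwistData

variable {R S : Type u} [CommRing R] [CommRing S] [Algebra R S] {w : R} {w' : S}
  {κ : Type} [Fintype κ] [DecidableEq κ] (t : TwistData w w' κ)

/-- The tensor product of a factorization with the factorization `(A, A')`. -/
def obj (M : MatrixFactorization R w) : MatrixFactorization S w' where
  X₀ := (κ → S ⊗[R] M.X₀) × (κ → S ⊗[R] M.X₁)
  X₁ := (κ → S ⊗[R] M.X₁) × (κ → S ⊗[R] M.X₀)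
  d₀ := twistDiff (-t.A') t.A M.d₀ M.d₁
  d₁ := twistDiff t.A' (-t.A) M.d₁ M.d₀
  d₁_d₀ x := by
    have := twistDiff_twistDiff (-t.A') t.A t.c
      (by rw [neg_mul, t.mul_A]) (by rw [mul_neg, t.A_mul])
      M.d₀ M.d₁ w M.d₁_d₀ M.d₀_d₁ x
    rwa [neg_neg, ← t.eq_add] at this
  d₀_d₁ x := by
    have := twistDiff_twistDiff t.A' (-t.A) t.c
      (by rw [mul_neg, t.mul_A]) (by rw [neg_mul, t.A_mul])
      M.d₁ M.d₀ w M.d₀_d₁ M.d₁_d₀ x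
    rwa [neg_neg, ← t.eq_add] at this

variable {M N : MatrixFactorization R w}

/-- The tensor product of a morphism of factorizations with the identity of `(A, A')`. -/
def map (f : M ⟶ N) : t.obj M ⟶ t.obj N where
  f₀ := (f.f₀.tupleBaseChange S κ).prodMap (f.f₁.tupleBaseChange S κ)
  f₁ := (f.f₁.tupleBaseChange S κ).prodMap (f.f₀.tupleBaseChange S κ)
  comm₀ := twistDiff_prodMap _ _ _ _ _ _ _ _ f.comm₀ f.comm₁
  comm₁ := twistDiff_prodMap _ _ _ _ _ _ _ _ f.comm₁ f.comm₀

/-- Tensoring with the factorization `(A, A')`, as a functor. -/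
def functor : MatrixFactorization R w ⥤ MatrixFactorization S w' where
  obj M := t.obj M
  map f := t.map f
  map_id M := by
    refine hom_ext (fun x => ?_) (fun x => ?_)
    · exact Prod.ext (LinearMap.congr_fun (LinearMap.tupleBaseChange_id S κ) x.1)
        (LinearMap.congr_fun (LinearMap.tupleBaseChange_id S κ) x.2)
    · exact Prod.ext (LinearMap.congr_fun (LinearMap.tupleBaseChange_id S κ) x.1)
        (LinearMap.congr_fun (LinearMap.tupleBaseChange_id S κ) x.2)
  map_comp f g := by
    refine hom_ext (fun x => ?_) (fun x => ?_)
    · exact Prod.ext (LinearMap.congr_fun (LinearMap.tupleBaseChange_comp S κ g.f₀ f.f₀) x.1)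
        (LinearMap.congr_fun (LinearMap.tupleBaseChange_comp S κ g.f₁ f.f₁) x.2)
    · exact Prod.ext (LinearMap.congr_fun (LinearMap.tupleBaseChange_comp S κ g.f₁ f.f₁) x.1)
        (LinearMap.congr_fun (LinearMap.tupleBaseChange_comp S κ g.f₀ f.f₀) x.2)

lemma functor_linear (k : Type*) [Field k] [Algebra k R] [Algebra k S] [IsScalarTower k R S] :
    t.functor.Linear k where
  map_smul {M N} f r := by
    have e := IsScalarTower.algebraMap_apply k R S r
    refine hom_ext (fun x => ?_) (fun x => ?_)
    · rw [smul_f₀, e]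
      exact Prod.ext (LinearMap.congr_fun (LinearMap.tupleBaseChange_smul S κ _ f.f₀) x.1)
        (LinearMap.congr_fun (LinearMap.tupleBaseChange_smul S κ _ f.f₁) x.2)
    · rw [smul_f₁, e]
      exact Prod.ext (LinearMap.congr_fun (LinearMap.tupleBaseChange_smul S κ _ f.f₁) x.1)
        (LinearMap.congr_fun (LinearMap.tupleBaseChange_smul S κ _ f.f₀) x.2)

lemma homotopic_map {f g : M ⟶ N} (h : homotopic w f g) :
    homotopic w' (t.functor.map f) (t.functor.map g) := by
  obtain ⟨h₀, h₁, H₀, H₁⟩ := h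
  refine ⟨(h₀.tupleBaseChange S κ).prodMap (h₁.tupleBaseChange S κ),
    (h₁.tupleBaseChange S κ).prodMap (h₀.tupleBaseChange S κ), fun x => ?_, fun x => ?_⟩
  · have := twistDiff_homotopy (-t.A') t.A _ _ _ _ _ _ _ _ _ _ H₀ H₁ x
    rwa [neg_neg] at this
  · have := twistDiff_homotopy t.A' (-t.A) _ _ _ _ _ _ _ _ _ _ H₁ H₀ x
    rwa [neg_neg] at this

lemma diff₀_sigma (x : (t.obj ((sigma w).obj M)).X₀) :
    (t.obj ((sigma w).obj M)).d₀ x = ((sigma w').obj (t.obj M)).d₀ x := by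
  have := LinearMap.congr_fun (twistDiff_neg t.A' (-t.A) M.d₁ M.d₀) x
  rwa [neg_neg] at this

lemma diff₁_sigma (x : (t.obj ((sigma w).obj M)).X₁) :
    (t.obj ((sigma w).obj M)).d₁ x = ((sigma w').obj (t.obj M)).d₁ x := by
  have := LinearMap.congr_fun (twistDiff_neg (-t.A') t.A M.d₀ M.d₁) x
  rwa [neg_neg] at this

/-- Tensoring commutes with `Σ`. -/
def sigmaIso : sigma w ⋙ t.functor ≅ t.functor ⋙ sigma w' :=
  NatIso.ofComponents (fun M =>
    { hom := ⟨LinearMap.id, LinearMap.id, fun x => (t.diff₀_sigma x).symm,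
        fun x => (t.diff₁_sigma x).symm⟩
      inv := ⟨LinearMap.id, LinearMap.id, fun x => (t.diff₀_sigma x), fun x => (t.diff₁_sigma x)⟩ })

/-- Tensoring commutes with the powers of `Σ`. -/
def sigmaPowIso : ∀ a : ZMod 2, sigmaPow w a ⋙ t.functor ≅ t.functor ⋙ sigmaPow w' a :=
  fun (a : Fin 2) => match a with
  | 0 => Functor.leftUnitor _ ≪≫ (Functor.rightUnitor _).symm
  | 1 => t.sigmaIso

instance commShiftTwo : t.functor.CommShift (ZMod 2) where
  commShiftIso a := t.sigmaPowIso a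
  commShiftIso_zero := by
    refine Iso.ext (NatTrans.ext (funext fun M => ?_))
    have h : (Functor.CommShift.isoZero t.functor (ZMod 2)).hom.app M =
      t.functor.map (𝟙 M) ≫ 𝟙 _ := rfl
    rw [h, CategoryTheory.Functor.map_id]
    rfl
  commShiftIso_add := fun (a : Fin 2) (b : Fin 2) => by
    -- Every component is an identity of the underlying modules. The only input that is not
    -- definitional is that the functor preserves identities.
    refine Iso.ext (NatTrans.ext (funext fun M => ?_))
    fin_cases a <;> fin_cases b
    · change _ = t.functor.map (𝟙 M) ≫ _
      rw [CategoryTheory.Functor.map_id]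
      rfl
    · change _ = t.functor.map (𝟙 ((sigma w).obj M)) ≫ _
      rw [CategoryTheory.Functor.map_id]
      rfl
    · change _ = t.functor.map (𝟙 ((sigma w).obj M)) ≫ _
      rw [CategoryTheory.Functor.map_id]
      rfl
    · exact hom_ext
        (fun x => (congrFun (congrArg (fun g => (Hom.f₀ g : _ → _)) (t.functor.map_id M)) x).symm)
        (fun x => (congrFun (congrArg (fun g => (Hom.f₁ g : _ → _)) (t.functor.map_id M)) x).symm)

/-- The ℤ-shift is the pullback of the ℤ/2-shift along reduction mod 2, so its commutation is pulled
back as well. -/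
instance : t.functor.CommShift ℤ :=
  inferInstanceAs ((PullbackShift.functor (Int.castAddHom (ZMod 2)) t.functor).CommShift ℤ)

end TwistData
end MatrixFactorization

end

/-! ### Tensoring with (A, A') preserves cones and descends to homotopy categories. -/

noncomputable section

open scoped TensorProduct

namespace MatrixFactorization

/-- An isomorphism of factorizations from linear equivalences commuting with the differentials. -/
def isoMk {R : Type u} [CommRing R] {w : R} {X Y : MatrixFactorization R w}
    (e₀ : X.X₀ ≃ₗ[R] Y.X₀) (e₁ : X.X₁ ≃ₗ[R] Y.X₁)
    (h₀ : ∀ x, Y.d₀ (e₀ x) = e₁ (X.d₀ x)) (h₁ : ∀ x, Y.d₁ (e₁ x) = e₀ (X.d₁ x)) : X ≅ Y where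
  hom := ⟨e₀, e₁, h₀, h₁⟩
  inv := ⟨e₀.symm, e₁.symm,
    fun x => e₁.injective (by
      have := h₀ (e₀.symm x)
      rw [e₀.apply_symm_apply] at this
      exact this.symm.trans (e₁.apply_symm_apply _).symm),
    fun x => e₀.injective (by
      have := h₁ (e₁.symm x)
      rw [e₁.apply_symm_apply] at this
      exact this.symm.trans (e₀.apply_symm_apply _).symm)⟩
  hom_inv_id := hom_ext e₀.symm_apply_apply e₁.symm_apply_apply
  inv_hom_id := hom_ext e₀.apply_symm_apply e₁.apply_symm_apply

end MatrixFactorization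

section TupleProd

variable {R : Type*} (S : Type*) [CommRing R] [CommRing S] [Algebra R S]
    (κ : Type*) (Y X Y' X' : Type*) [AddCommGroup X] [Module R X]
    [AddCommGroup Y] [Module R Y] [AddCommGroup X'] [Module R X'] [AddCommGroup Y'] [Module R Y']

lemma tuple_fst_inl : (LinearMap.fst R Y X).tupleBaseChange S κ ∘ₗ
    (LinearMap.inl R Y X).tupleBaseChange S κ = LinearMap.id := by
  rw [← LinearMap.tupleBaseChange_comp, LinearMap.fst_comp_inl]
  exact LinearMap.tupleBaseChange_id S κ

lemma tuple_fst_inr : (LinearMap.fst R Y X).tupleBaseChange S κ ∘ₗ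
    (LinearMap.inr R Y X).tupleBaseChange S κ = 0 := by
  rw [← LinearMap.tupleBaseChange_comp, LinearMap.fst_comp_inr]
  ext x a; simp

lemma tuple_snd_inl : (LinearMap.snd R Y X).tupleBaseChange S κ ∘ₗ
    (LinearMap.inl R Y X).tupleBaseChange S κ = 0 := by
  rw [← LinearMap.tupleBaseChange_comp, LinearMap.snd_comp_inl]
  ext x a; simp

lemma tuple_snd_inr : (LinearMap.snd R Y X).tupleBaseChange S κ ∘ₗ
    (LinearMap.inr R Y X).tupleBaseChange S κ = LinearMap.id := by
  rw [← LinearMap.tupleBaseChange_comp, LinearMap.snd_comp_inr]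
  exact LinearMap.tupleBaseChange_id S κ

lemma tuple_inl_fst : (LinearMap.inl R Y X).tupleBaseChange S κ ∘ₗ
      (LinearMap.fst R Y X).tupleBaseChange S κ +
    (LinearMap.inr R Y X).tupleBaseChange S κ ∘ₗ (LinearMap.snd R Y X).tupleBaseChange S κ =
    LinearMap.id := by
  rw [← LinearMap.tupleBaseChange_comp, ← LinearMap.tupleBaseChange_comp,
    ← LinearMap.tupleBaseChange_add, ← LinearMap.tupleBaseChange_id]
  congr 1
  ext <;> simp

/-- Tuples and base change commute with products; the two middle factors are interchanged. -/
def tupleProdEquiv : ((κ → S ⊗[R] (Y × X)) × (κ → S ⊗[R] (Y' × X'))) ≃ₗ[S]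
    (((κ → S ⊗[R] Y) × (κ → S ⊗[R] Y')) × ((κ → S ⊗[R] X) × (κ → S ⊗[R] X'))) :=
  LinearEquiv.ofLinearMap
    ((((LinearMap.fst R Y X).tupleBaseChange S κ).prodMap
        ((LinearMap.fst R Y' X').tupleBaseChange S κ)).prod
      (((LinearMap.snd R Y X).tupleBaseChange S κ).prodMap
        ((LinearMap.snd R Y' X').tupleBaseChange S κ)))
    ((((LinearMap.inl R Y X).tupleBaseChange S κ).prodMap
        ((LinearMap.inl R Y' X').tupleBaseChange S κ)).coprod
      (((LinearMap.inr R Y X).tupleBaseChange S κ).prodMap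
        ((LinearMap.inr R Y' X').tupleBaseChange S κ)))
    (LinearMap.ext fun x => by
      have hf := fun x => LinearMap.congr_fun (tuple_fst_inl (R := R) S κ Y X) x
      have hf' := fun x => LinearMap.congr_fun (tuple_fst_inl (R := R) S κ Y' X') x
      have hg := fun x => LinearMap.congr_fun (tuple_fst_inr (R := R) S κ Y X) x
      have hg' := fun x => LinearMap.congr_fun (tuple_fst_inr (R := R) S κ Y' X') x
      have hk := fun x => LinearMap.congr_fun (tuple_snd_inl (R := R) S κ Y X) x
      have hk' := fun x => LinearMap.congr_fun (tuple_snd_inl (R := R) S κ Y' X') x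
      have hl := fun x => LinearMap.congr_fun (tuple_snd_inr (R := R) S κ Y X) x
      have hl' := fun x => LinearMap.congr_fun (tuple_snd_inr (R := R) S κ Y' X') x
      simp only [LinearMap.comp_apply, LinearMap.id_apply, LinearMap.zero_apply] at *
      obtain ⟨⟨x₁, x₂⟩, x₃, x₄⟩ := x
      simp only [LinearMap.coprod_apply, LinearMap.prod_apply, Function.prod,
        LinearMap.prodMap_apply,
        map_add, Prod.mk_add_mk, hf, hf', hg, hg', hk, hk', hl, hl', add_zero, zero_add])
    (LinearMap.ext fun x => by
      have h := fun x => LinearMap.congr_fun (tuple_inl_fst (R := R) S κ Y X) x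
      have h' := fun x => LinearMap.congr_fun (tuple_inl_fst (R := R) S κ Y' X') x
      simp only [LinearMap.add_apply, LinearMap.comp_apply, LinearMap.id_apply] at h h'
      simp only [LinearMap.comp_apply, LinearMap.coprod_apply, LinearMap.prod_apply, Function.prod,
        LinearMap.prodMap_apply, Prod.mk_add_mk, h, h', LinearMap.id_apply])

lemma tupleProdEquiv_apply (z) : tupleProdEquiv (R := R) S κ Y X Y' X' z =
    (((LinearMap.fst R Y X).tupleBaseChange S κ z.1,
      (LinearMap.fst R Y' X').tupleBaseChange S κ z.2),
     ((LinearMap.snd R Y X).tupleBaseChange S κ z.1,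
      (LinearMap.snd R Y' X').tupleBaseChange S κ z.2)) := rfl

variable {S κ}

lemma tuple_fst_cone {A B C D : Type*} [AddCommGroup A] [Module R A] [AddCommGroup B] [Module R B]
    [AddCommGroup C] [Module R C] [AddCommGroup D] [Module R D] (d : A →ₗ[R] C) (f : B →ₗ[R] C)
    (g : B →ₗ[R] D) (z : κ → S ⊗[R] (A × B)) :
    (LinearMap.fst R C D).tupleBaseChange S κ
      ((LinearMap.prod (d.coprod f) (-(g ∘ₗ LinearMap.snd R A B))).tupleBaseChange S κ z) =
    d.tupleBaseChange S κ ((LinearMap.fst R A B).tupleBaseChange S κ z) +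
      f.tupleBaseChange S κ ((LinearMap.snd R A B).tupleBaseChange S κ z) := by
  simp only [← LinearMap.comp_apply, ← LinearMap.tupleBaseChange_comp, ← LinearMap.add_apply,
    ← LinearMap.tupleBaseChange_add]
  congr 2

lemma tuple_snd_cone {A B C D : Type*} [AddCommGroup A] [Module R A] [AddCommGroup B] [Module R B]
    [AddCommGroup C] [Module R C] [AddCommGroup D] [Module R D] (d : A →ₗ[R] C) (f : B →ₗ[R] C)
    (g : B →ₗ[R] D) (z : κ → S ⊗[R] (A × B)) :
    (LinearMap.snd R C D).tupleBaseChange S κ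
      ((LinearMap.prod (d.coprod f) (-(g ∘ₗ LinearMap.snd R A B))).tupleBaseChange S κ z) =
    -g.tupleBaseChange S κ ((LinearMap.snd R A B).tupleBaseChange S κ z) := by
  simp only [← LinearMap.comp_apply, ← LinearMap.tupleBaseChange_comp, ← LinearMap.neg_apply,
    ← LinearMap.tupleBaseChange_neg]
  congr 2

end TupleProd

section TwistDiffCone

variable {R : Type*} {S : Type*} [CommRing R] [CommRing S] [Algebra R S]
    {κ : Type*} [Fintype κ] {X₀ X₁ Y₀ Y₁ : Type*} [AddCommGroup X₀] [Module R X₀]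
    [AddCommGroup X₁] [Module R X₁] [AddCommGroup Y₀] [Module R Y₀]
    [AddCommGroup Y₁] [Module R Y₁]

/-- The summand ΣX of the cone has differential `-d`. After the interchange of the middle factors it
therefore appears as minus the twisted differential with opposite matrices, which is the
differential of Σ applied to the tensor product. -/
lemma twistDiff_cone (B A : Matrix κ κ S) (d₀ : X₀ →ₗ[R] X₁) (d₁ : X₁ →ₗ[R] X₀)
    (e₀ : Y₀ →ₗ[R] Y₁) (e₁ : Y₁ →ₗ[R] Y₀) (f₀ : X₀ →ₗ[R] Y₀) (f₁ : X₁ →ₗ[R] Y₁)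
    (y : (κ → S ⊗[R] (Y₀ × X₁)) × (κ → S ⊗[R] (Y₁ × X₀))) :
    tupleProdEquiv S κ Y₁ X₀ Y₀ X₁ (twistDiff B A
      (LinearMap.prod (e₀.coprod f₁) (-(d₁ ∘ₗ LinearMap.snd R _ _)))
      (LinearMap.prod (e₁.coprod f₀) (-(d₀ ∘ₗ LinearMap.snd R _ _))) y) =
    (twistDiff B A e₀ e₁ (tupleProdEquiv S κ Y₀ X₁ Y₁ X₀ y).1 +
      (f₁.tupleBaseChange S κ).prodMap (f₀.tupleBaseChange S κ)
        (tupleProdEquiv S κ Y₀ X₁ Y₁ X₀ y).2,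
      -twistDiff (-B) (-A) d₁ d₀ (tupleProdEquiv S κ Y₀ X₁ Y₁ X₀ y).2) := by
  simp only [tupleProdEquiv_apply, twistDiff_apply, LinearMap.prodMap_apply, map_add,
    tuple_fst_cone, tuple_snd_cone, Matrix.tupleMap_compLeft, Matrix.tupleMap_neg,
    LinearMap.neg_apply, Prod.mk_add_mk, Prod.neg_mk, neg_add, neg_neg]
  refine Prod.ext (Prod.ext ?_ ?_) (Prod.ext ?_ ?_) <;> dsimp only <;> abel

end TwistDiffCone

namespace MatrixFactorization.TwistData

variable {R S : Type u} [CommRing R] [CommRing S] [Algebra R S] {w : R} {w' : S}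
  {κ : Type} [Fintype κ] [DecidableEq κ] (t : TwistData w w' κ)

variable {X Y : MatrixFactorization R w}

/-- Tensoring with `(A, A')` commutes with mapping cones. -/
def coneIso (f : X ⟶ Y) : t.functor.obj (cone f) ≅ cone (t.functor.map f) :=
  isoMk (X := t.obj (cone f)) (Y := cone (t.map f))
    (tupleProdEquiv S κ Y.X₀ X.X₁ Y.X₁ X.X₀) (tupleProdEquiv S κ Y.X₁ X.X₀ Y.X₀ X.X₁)
    (fun x => by
      have := twistDiff_cone (-t.A') t.A X.d₀ X.d₁ Y.d₀ Y.d₁ f.f₀ f.f₁ x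
      rw [neg_neg] at this
      exact this.symm)
    (fun x => by
      have := twistDiff_cone t.A' (-t.A) X.d₁ X.d₀ Y.d₁ Y.d₀ f.f₁ f.f₀ x
      rw [neg_neg] at this
      exact this.symm)

lemma map_coneIncl (f : X ⟶ Y) :
    t.functor.map (coneIncl f) ≫ (t.coneIso f).hom = coneIncl (t.functor.map f) :=
  hom_ext
    (fun x => Prod.ext
      (Prod.ext (LinearMap.congr_fun (tuple_fst_inl S κ Y.X₀ X.X₁) x.1)
        (LinearMap.congr_fun (tuple_fst_inl S κ Y.X₁ X.X₀) x.2))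
      (Prod.ext (LinearMap.congr_fun (tuple_snd_inl S κ Y.X₀ X.X₁) x.1)
        (LinearMap.congr_fun (tuple_snd_inl S κ Y.X₁ X.X₀) x.2)))
    (fun x => Prod.ext
      (Prod.ext (LinearMap.congr_fun (tuple_fst_inl S κ Y.X₁ X.X₀) x.1)
        (LinearMap.congr_fun (tuple_fst_inl S κ Y.X₀ X.X₁) x.2))
      (Prod.ext (LinearMap.congr_fun (tuple_snd_inl S κ Y.X₁ X.X₀) x.1)
        (LinearMap.congr_fun (tuple_snd_inl S κ Y.X₀ X.X₁) x.2)))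

lemma commShiftIso_one_hom_app (X : MatrixFactorization R w) :
    (t.functor.commShiftIso (1 : ℤ)).hom.app X = t.sigmaIso.hom.app X := by
  change t.functor.map (𝟙 _) ≫ t.sigmaIso.hom.app X ≫ 𝟙 _ = _
  rw [CategoryTheory.Functor.map_id]
  exact hom_ext (fun _ => rfl) (fun _ => rfl)

open Pretriangulated

/-- The image of a standard triangle is a standard triangle. -/
def mapConeTriangleIso (f : X ⟶ Y) :
    t.functor.mapTriangle.obj (coneTriangle f) ≅ coneTriangle (t.functor.map f) :=
  Triangle.isoMk _ _ (Iso.refl _) (Iso.refl _) (t.coneIso f)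
    (by simp; rfl)
    ((t.map_coneIncl f).trans (Category.id_comp _).symm)
    (by
      change (t.functor.map (coneProj f) ≫ (t.functor.commShiftIso (1 : ℤ)).hom.app X) ≫
        (shiftFunctor _ (1 : ℤ)).map (𝟙 (t.functor.obj X)) = (t.coneIso f).hom ≫ coneProj _
      rw [CategoryTheory.Functor.map_id, t.commShiftIso_one_hom_app]
      exact hom_ext (fun _ => rfl) (fun _ => rfl))

/-- Tensoring with `(A, A')` on homotopy categories. -/
def hmf : HMF R w ⥤ HMF S w' :=
  CategoryTheory.Quotient.lift _ (t.functor ⋙ HMF.quotient S w')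
    (fun _ _ _ _ h => (HMF.quotient_map_eq_iff _ _).2 (t.homotopic_map h))

instance : t.hmf.CommShift ℤ := CategoryTheory.Quotient.liftCommShift ..

/-- Tensoring commutes with passage to the homotopy category. -/
def hmfFactors : HMF.quotient R w ⋙ t.hmf ≅ t.functor ⋙ HMF.quotient S w' :=
  CategoryTheory.Quotient.lift.isLift _ _ _

instance : NatTrans.CommShift t.hmfFactors.hom ℤ :=
  CategoryTheory.Quotient.liftCommShift_compatibility ..

/-- The image of a standard triangle in the homotopy category is a standard triangle. -/
def hmfMapConeTriangleIso (f : X ⟶ Y) :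
    t.hmf.mapTriangle.obj ((HMF.quotient R w).mapTriangle.obj (coneTriangle f)) ≅
      (HMF.quotient S w').mapTriangle.obj (coneTriangle (t.functor.map f)) :=
  (Functor.mapTriangleCompIso _ _).symm.app _ ≪≫
    (Functor.mapTriangleIso t.hmfFactors).app _ ≪≫
    (Functor.mapTriangleCompIso _ _).app _ ≪≫
    (HMF.quotient S w').mapTriangle.mapIso (t.mapConeTriangleIso f)

/-- Distinguished triangles are by definition those isomorphic to cone triangles, and cone triangles
go to cone triangles. -/
instance : t.hmf.IsTriangulated where
  map_distinguished := by
    rintro T ⟨K, L, f, ⟨e⟩⟩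
    exact ⟨_, _, _, ⟨t.hmf.mapTriangle.mapIso e ≪≫ t.hmfMapConeTriangleIso f⟩⟩

lemma hmf_linear (k : Type*) [Field k] [Algebra k R] [Algebra k S] [IsScalarTower k R S] :
    t.hmf.Linear k where
  map_smul {X Y} f r := by
    obtain ⟨X⟩ := X
    obtain ⟨Y⟩ := Y
    obtain ⟨f, rfl⟩ := (HMF.quotient R w).map_surjective f
    have := t.functor_linear k
    rw [← Functor.map_smul]
    exact (congrArg (HMF.quotient S w').map (t.functor.map_smul r f)).trans
      ((HMF.quotient S w').map_smul r (t.functor.map f))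

end MatrixFactorization.TwistData

end

/-! ### Formal series and the contraction of the Koszul complex. -/

noncomputable section

namespace FormalSeries

variable {σ : Type*} {E : Type*} [AddCommGroup E]

/-- The coefficients of degree less than `k` vanish. -/
def OrderGE (φ : (σ →₀ ℕ) → E) (k : ℕ) : Prop := ∀ e, e.degree < k → φ e = 0

lemma eq_zero_of_orderGE {φ : (σ →₀ ℕ) → E} (h : ∀ k, OrderGE φ k) : φ = 0 :=
  funext fun e => h (e.degree + 1) e (Nat.lt_succ_self _)

lemma OrderGE.mono {φ : (σ →₀ ℕ) → E} {k l : ℕ} (h : OrderGE φ k) (hl : l ≤ k) : OrderGE φ l :=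
  fun e he => h e (he.trans_le hl)

/-- An operator which raises the order has no nonzero fixed points. -/
lemma eq_zero_of_eq_apply (T : ((σ →₀ ℕ) → E) → ((σ →₀ ℕ) → E))
    (hT : ∀ φ k, OrderGE φ k → OrderGE (T φ) (k + 1)) {c : (σ →₀ ℕ) → E} (hc : c = T c) :
    c = 0 := by
  refine eq_zero_of_orderGE fun k => ?_
  induction k with
  | zero => exact fun e he => absurd he (Nat.not_lt_zero _)
  | succ k ih => rw [hc]; exact hT _ _ ih

/-- If `T` raises the order, then `1 - T` is surjective. -/
lemma exists_eq_add_apply (T : ((σ →₀ ℕ) → E) →+ ((σ →₀ ℕ) → E))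
    (hT : ∀ φ k, OrderGE φ k → OrderGE (T φ) (k + 1)) (u : (σ →₀ ℕ) → E) :
    ∃ f, f = u + T f := by
  have hpow (j : ℕ) : OrderGE (T^[j] u) j := by
    induction j with
    | zero => exact fun e he => absurd he (Nat.not_lt_zero _)
    | succ j ih => rw [Function.iterate_succ_apply']; exact hT _ _ ih
  -- The geometric series ∑ Tʲ u. Since Tʲ u has order at least j, only the terms with j at most the
  -- degree of e reach the coefficient at e, so the sum is finite.
  let f : (σ →₀ ℕ) → E := fun e => ∑ j ∈ Finset.range (e.degree + 1), T^[j] u e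
  have hf (N : ℕ) : OrderGE (f - ∑ j ∈ Finset.range N, T^[j] u) N := by
    intro e he
    simp only [f, Pi.sub_apply, Finset.sum_apply]
    rw [sub_eq_zero]
    refine Finset.sum_subset (Finset.range_mono he) fun j _ hj => hpow j e ?_
    rw [Finset.mem_range] at hj
    omega
  refine ⟨f, sub_eq_zero.1 (eq_zero_of_orderGE fun N => ?_)⟩
  -- T is not assumed to commute with infinite sums. The error is expressed through two remainders
  -- instead, each vanishing in degrees below N.
  have h : f - (u + T f) = (f - ∑ j ∈ Finset.range (N + 1), T^[j] u) -
      T (f - ∑ j ∈ Finset.range N, T^[j] u) := by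
    rw [Finset.sum_range_succ', map_sub, map_sum]
    simp only [Function.iterate_succ_apply', Function.iterate_zero, id]
    abel
  rw [h]
  intro e he
  rw [Pi.sub_apply, ((hf (N + 1)).mono (Nat.le_succ N)) e he,
    ((hT _ _ (hf N)).mono (Nat.le_succ N)) e he, sub_zero]

variable [Module ℝ E] [Fintype σ]

/-- The Koszul differential `∑ xᵢ ιᵢ`. -/
def koszul (ι : σ → E →ₗ[ℝ] E) : ((σ →₀ ℕ) → E) →ₗ[ℝ] ((σ →₀ ℕ) → E) where
  toFun φ e := ∑ i, if e i = 0 then 0 else ι i (φ (e - Finsupp.single i 1))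
  map_add' φ ψ := by
    ext e
    simp only [Pi.add_apply, map_add, ← Finset.sum_add_distrib]
    refine Finset.sum_congr rfl fun i _ => ?_
    split_ifs <;> simp
  map_smul' c φ := by
    ext e
    simp only [Pi.smul_apply, map_smul, Finset.smul_sum, RingHom.id_apply]
    refine Finset.sum_congr rfl fun i _ => ?_
    split_ifs <;> simp

lemma koszul_apply (ι : σ → E →ₗ[ℝ] E) (φ : (σ →₀ ℕ) → E) (e : σ →₀ ℕ) :
    koszul ι φ e = ∑ i, if e i = 0 then 0 else ι i (φ (e - Finsupp.single i 1)) := rfl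

/-- The summands of the square are antisymmetric in (i, j), including the diagonal where ιᵢ² = -ιᵢ².
The double sum is then its own negative, hence zero over ℝ. -/
lemma koszul_koszul (ι : σ → E →ₗ[ℝ] E) (hι : ∀ i j x, ι i (ι j x) = -ι j (ι i x))
    (φ : (σ →₀ ℕ) → E) : koszul ι (koszul ι φ) = 0 := by
  classical
  ext e
  let t : σ → σ → E := fun i j =>
    if e i = 0 then 0 else if (e - Finsupp.single i 1 : σ →₀ ℕ) j = 0 then 0
    else ι i (ι j (φ (e - Finsupp.single i 1 - Finsupp.single j 1)))
  have ht (i j) : t i j = -t j i := by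
    simp only [t]
    by_cases hij : i = j
    · subst hij
      split_ifs
      · simp
      · simp
      · exact hι _ _ _
    · have h₁ : (e - Finsupp.single i 1 : σ →₀ ℕ) j = e j := by simp [hij]
      have h₂ : (e - Finsupp.single j 1 : σ →₀ ℕ) i = e i := by simp [Ne.symm hij]
      rw [h₁, h₂, tsub_right_comm]
      split_ifs
      · simp
      · simp
      · simp
      · exact hι _ _ _
  have h : koszul ι (koszul ι φ) e = ∑ i, ∑ j, t i j := by
    rw [koszul_apply]
    refine Finset.sum_congr rfl fun i _ => ?_
    simp only [t, koszul_apply, map_sum, apply_ite (ι i), map_zero]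
    split_ifs
    · simp
    · rfl
  have h' : ∑ i, ∑ j, t i j = -∑ i, ∑ j, t i j := by
    conv_lhs => rw [Finset.sum_comm]
    rw [← Finset.sum_neg_distrib]
    refine Finset.sum_congr rfl fun i _ => ?_
    rw [← Finset.sum_neg_distrib]
    exact Finset.sum_congr rfl fun j _ => ht _ _
  rw [h, Pi.zero_apply]
  have : IsAddTorsionFree E := .of_isTorsionFree ℝ E
  exact self_eq_neg.1 h'

variable (ι ε : σ → E →ₗ[ℝ] E)

/-- The contraction of the Koszul differential in the direction of one variable. -/
def contract (ε : σ → E →ₗ[ℝ] E) (i : σ) : ((σ →₀ ℕ) → E) →ₗ[ℝ] ((σ →₀ ℕ) → E) where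
  toFun φ e := ε i (φ (e + Finsupp.single i 1))
  map_add' φ ψ := by ext; simp
  map_smul' c φ := by ext; simp

/-- `contract` divides by xᵢ and applies εᵢ. For j ≠ i the terms cancel because ιⱼ and εᵢ
anticommute. For j = i the relation ιᵢ εᵢ + εᵢ ιᵢ = 1 gives φ. When eᵢ = 0 the half ιᵢ εᵢ is
missing, so the defect lives on series free of xᵢ. -/
lemma koszul_contract [DecidableEq σ]
    (hιε : ∀ i j x, ι i (ε j x) + ε j (ι i x) = if i = j then x else 0)
    (i : σ) (φ : (σ →₀ ℕ) → E) (e : σ →₀ ℕ) :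
    koszul ι (contract ε i φ) e + contract ε i (koszul ι φ) e =
      φ e - if e i = 0 then ι i (ε i (φ e)) else 0 := by
  change _ + ε i (koszul ι φ (e + Finsupp.single i 1)) = _
  simp only [koszul_apply, map_sum, ← Finset.sum_add_distrib]
  rw [Finset.sum_eq_single i]
  · simp only [contract, LinearMap.coe_mk, AddHom.coe_mk, Finsupp.add_apply,
      Finsupp.single_eq_same, Nat.add_eq_zero_iff, one_ne_zero, and_false, if_false,
      add_tsub_cancel_right]
    have h := hιε i i (φ e)
    rw [if_pos rfl] at h
    split_ifs with he
    · rw [zero_add, eq_sub_iff_add_eq, add_comm]; exact h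
    · rw [tsub_add_cancel_of_le, h, sub_zero]
      simpa [Nat.one_le_iff_ne_zero] using he
  · intro j _ hj
    have hji : (e + Finsupp.single i 1 : σ →₀ ℕ) j = e j := by simp [Ne.symm hj]
    rw [hji]
    split_ifs with he
    · simp
    · have h := hιε j i (φ (e - Finsupp.single j 1 + Finsupp.single i 1))
      rw [if_neg hj] at h
      have h2 : e + Finsupp.single i 1 - Finsupp.single j 1 =
          e - Finsupp.single j 1 + Finsupp.single i 1 := by
        rw [tsub_add_eq_add_tsub]
        simpa [Nat.one_le_iff_ne_zero] using he
      rw [h2]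
      exact h
  · simp

/-- The variables are contracted one at a time. If 1 - P and 1 - Q are null-homotopic through H and
K, then 1 - PQ is so through H + PK, provided P commutes with the differential. The bound on orders
is carried along: H loses at most one degree. -/
lemma exists_koszul_homotopy_finset [DecidableEq σ]
    (hι : ∀ i j x, ι i (ι j x) = -ι j (ι i x))
    (hιε : ∀ i j x, ι i (ε j x) + ε j (ι i x) = if i = j then x else 0) (s : Finset σ) :
    ∃ (H P : ((σ →₀ ℕ) → E) →ₗ[ℝ] ((σ →₀ ℕ) → E)) (π : E →ₗ[ℝ] E),
      (∀ φ, koszul ι (H φ) + H (koszul ι φ) = φ - P φ) ∧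
      (∀ φ k, OrderGE φ (k + 1) → OrderGE (H φ) k) ∧
      (∀ φ e, P φ e = if ∀ i ∈ s, e i = 0 then π (φ e) else 0) := by
  induction s using Finset.induction_on with
  | empty =>
    refine ⟨0, LinearMap.id, LinearMap.id, fun φ => by simp, fun φ k _ e _ => rfl, fun φ e => ?_⟩
    simp
  | insert i s hi ih =>
    obtain ⟨H, P, π, h₁, h₂, h₃⟩ := ih
    -- With D the Koszul differential and D² = 0, the homotopy formula computes D H D φ both as Dφ -
    -- DPφ and as Dφ - PDφ.
    have hDP (φ) : koszul ι (P φ) = P (koszul ι φ) := by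
      have e₁ := congrArg (koszul ι) (h₁ φ)
      have e₂ := h₁ (koszul ι φ)
      rw [map_add, koszul_koszul ι hι, zero_add, map_sub] at e₁
      rw [koszul_koszul ι hι, map_zero, add_zero, e₁] at e₂
      exact sub_right_inj.1 e₂
    let Q : ((σ →₀ ℕ) → E) →ₗ[ℝ] ((σ →₀ ℕ) → E) :=
      { toFun φ e := if e i = 0 then ι i (ε i (φ e)) else 0
        map_add' φ ψ := by ext e; simp only [Pi.add_apply]; split_ifs <;> simp
        map_smul' c φ := by ext e; simp only [Pi.smul_apply, RingHom.id_apply]; split_ifs <;> simp }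
    have hQ (φ) : koszul ι (contract ε i φ) + contract ε i (koszul ι φ) = φ - Q φ :=
      funext fun e => koszul_contract ι ε hιε i φ e
    refine ⟨H + P ∘ₗ contract ε i, P ∘ₗ Q, π ∘ₗ ι i ∘ₗ ε i, fun φ => ?_, fun φ k hφ => ?_,
      fun φ e => ?_⟩
    · simp only [LinearMap.add_apply, LinearMap.comp_apply, map_add, hDP]
      rw [add_add_add_comm, h₁, ← map_add, hQ, map_sub]
      abel
    · intro e he
      rw [LinearMap.add_apply, Pi.add_apply, h₂ φ k hφ e he, zero_add, LinearMap.comp_apply, h₃]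
      split_ifs
      · change π (ε i (φ _)) = 0
        rw [hφ _ (by simpa using he), map_zero, map_zero]
      · rfl
    · rw [LinearMap.comp_apply, h₃]
      change (if _ then π (if e i = 0 then ι i (ε i (φ e)) else 0) else 0) = _
      simp only [Finset.forall_mem_insert, LinearMap.comp_apply]
      by_cases h : e i = 0 <;> by_cases h' : ∀ j ∈ s, e j = 0 <;> simp [h]

/-- The Koszul complex is contractible onto constants. -/
lemma exists_koszul_homotopy [DecidableEq σ]
    (hι : ∀ i j x, ι i (ι j x) = -ι j (ι i x))
    (hιε : ∀ i j x, ι i (ε j x) + ε j (ι i x) = if i = j then x else 0) :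
    ∃ (H : ((σ →₀ ℕ) → E) →ₗ[ℝ] ((σ →₀ ℕ) → E)) (π : E →ₗ[ℝ] E),
      (∀ φ, koszul ι (H φ) + H (koszul ι φ) = φ - Pi.single 0 (π (φ 0))) ∧
      (∀ φ k, OrderGE φ (k + 1) → OrderGE (H φ) k) := by
  obtain ⟨H, P, π, h₁, h₂, h₃⟩ := exists_koszul_homotopy_finset ι ε hι hιε Finset.univ
  refine ⟨H, π, fun φ => ?_, h₂⟩
  rw [h₁]
  congr 1
  ext e
  rw [h₃]
  by_cases he : e = 0
  · subst he; simp
  · rw [Pi.single_eq_of_ne he, if_neg]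
    intro h
    exact he (Finsupp.ext fun i => h i (Finset.mem_univ i))

end FormalSeries

end

/-! ### The parity involution and matrices of power series. -/

noncomputable section

namespace Matrix

section Hat

variable {k : Type*} [Ring k] {I₀ I₁ J₀ J₁ K₀ K₁ : Type*}

/-- The grading involution on matrices between `ℤ/2`-graded index types. -/
def hat (M : Matrix (J₀ ⊕ J₁) (I₀ ⊕ I₁) k) : Matrix (J₀ ⊕ J₁) (I₀ ⊕ I₁) k :=
  fromBlocks M.toBlocks₁₁ (-M.toBlocks₁₂) (-M.toBlocks₂₁) M.toBlocks₂₂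

lemma hat_fromBlocks (A : Matrix J₀ I₀ k) (B : Matrix J₀ I₁ k) (C : Matrix J₁ I₀ k)
    (D : Matrix J₁ I₁ k) : hat (fromBlocks A B C D) = fromBlocks A (-B) (-C) D := rfl

lemma hat_hat (M : Matrix (J₀ ⊕ J₁) (I₀ ⊕ I₁) k) : hat (hat M) = M := by
  rw [← fromBlocks_toBlocks M]
  simp [hat_fromBlocks]

lemma hat_add (M N : Matrix (J₀ ⊕ J₁) (I₀ ⊕ I₁) k) : hat (M + N) = hat M + hat N := by
  rw [← fromBlocks_toBlocks M, ← fromBlocks_toBlocks N]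
  simp [hat_fromBlocks, fromBlocks_add, add_comm]

lemma hat_neg (M : Matrix (J₀ ⊕ J₁) (I₀ ⊕ I₁) k) : hat (-M) = -hat M := by
  rw [← fromBlocks_toBlocks M]
  simp [hat_fromBlocks, fromBlocks_neg]

lemma hat_sub (M N : Matrix (J₀ ⊕ J₁) (I₀ ⊕ I₁) k) : hat (M - N) = hat M - hat N := by
  rw [sub_eq_add_neg, hat_add, hat_neg, sub_eq_add_neg]

lemma hat_smul {R : Type*} [Monoid R] [DistribMulAction R k] (c : R)
    (M : Matrix (J₀ ⊕ J₁) (I₀ ⊕ I₁) k) : hat (c • M) = c • hat M := by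
  rw [← fromBlocks_toBlocks M]
  simp [hat_fromBlocks, fromBlocks_smul]

/-- `hat` is multiplication by diag(1, -1) on both sides, hence multiplicative. It lets one formula
with `hat` replace the Koszul signs for even and odd matrices separately. -/
lemma hat_mul [Fintype J₀] [Fintype J₁] (M : Matrix (K₀ ⊕ K₁) (J₀ ⊕ J₁) k)
    (N : Matrix (J₀ ⊕ J₁) (I₀ ⊕ I₁) k) : hat (M * N) = hat M * hat N := by
  rw [← fromBlocks_toBlocks M, ← fromBlocks_toBlocks N]
  simp [hat_fromBlocks, fromBlocks_multiply, add_comm]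

lemma hat_one [DecidableEq I₀] [DecidableEq I₁] : hat (1 : Matrix (I₀ ⊕ I₁) (I₀ ⊕ I₁) k) = 1 := by
  rw [← fromBlocks_one, hat_fromBlocks]
  simp

end Hat

section Series

variable {σ : Type*} {I J K : Type*}

/-- The coefficients of a matrix of power series. -/
def series : Matrix J I (MvPowerSeries σ ℝ) ≃ₗ[ℝ] ((σ →₀ ℕ) → Matrix J I ℝ) where
  toFun M e := M.map (MvPowerSeries.coeff e)
  invFun φ := Matrix.of fun j i => (fun e => φ e j i : MvPowerSeries σ ℝ)
  map_add' M N := by ext; simp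
  map_smul' c M := by ext; simp
  left_inv M := rfl
  right_inv φ := rfl

lemma series_apply (M : Matrix J I (MvPowerSeries σ ℝ)) (e : σ →₀ ℕ) :
    series M e = M.map (MvPowerSeries.coeff e) := rfl

lemma series_mul [DecidableEq σ] [Fintype J] (M : Matrix K J (MvPowerSeries σ ℝ))
    (N : Matrix J I (MvPowerSeries σ ℝ)) (e : σ →₀ ℕ) :
    series (M * N) e =
      ∑ p ∈ Finset.HasAntidiagonal.antidiagonal e, series M p.1 * series N p.2 := by
  ext k i
  simp only [series_apply, map_apply, mul_apply, map_sum, MvPowerSeries.coeff_mul,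
    Matrix.sum_apply]
  exact Finset.sum_comm

lemma series_map_C [DecidableEq σ] (M : Matrix J I ℝ) :
    series (M.map (MvPowerSeries.C (σ := σ))) = Pi.single 0 M := by
  ext e j i
  by_cases he : e = 0
  · subst he; simp [series_apply]
  · rw [Pi.single_eq_of_ne he, series_apply, map_apply, map_apply,
      MvPowerSeries.coeff_C_of_ne_zero he, zero_apply]

lemma series_hat {I₀ I₁ J₀ J₁ : Type*} (M : Matrix (J₀ ⊕ J₁) (I₀ ⊕ I₁) (MvPowerSeries σ ℝ))
    (e : σ →₀ ℕ) : series (hat M) e = hat (series M e) := by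
  ext (j | j) (i | i) <;> simp [series_apply, hat, toBlocks₁₁, toBlocks₁₂, toBlocks₂₁, toBlocks₂₂]

variable [Fintype σ]

/-- The matrix of linear forms `∑ xᵢ gᵢ`. -/
def linearForm (g : σ → Matrix J I ℝ) : Matrix J I (MvPowerSeries σ ℝ) :=
  ∑ i, (MvPowerSeries.X i : MvPowerSeries σ ℝ) • (g i).map (MvPowerSeries.C (σ := σ))

lemma coeff_X_mul_eq_ite (i : σ) (f : MvPowerSeries σ ℝ) (e : σ →₀ ℕ) :
    MvPowerSeries.coeff e (MvPowerSeries.X i * f) =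
      if e i = 0 then 0 else MvPowerSeries.coeff (e - Finsupp.single i 1) f := by
  classical
  rw [MvPowerSeries.X_def, MvPowerSeries.coeff_monomial_mul, one_mul]
  have h : Finsupp.single i 1 ≤ e ↔ e i ≠ 0 := by
    rw [Finsupp.single_le_iff, Nat.one_le_iff_ne_zero]
  by_cases he : e i = 0 <;> simp [he]

lemma series_linearForm_mul [Fintype J] (g : σ → Matrix K J ℝ)
    (M : Matrix J I (MvPowerSeries σ ℝ)) (e : σ →₀ ℕ) :
    series (linearForm g * M) e =
      ∑ i, if e i = 0 then 0 else g i * series M (e - Finsupp.single i 1) := by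
  ext k i
  simp only [series_apply, map_apply, linearForm, Matrix.sum_mul, Matrix.smul_mul, Matrix.sum_apply,
    map_sum, Matrix.smul_apply, smul_eq_mul, coeff_X_mul_eq_ite]
  refine Finset.sum_congr rfl fun a _ => ?_
  split_ifs
  · rfl
  · simp only [mul_apply, map_apply, map_sum, MvPowerSeries.coeff_C_mul]

lemma series_mul_linearForm [Fintype J] (g : σ → Matrix J I ℝ)
    (M : Matrix K J (MvPowerSeries σ ℝ)) (e : σ →₀ ℕ) :
    series (M * linearForm g) e =
      ∑ i, if e i = 0 then 0 else series M (e - Finsupp.single i 1) * g i := by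
  ext k i
  simp only [series_apply, map_apply, linearForm, Matrix.mul_sum, Matrix.mul_smul, Matrix.sum_apply,
    map_sum, Matrix.smul_apply, smul_eq_mul, coeff_X_mul_eq_ite]
  refine Finset.sum_congr rfl fun a _ => ?_
  split_ifs
  · rfl
  · simp only [mul_apply, map_apply, map_sum, MvPowerSeries.coeff_mul_C]

lemma linearForm_mul_linearForm [Fintype J] (g : σ → Matrix K J ℝ) (h : σ → Matrix J I ℝ) :
    linearForm g * linearForm h = ∑ i, ∑ j,
      (MvPowerSeries.X i * MvPowerSeries.X j : MvPowerSeries σ ℝ) •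
        (g i * h j).map (MvPowerSeries.C (σ := σ)) := by
  simp only [linearForm, Matrix.sum_mul]
  refine Finset.sum_congr rfl fun i _ => ?_
  rw [Matrix.mul_sum]
  refine Finset.sum_congr rfl fun j _ => ?_
  rw [Matrix.smul_mul, Matrix.mul_smul, smul_smul, Matrix.map_mul]

lemma linearForm_fromBlocks {I₀ I₁ J₀ J₁ : Type*} (a : σ → Matrix J₀ I₀ ℝ)
    (b : σ → Matrix J₀ I₁ ℝ) (c : σ → Matrix J₁ I₀ ℝ) (d : σ → Matrix J₁ I₁ ℝ) :
    linearForm (fun i => fromBlocks (a i) (b i) (c i) (d i)) =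
      fromBlocks (linearForm a) (linearForm b) (linearForm c) (linearForm d) := by
  ext (j | j) (i | i) <;> simp [linearForm, Matrix.sum_apply]

end Series

end Matrix

/-- The quadratic power series `∑ Bᵢⱼ xᵢ xⱼ`. -/
def quadraticSeries {σ : Type*} [Fintype σ] (B : Matrix σ σ ℝ) : MvPowerSeries σ ℝ :=
  ∑ i, ∑ j, MvPowerSeries.C (B i j) * MvPowerSeries.X i * MvPowerSeries.X j

/-- If the symmetrizations of `gᵢ hⱼ` are `Bᵢⱼ`, then `(∑ xᵢ gᵢ) (∑ xⱼ hⱼ) = ∑ Bᵢⱼ xᵢ xⱼ`. -/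
lemma Matrix.linearForm_mul_linearForm_eq {σ I J : Type*} [Fintype σ] [Fintype J] [Fintype I]
    [DecidableEq I] {B : Matrix σ σ ℝ} (g : σ → Matrix I J ℝ) (h : σ → Matrix J I ℝ)
    (H : ∀ i j, g i * h j + g j * h i = (B i j + B j i) • 1) :
    linearForm g * linearForm h = quadraticSeries B • 1 := by
  have e : quadraticSeries B • (1 : Matrix I I (MvPowerSeries σ ℝ)) = ∑ i, ∑ j,
      (MvPowerSeries.X i * MvPowerSeries.X j : MvPowerSeries σ ℝ) •
        (B i j • (1 : Matrix I I ℝ)).map (MvPowerSeries.C (σ := σ)) := by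
    simp only [quadraticSeries, Finset.sum_smul]
    refine Finset.sum_congr rfl fun i _ => Finset.sum_congr rfl fun j _ => ?_
    ext a b
    by_cases hab : a = b
    · subst hab
      simp only [smul_apply, one_apply_eq, map_apply, smul_eq_mul, mul_one]
      rw [mul_assoc, MvPowerSeries.coeff_C_mul, MvPowerSeries.coeff_mul_C, mul_comm]
    · simp [hab]
  rw [e, linearForm_mul_linearForm, ← sub_eq_zero]
  simp only [← Finset.sum_sub_distrib, ← smul_sub]
  set t : σ → σ → Matrix I I (MvPowerSeries σ ℝ) := fun i j =>
    (MvPowerSeries.X i * MvPowerSeries.X j : MvPowerSeries σ ℝ) •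
      ((g i * h j).map (MvPowerSeries.C (σ := σ)) -
        (B i j • (1 : Matrix I I ℝ)).map (MvPowerSeries.C (σ := σ))) with ht
  -- Only the symmetrized products gᵢ hⱼ are known. That is enough, because xᵢ xⱼ is symmetric and
  -- the difference of the two sides is antisymmetric in (i, j).
  have hts (i j) : t i j = -t j i := by
    have := congrArg (fun M : Matrix I I ℝ => M.map (MvPowerSeries.C (σ := σ))) (H i j)
    simp only [add_smul, Matrix.map_add _ (map_add _)] at this
    simp only [ht]
    rw [mul_comm (MvPowerSeries.X j), ← smul_neg]
    congr 1
    rw [neg_sub, sub_eq_sub_iff_add_eq_add, this, add_comm]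
  have h' : ∑ i, ∑ j, t i j = -∑ i, ∑ j, t i j := by
    conv_lhs => rw [Finset.sum_comm]
    rw [← Finset.sum_neg_distrib]
    refine Finset.sum_congr rfl fun i _ => ?_
    rw [← Finset.sum_neg_distrib]
    exact Finset.sum_congr rfl fun j _ => hts _ _
  have : IsAddTorsionFree (Matrix I I (MvPowerSeries σ ℝ)) := .of_isTorsionFree ℝ _
  exact self_eq_neg.1 h'

end

/-! ### Factorizations in coordinates, and Clifford modules with their graded commutators. -/

noncomputable section

namespace MatrixFactorization

open Matrix

section OfMatrix

variable {R : Type u} [CommRing R] {w : R} {I₀ I₁ J₀ J₁ : Type}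
  [Fintype I₀] [Fintype I₁] [DecidableEq I₀] [DecidableEq I₁]
  [Fintype J₀] [Fintype J₁] [DecidableEq J₀] [DecidableEq J₁]

/-- The factorization of coordinate spaces given by a pair of matrices. -/
def ofMatrix (D₀ : Matrix I₁ I₀ R) (D₁ : Matrix I₀ I₁ R) (h₁₀ : D₁ * D₀ = w • 1)
    (h₀₁ : D₀ * D₁ = w • 1) : MatrixFactorization R w where
  X₀ := I₀ → R
  X₁ := I₁ → R
  d₀ := D₀.mulVecLin
  d₁ := D₁.mulVecLin
  d₁_d₀ x := by
    rw [mulVecLin_apply, mulVecLin_apply, mulVec_mulVec, h₁₀, smul_mulVec, one_mulVec]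
  d₀_d₁ x := by
    rw [mulVecLin_apply, mulVecLin_apply, mulVec_mulVec, h₀₁, smul_mulVec, one_mulVec]

variable {D₀ : Matrix I₁ I₀ R} {D₁ : Matrix I₀ I₁ R} {h₁₀ : D₁ * D₀ = w • 1}
  {h₀₁ : D₀ * D₁ = w • 1} {E₀ : Matrix J₁ J₀ R} {E₁ : Matrix J₀ J₁ R} {k₁₀ : E₁ * E₀ = w • 1}
  {k₀₁ : E₀ * E₁ = w • 1}

/-- The morphism given by a pair of matrices. -/
def ofMatrixHom (F₀ : Matrix J₀ I₀ R) (F₁ : Matrix J₁ I₁ R) (H₀ : E₀ * F₀ = F₁ * D₀)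
    (H₁ : E₁ * F₁ = F₀ * D₁) : ofMatrix D₀ D₁ h₁₀ h₀₁ ⟶ ofMatrix E₀ E₁ k₁₀ k₀₁ where
  f₀ := F₀.mulVecLin
  f₁ := F₁.mulVecLin
  comm₀ (x : I₀ → R) := by
    change E₀ *ᵥ (F₀ *ᵥ x) = F₁ *ᵥ (D₀ *ᵥ x)
    rw [mulVec_mulVec, mulVec_mulVec, H₀]
  comm₁ (x : I₁ → R) := by
    change E₁ *ᵥ (F₁ *ᵥ x) = F₀ *ᵥ (D₁ *ᵥ x)
    rw [mulVec_mulVec, mulVec_mulVec, H₁]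

lemma exists_eq_ofMatrixHom (f : ofMatrix D₀ D₁ h₁₀ h₀₁ ⟶ ofMatrix E₀ E₁ k₁₀ k₀₁) :
    ∃ (F₀ : Matrix J₀ I₀ R) (F₁ : Matrix J₁ I₁ R) (H₀ : E₀ * F₀ = F₁ * D₀)
      (H₁ : E₁ * F₁ = F₀ * D₁), f = ofMatrixHom F₀ F₁ H₀ H₁ := by
  let f₀ : (I₀ → R) →ₗ[R] (J₀ → R) := f.f₀
  let f₁ : (I₁ → R) →ₗ[R] (J₁ → R) := f.f₁
  have e₀ (x) : LinearMap.toMatrix' f₀ *ᵥ x = f₀ x := LinearMap.toMatrix'_mulVec f₀ x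
  have e₁ (x) : LinearMap.toMatrix' f₁ *ᵥ x = f₁ x := LinearMap.toMatrix'_mulVec f₁ x
  refine ⟨LinearMap.toMatrix' f₀, LinearMap.toMatrix' f₁, ?_, ?_, ?_⟩
  · refine mulVec_injective (funext fun x => ?_)
    rw [← mulVec_mulVec, ← mulVec_mulVec, e₀, e₁]
    exact f.comm₀ x
  · refine mulVec_injective (funext fun x => ?_)
    rw [← mulVec_mulVec, ← mulVec_mulVec, e₀, e₁]
    exact f.comm₁ x
  · exact hom_ext (fun x => (e₀ x).symm) (fun x => (e₁ x).symm)

lemma homotopic_ofMatrixHom_iff (F₀ F₀' : Matrix J₀ I₀ R) (F₁ F₁' : Matrix J₁ I₁ R)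
    (H₀ : E₀ * F₀ = F₁ * D₀) (H₁ : E₁ * F₁ = F₀ * D₁)
    (H₀' : E₀ * F₀' = F₁' * D₀) (H₁' : E₁ * F₁' = F₀' * D₁) :
    homotopic w (ofMatrixHom (h₁₀ := h₁₀) (h₀₁ := h₀₁) (k₁₀ := k₁₀) (k₀₁ := k₀₁) F₀ F₁ H₀ H₁)
      (ofMatrixHom F₀' F₁' H₀' H₁') ↔
    ∃ (h₀ : Matrix J₁ I₀ R) (h₁ : Matrix J₀ I₁ R),
      F₀ - F₀' = E₁ * h₀ + h₁ * D₀ ∧ F₁ - F₁' = E₀ * h₁ + h₀ * D₁ := by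
  constructor
  · rintro ⟨h₀, h₁, K₀, K₁⟩
    let g₀ : (I₀ → R) →ₗ[R] (J₁ → R) := h₀
    let g₁ : (I₁ → R) →ₗ[R] (J₀ → R) := h₁
    have e₀ (x) : LinearMap.toMatrix' g₀ *ᵥ x = g₀ x := LinearMap.toMatrix'_mulVec g₀ x
    have e₁ (x) : LinearMap.toMatrix' g₁ *ᵥ x = g₁ x := LinearMap.toMatrix'_mulVec g₁ x
    refine ⟨LinearMap.toMatrix' g₀, LinearMap.toMatrix' g₁, ?_, ?_⟩
    · refine mulVec_injective (funext fun x => ?_)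
      rw [sub_mulVec, add_mulVec, ← mulVec_mulVec, ← mulVec_mulVec, e₀, e₁]
      exact K₀ x
    · refine mulVec_injective (funext fun x => ?_)
      rw [sub_mulVec, add_mulVec, ← mulVec_mulVec, ← mulVec_mulVec, e₀, e₁]
      exact K₁ x
  · rintro ⟨h₀, h₁, K₀, K₁⟩
    refine ⟨h₀.mulVecLin, h₁.mulVecLin, fun (x : I₀ → R) => ?_, fun (x : I₁ → R) => ?_⟩
    · change F₀ *ᵥ x - F₀' *ᵥ x = E₁ *ᵥ (h₀ *ᵥ x) + h₁ *ᵥ (D₀ *ᵥ x)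
      rw [← sub_mulVec, K₀, add_mulVec, mulVec_mulVec, mulVec_mulVec]
    · change F₁ *ᵥ x - F₁' *ᵥ x = E₀ *ᵥ (h₁ *ᵥ x) + h₀ *ᵥ (D₁ *ᵥ x)
      rw [← sub_mulVec, K₁, add_mulVec, mulVec_mulVec, mulVec_mulVec]

/-- Invertible matrices give isomorphisms. -/
def ofMatrixIso (F₀ : Matrix J₀ I₀ R) (F₁ : Matrix J₁ I₁ R) (H₀ : E₀ * F₀ = F₁ * D₀)
    (H₁ : E₁ * F₁ = F₀ * D₁) (G₀ : Matrix I₀ J₀ R) (G₁ : Matrix I₁ J₁ R) (hGF₀ : G₀ * F₀ = 1)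
    (hFG₀ : F₀ * G₀ = 1) (hGF₁ : G₁ * F₁ = 1) (hFG₁ : F₁ * G₁ = 1) :
    ofMatrix D₀ D₁ h₁₀ h₀₁ ≅ ofMatrix E₀ E₁ k₁₀ k₀₁ where
  hom := ofMatrixHom F₀ F₁ H₀ H₁
  inv := ofMatrixHom G₀ G₁
    (by
      rw [← Matrix.one_mul (D₀ * G₀), ← hGF₁, Matrix.mul_assoc, ← Matrix.mul_assoc F₁, ← H₀,
        Matrix.mul_assoc, hFG₀, Matrix.mul_one])
    (by
      rw [← Matrix.one_mul (D₁ * G₁), ← hGF₀, Matrix.mul_assoc, ← Matrix.mul_assoc F₀, ← H₁,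
        Matrix.mul_assoc, hFG₁, Matrix.mul_one])
  hom_inv_id := by
    refine hom_ext (fun (x : I₀ → R) => ?_) (fun (x : I₁ → R) => ?_)
    · change G₀ *ᵥ (F₀ *ᵥ x) = x
      rw [mulVec_mulVec, hGF₀, one_mulVec]
    · change G₁ *ᵥ (F₁ *ᵥ x) = x
      rw [mulVec_mulVec, hGF₁, one_mulVec]
  inv_hom_id := by
    refine hom_ext (fun (x : J₀ → R) => ?_) (fun (x : J₁ → R) => ?_)
    · change F₀ *ᵥ (G₀ *ᵥ x) = x
      rw [mulVec_mulVec, hFG₀, one_mulVec]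
    · change F₁ *ᵥ (G₁ *ᵥ x) = x
      rw [mulVec_mulVec, hFG₁, one_mulVec]

end OfMatrix

end MatrixFactorization

open Matrix

/-- A `ℤ/2`-graded module of finite dimension, in coordinates, over the real Clifford algebra
with generators `γᵢ` and relations `γᵢ γⱼ + γⱼ γᵢ = Bᵢⱼ + Bⱼᵢ`. -/
structure CliffordData {σ : Type} (B : Matrix σ σ ℝ) where
  /-- a basis of the even part -/
  I₀ : Type
  /-- a basis of the odd part -/
  I₁ : Type
  [fintype₀ : Fintype I₀]
  [fintype₁ : Fintype I₁]
  [decidableEq₀ : DecidableEq I₀]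
  [decidableEq₁ : DecidableEq I₁]
  /-- the action on the even part -/
  γ₀ : σ → Matrix I₁ I₀ ℝ
  /-- the action on the odd part -/
  γ₁ : σ → Matrix I₀ I₁ ℝ
  rel₀ : ∀ i j, γ₁ i * γ₀ j + γ₁ j * γ₀ i = (B i j + B j i) • 1
  rel₁ : ∀ i j, γ₀ i * γ₁ j + γ₀ j * γ₁ i = (B i j + B j i) • 1

namespace CliffordData

attribute [instance] fintype₀ fintype₁ decidableEq₀ decidableEq₁

variable {σ : Type} {B : Matrix σ σ ℝ}

/-- A morphism of graded Clifford modules. -/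
@[ext]
structure Hom (V W : CliffordData B) where
  /-- the even part -/
  c₀ : Matrix W.I₀ V.I₀ ℝ
  /-- the odd part -/
  c₁ : Matrix W.I₁ V.I₁ ℝ
  comm₀ : ∀ i, W.γ₀ i * c₀ = c₁ * V.γ₀ i
  comm₁ : ∀ i, W.γ₁ i * c₁ = c₀ * V.γ₁ i

/-- The total action. -/
def γ (V : CliffordData B) (i : σ) : Matrix (V.I₀ ⊕ V.I₁) (V.I₀ ⊕ V.I₁) ℝ :=
  fromBlocks 0 (V.γ₁ i) (V.γ₀ i) 0

lemma hat_γ (V : CliffordData B) (i : σ) : hat (V.γ i) = -V.γ i := by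
  simp [γ, hat_fromBlocks, fromBlocks_neg]

lemma γ_mul_γ (V : CliffordData B) (i j : σ) :
    V.γ i * V.γ j + V.γ j * V.γ i = (B i j + B j i) • 1 := by
  simp [γ, fromBlocks_multiply, fromBlocks_add, V.rel₀, V.rel₁, ← fromBlocks_one, fromBlocks_smul]

section Koszul

variable (V W : CliffordData B)

/-- The graded commutator with `γᵢ`. -/
def gradedCommutator (i : σ) : Matrix (W.I₀ ⊕ W.I₁) (V.I₀ ⊕ V.I₁) ℝ →ₗ[ℝ]
    Matrix (W.I₀ ⊕ W.I₁) (V.I₀ ⊕ V.I₁) ℝ where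
  toFun φ := W.γ i * φ - hat φ * V.γ i
  map_add' φ ψ := by simp only [Matrix.mul_add, hat_add, Matrix.add_mul]; abel
  map_smul' c φ := by simp [hat_smul, smul_sub]

lemma gradedCommutator_apply (i : σ) (φ) :
    gradedCommutator V W i φ = W.γ i * φ - hat φ * V.γ i := rfl

/-- The graded anticommutator with a combination of the `γⱼ`. -/
def gradedAnticommutator [Fintype σ] (C : Matrix σ σ ℝ) (i : σ) :
    Matrix (W.I₀ ⊕ W.I₁) (V.I₀ ⊕ V.I₁) ℝ →ₗ[ℝ] Matrix (W.I₀ ⊕ W.I₁) (V.I₀ ⊕ V.I₁) ℝ where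
  toFun φ := (1 / 2 : ℝ) • ∑ j, C i j • (W.γ j * φ + hat φ * V.γ j)
  map_add' φ ψ := by
    rw [← smul_add, ← Finset.sum_add_distrib]
    congr 1
    refine Finset.sum_congr rfl fun j _ => ?_
    rw [← smul_add]
    simp only [Matrix.mul_add, hat_add, Matrix.add_mul]
    congr 1
    abel
  map_smul' c φ := by
    simp only [hat_smul, RingHom.id_apply, Matrix.mul_smul, Matrix.smul_mul, ← smul_add,
      smul_comm _ c, ← Finset.smul_sum]

/-- The mixed terms cancel in the symmetrization, leaving {γᵢ, γⱼ} φ - φ {γᵢ, γⱼ}. This vanishes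
because both modules have the same scalar anticommutators. -/
lemma gradedCommutator_anticomm (i j : σ) (φ) :
    gradedCommutator V W i (gradedCommutator V W j φ) =
      -gradedCommutator V W j (gradedCommutator V W i φ) := by
  have h₁ := congrArg (· * φ) (W.γ_mul_γ i j)
  have h₂ := congrArg (φ * ·) (V.γ_mul_γ i j)
  simp only [Matrix.add_mul, Matrix.mul_add, Matrix.smul_mul, Matrix.mul_smul, Matrix.one_mul,
    Matrix.mul_one, Matrix.mul_assoc] at h₁ h₂
  simp only [gradedCommutator_apply, hat_sub, hat_mul, hat_hat, hat_γ, Matrix.mul_sub,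
    Matrix.sub_mul, Matrix.neg_mul, Matrix.mul_neg, Matrix.mul_assoc]
  rw [← sub_eq_zero]
  linear_combination (norm := module) h₁ - h₂

/-- The anticommutator of ιᵢ with φ ↦ γⱼ φ + `hat φ` γⱼ is {γᵢ, γⱼ} φ + φ {γᵢ, γⱼ} = 2 (B + Bᵀ)ⱼᵢ φ.
The factor 1/2 and the inverse C normalize it to δᵢₖ. This is the place where nondegeneracy of q
enters. -/
lemma gradedCommutator_gradedAnticommutator [Fintype σ] [DecidableEq σ] (C : Matrix σ σ ℝ)
    (hC : C * (B + Bᵀ) = 1) (i k : σ) (φ) :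
    gradedCommutator V W i (gradedAnticommutator V W C k φ) +
      gradedAnticommutator V W C k (gradedCommutator V W i φ) = if i = k then φ else 0 := by
  have h (j) : gradedCommutator V W i (W.γ j * φ + hat φ * V.γ j) +
      (W.γ j * gradedCommutator V W i φ + hat (gradedCommutator V W i φ) * V.γ j) =
      (2 : ℝ) • (B + Bᵀ) j i • φ := by
    have h₁ := congrArg (· * φ) (W.γ_mul_γ i j)
    have h₂ := congrArg (φ * ·) (V.γ_mul_γ i j)
    simp only [Matrix.add_mul, Matrix.mul_add, Matrix.smul_mul, Matrix.mul_smul, Matrix.one_mul,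
      Matrix.mul_one, Matrix.mul_assoc] at h₁ h₂
    simp only [gradedCommutator_apply, hat_sub, hat_add, hat_mul, hat_hat, hat_γ, Matrix.mul_sub,
      Matrix.sub_mul, Matrix.add_mul, Matrix.mul_add,
      Matrix.neg_mul, Matrix.mul_neg, Matrix.mul_assoc, Matrix.add_apply, Matrix.transpose_apply]
    rw [two_smul, add_comm (B j i)]
    linear_combination (norm := module) h₁ + h₂
  change gradedCommutator V W i ((1 / 2 : ℝ) • ∑ j, C k j • (W.γ j * φ + hat φ * V.γ j)) +
    (1 / 2 : ℝ) • ∑ j, C k j • (W.γ j * gradedCommutator V W i φ +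
      hat (gradedCommutator V W i φ) * V.γ j) = _
  rw [map_smul, map_sum, ← smul_add, ← Finset.sum_add_distrib]
  simp only [map_smul, ← smul_add, h]
  have h' := congrFun (congrFun hC k) i
  rw [mul_apply] at h'
  have h2 :
      ∑ j, C k j • (2 : ℝ) • (B + Bᵀ) j i • φ = (2 : ℝ) • (∑ j, C k j * (B + Bᵀ) j i) • φ := by
    rw [Finset.sum_smul, Finset.smul_sum]
    refine Finset.sum_congr rfl fun j _ => ?_
    rw [smul_comm, mul_smul]
  rw [h2, h', smul_smul, one_apply]
  by_cases hik : i = k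
  · subst hik; simp
  · simp [hik, Ne.symm hik]

variable [Fintype σ]

/-- This identifies the differential of the complex of maps between two Clifford factorizations with
a Koszul differential, coefficient by coefficient. -/
lemma series_linearForm_γ_mul_sub (M : Matrix (W.I₀ ⊕ W.I₁) (V.I₀ ⊕ V.I₁) (MvPowerSeries σ ℝ)) :
    series (linearForm W.γ * M - hat M * linearForm V.γ) =
      FormalSeries.koszul (gradedCommutator V W) (series M) := by
  ext1 e
  rw [map_sub, Pi.sub_apply, series_linearForm_mul, series_mul_linearForm,
    ← Finset.sum_sub_distrib, FormalSeries.koszul_apply]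
  refine Finset.sum_congr rfl fun i _ => ?_
  split_ifs
  · exact sub_zero _
  · rw [gradedCommutator_apply, series_hat]

lemma linearForm_γ : linearForm V.γ = fromBlocks 0 (linearForm V.γ₁) (linearForm V.γ₀) 0 := by
  have := linearForm_fromBlocks (fun _ => 0) V.γ₁ V.γ₀ (fun _ => 0)
  have h0 {I J : Type} : linearForm (fun _ : σ => (0 : Matrix I J ℝ)) = 0 := by
    simp [linearForm]
  rw [h0, h0] at this
  exact this

end Koszul

end CliffordData

end

/-! ### Morphisms between factorizations of Clifford modules. -/

noncomputable section

open Matrix MatrixFactorization FormalSeries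

namespace CliffordData

variable {σ : Type} [Fintype σ] {B : Matrix σ σ ℝ}

/-- The matrix factorization `∑ xᵢ γᵢ` attached to a Clifford module. -/
def toMF (V : CliffordData B) : MatrixFactorization (MvPowerSeries σ ℝ) (quadraticSeries B) :=
  ofMatrix (linearForm V.γ₀) (linearForm V.γ₁) (linearForm_mul_linearForm_eq _ _ V.rel₀)
    (linearForm_mul_linearForm_eq _ _ V.rel₁)

lemma linearForm_mul_map {I J K : Type} [Fintype J] (g : σ → Matrix K J ℝ) (c : Matrix J I ℝ) :
    linearForm g * c.map (MvPowerSeries.C (σ := σ)) = linearForm fun i => g i * c := by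
  simp only [linearForm, Matrix.sum_mul, Matrix.smul_mul, Matrix.map_mul]

lemma map_mul_linearForm {I J K : Type} [Fintype J] (g : σ → Matrix J I ℝ) (c : Matrix K J ℝ) :
    c.map (MvPowerSeries.C (σ := σ)) * linearForm g = linearForm fun i => c * g i := by
  simp only [linearForm, Matrix.mul_sum, Matrix.mul_smul, Matrix.map_mul]

/-- The morphism of factorizations attached to a morphism of Clifford modules. -/
def Hom.toMF {V W : CliffordData B} (c : V.Hom W) : V.toMF ⟶ W.toMF :=
  ofMatrixHom (c.c₀.map (MvPowerSeries.C (σ := σ))) (c.c₁.map (MvPowerSeries.C (σ := σ)))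
    (by rw [linearForm_mul_map, map_mul_linearForm]; simp only [c.comm₀])
    (by rw [linearForm_mul_map, map_mul_linearForm]; simp only [c.comm₁])

lemma map_constantCoeff_linearForm {I J : Type} (g : σ → Matrix J I ℝ) :
    (linearForm g).map (MvPowerSeries.constantCoeff (σ := σ) (R := ℝ)) = 0 := by
  ext j i
  simp [linearForm, Matrix.sum_apply]

/-- A boundary is a combination of products with linear forms and vanishes at the origin, whereas
these morphisms are constant matrices. -/
lemma Hom.eq_of_homotopic {V W : CliffordData B} {c c' : V.Hom W}
    (h : homotopic _ c.toMF c'.toMF) : c = c' := by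
  obtain ⟨h₀, h₁, e₀, e₁⟩ := (homotopic_ofMatrixHom_iff _ _ _ _ _ _ _ _).1 h
  have hc {I J : Type} (M : Matrix I J ℝ) : (M.map (MvPowerSeries.C (σ := σ))).map
      (MvPowerSeries.constantCoeff (σ := σ) (R := ℝ)) = M := by
    ext; simp
  have e₀' := congrArg (fun M => M.map (MvPowerSeries.constantCoeff (σ := σ) (R := ℝ))) e₀
  have e₁' := congrArg (fun M => M.map (MvPowerSeries.constantCoeff (σ := σ) (R := ℝ))) e₁
  simp only [Matrix.map_sub _ (map_sub _), Matrix.map_add _ (map_add _), Matrix.map_mul,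
    map_constantCoeff_linearForm, hc, Matrix.zero_mul, Matrix.mul_zero, add_zero] at e₀' e₁'
  exact Hom.ext (sub_eq_zero.1 e₀') (sub_eq_zero.1 e₁')

variable [DecidableEq σ]

/-- A morphism is a Koszul cycle, so the contraction shows that it differs from a constant matrix c
by a boundary. Then c is itself a cycle, and the degree one part of this says that c graded commutes
with all γᵢ. -/
lemma exists_homotopic_toMF (C : Matrix σ σ ℝ) (hC : C * (B + Bᵀ) = 1) {V W : CliffordData B}
    (f : V.toMF ⟶ W.toMF) : ∃ c : V.Hom W, homotopic _ f c.toMF := by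
  obtain ⟨F₀, F₁, H₀, H₁, rfl⟩ := exists_eq_ofMatrixHom f
  obtain ⟨H, π, hH, -⟩ := exists_koszul_homotopy (gradedCommutator V W)
    (gradedAnticommutator V W C) (gradedCommutator_anticomm V W)
    (gradedCommutator_gradedAnticommutator V W C hC)
  set φ := fromBlocks F₀ 0 0 F₁ with hφ
  have hφ0 : koszul (gradedCommutator V W) (series φ) = 0 := by
    rw [← series_linearForm_γ_mul_sub, linearForm_γ, linearForm_γ, hφ, hat_fromBlocks,
      fromBlocks_multiply, fromBlocks_multiply]
    simp [H₀, H₁]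
  set c := π (series φ 0)
  set h := series.symm (H (series φ)) with hh
  have e₁ : series φ - Pi.single 0 c = koszul (gradedCommutator V W) (H (series φ)) := by
    rw [← hH, hφ0, map_zero, add_zero]
  have e₂ : φ - c.map (MvPowerSeries.C (σ := σ)) = linearForm W.γ * h - hat h * linearForm V.γ := by
    apply series.injective
    rw [series_linearForm_γ_mul_sub, map_sub, series_map_C, e₁, hh, LinearEquiv.apply_symm_apply]
  have e₃ : koszul (gradedCommutator V W) (Pi.single 0 c) = 0 := by
    have := congrArg (koszul (gradedCommutator V W)) e₁
    rw [koszul_koszul _ (gradedCommutator_anticomm V W), map_sub, hφ0, zero_sub,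
      neg_eq_zero] at this
    exact this
  -- The coefficient of xᵢ in the Koszul differential of the constant c is its graded commutator
  -- with γᵢ.
  have e₄ (i : σ) : W.γ i * c = hat c * V.γ i := by
    have := congrFun e₃ (Finsupp.single i 1)
    rw [koszul_apply, Finset.sum_eq_single i] at this
    · rw [if_neg (by simp), tsub_self, Pi.single_eq_same] at this
      exact sub_eq_zero.1 this
    · intro j _ hj
      rw [if_pos (by simp [Ne.symm hj])]
    · simp
  rw [← fromBlocks_toBlocks c, ← fromBlocks_toBlocks h, linearForm_γ, linearForm_γ, hat_fromBlocks,
    fromBlocks_map, hφ, fromBlocks_multiply, fromBlocks_multiply] at e₂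
  simp only [sub_eq_add_neg, fromBlocks_neg, fromBlocks_add, fromBlocks_inj] at e₂
  -- The contraction is not known to respect parity, so c may have odd blocks. Each equation splits
  -- by parity, and the diagonal blocks of c with the off-diagonal blocks of h suffice. The sign in
  -- `hat h` turns the graded commutator into the sum d h + h d.
  refine ⟨⟨c.toBlocks₁₁, c.toBlocks₂₂, fun i => ?_, fun i => ?_⟩, ?_⟩
  · have := e₄ i
    rw [← fromBlocks_toBlocks c, γ, γ, hat_fromBlocks, fromBlocks_multiply, fromBlocks_multiply,
      fromBlocks_inj] at this
    simpa using this.2.2.1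
  · have := e₄ i
    rw [← fromBlocks_toBlocks c, γ, γ, hat_fromBlocks, fromBlocks_multiply, fromBlocks_multiply,
      fromBlocks_inj] at this
    simpa using this.2.1
  · refine (homotopic_ofMatrixHom_iff _ _ _ _ _ _ _ _).2
      ⟨h.toBlocks₂₁, h.toBlocks₁₂, ?_, ?_⟩
    · simpa [sub_eq_add_neg] using e₂.1
    · simpa [sub_eq_add_neg] using e₂.2.2.2

end CliffordData

end

/-! ### A factorization without constant terms is isomorphic to its linear part. -/

noncomputable section

open Matrix MatrixFactorization FormalSeries

namespace MvPowerSeries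

variable {σ : Type*}

lemma exists_eq_single_add {e : σ →₀ ℕ} (he : e ≠ 0) :
    ∃ k e', e = Finsupp.single k 1 + e' := by
  obtain ⟨k, hk⟩ := Finsupp.ne_iff.1 he
  refine ⟨k, e - Finsupp.single k 1, (add_tsub_cancel_of_le ?_).symm⟩
  rw [Finsupp.single_le_iff]
  exact Nat.one_le_iff_ne_zero.2 hk

/-- Without constant terms, only splittings of the exponent into two nonzero parts contribute, and
both parts then have degree one. For i = j the two splittings coincide while the left side counts
them twice, hence the factor 2. -/
lemma coeff_mul_single_add_single [DecidableEq σ] {f g : MvPowerSeries σ ℝ}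
    (hf : constantCoeff f = 0) (hg : constantCoeff g = 0) (i j : σ) :
    coeff (Finsupp.single i 1) f * coeff (Finsupp.single j 1) g +
      coeff (Finsupp.single j 1) f * coeff (Finsupp.single i 1) g =
    (if i = j then 2 else 1) * coeff (Finsupp.single i 1 + Finsupp.single j 1) (f * g) := by
  have h : coeff (Finsupp.single i 1 + Finsupp.single j 1) (f * g) =
      ∑ p ∈ {(Finsupp.single i 1, Finsupp.single j 1), (Finsupp.single j 1, Finsupp.single i 1)},
        coeff p.1 f * coeff p.2 g := by
    rw [coeff_mul]
    refine (Finset.sum_subset ?_ ?_).symm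
    · intro p hp
      rw [Finset.mem_insert, Finset.mem_singleton] at hp
      rw [Finset.HasAntidiagonal.mem_antidiagonal]
      obtain rfl | rfl := hp
      · rfl
      · exact add_comm _ _
    · rintro ⟨a, b⟩ hp hp'
      rw [Finset.HasAntidiagonal.mem_antidiagonal] at hp
      by_contra hne
      have ha : a ≠ 0 := by
        rintro rfl
        exact hne (by rw [coeff_zero_eq_constantCoeff_apply, hf, zero_mul])
      have hb : b ≠ 0 := by
        rintro rfl
        exact hne (by rw [coeff_zero_eq_constantCoeff_apply g, hg, mul_zero])
      obtain ⟨k, a', rfl⟩ := exists_eq_single_add ha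
      obtain ⟨l, b', rfl⟩ := exists_eq_single_add hb
      dsimp only at hp
      have hd := congrArg Finsupp.degree hp
      simp only [map_add, Finsupp.degree_single] at hd
      have ha' : a' = 0 := (Finsupp.degree_eq_zero_iff a').1 (by omega)
      have hb' : b' = 0 := (Finsupp.degree_eq_zero_iff b').1 (by omega)
      subst ha' hb'
      rw [add_zero, add_zero,
        Finsupp.single_add_single_eq_single_add_single one_ne_zero one_ne_zero] at hp
      apply hp'
      rw [add_zero, add_zero]
      obtain ⟨rfl, rfl⟩ | ⟨-, rfl, rfl⟩ | ⟨h, -, -⟩ := hp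
      · simp
      · simp
      · exact absurd h (by norm_num)
  rw [h]
  by_cases hij : i = j
  · subst hij
    simp only [Finset.insert_eq_of_mem, Finset.mem_singleton, Finset.sum_singleton, if_pos]
    ring
  · rw [Finset.sum_pair, if_neg hij, one_mul]
    simp [Finsupp.single_left_inj, hij]

end MvPowerSeries

lemma coeff_quadraticSeries {σ : Type*} [Fintype σ] [DecidableEq σ] (B : Matrix σ σ ℝ) (i j : σ) :
    (if i = j then 2 else 1) * MvPowerSeries.coeff (Finsupp.single i 1 + Finsupp.single j 1)
      (quadraticSeries B) = B i j + B j i := by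
  have h (k l : σ) : (if i = j then 2 else 1) *
      MvPowerSeries.coeff (Finsupp.single i 1 + Finsupp.single j 1)
        (MvPowerSeries.C (B k l) * MvPowerSeries.X k * MvPowerSeries.X l : MvPowerSeries σ ℝ) =
      (if i = k then if j = l then B k l else 0 else 0) +
        (if j = k then if i = l then B k l else 0 else 0) := by
    rw [← MvPowerSeries.coeff_mul_single_add_single (by simp) (by simp)]
    simp only [MvPowerSeries.coeff_C_mul, MvPowerSeries.coeff_X,
      Finsupp.single_left_inj one_ne_zero]
    congr 1 <;> split_ifs <;> simp
  simp only [quadraticSeries, map_sum, Finset.mul_sum, h, Finset.sum_add_distrib]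
  simp

namespace CliffordData

variable {σ : Type} [Fintype σ] {B : Matrix σ σ ℝ} [DecidableEq σ]

/-- The degree two part of the factorization equation involves only the linear coefficients, and
polarizing it gives the Clifford relations. -/
lemma linear_coeff_rel {I J : Type} [Fintype J] [Fintype I] [DecidableEq I]
    {M : Matrix I J (MvPowerSeries σ ℝ)}
    {N : Matrix J I (MvPowerSeries σ ℝ)} (hMN : M * N = quadraticSeries B • 1)
    (hM : series M 0 = 0) (hN : series N 0 = 0) (i j : σ) :
    series M (Finsupp.single i 1) * series N (Finsupp.single j 1) +
      series M (Finsupp.single j 1) * series N (Finsupp.single i 1) = (B i j + B j i) • 1 := by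
  ext a b
  have e := congrArg (fun x => (if i = j then 2 else 1) *
    MvPowerSeries.coeff (Finsupp.single i 1 + Finsupp.single j 1) (x a b)) hMN
  simp only [mul_apply, map_sum, Finset.mul_sum] at e
  have hM' (a c) : MvPowerSeries.constantCoeff (M a c) = 0 := congrFun (congrFun hM a) c
  have hN' (a c) : MvPowerSeries.constantCoeff (N a c) = 0 := congrFun (congrFun hN a) c
  simp only [← MvPowerSeries.coeff_mul_single_add_single (hM' _ _) (hN' _ _),
    Finset.sum_add_distrib] at e
  refine e.trans ?_
  rw [Matrix.smul_apply, Matrix.smul_apply]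
  by_cases hab : a = b
  · subst hab
    simpa using coeff_quadraticSeries B i j
  · simp [hab]

lemma series_linearForm_zero {I J : Type} (g : σ → Matrix J I ℝ) :
    series (linearForm g) 0 = 0 :=
  map_constantCoeff_linearForm g

lemma series_linearForm_single {I J : Type} (g : σ → Matrix J I ℝ) (i : σ) :
    series (linearForm g) (Finsupp.single i 1) = g i := by
  ext a b
  simp [linearForm, series_apply, Matrix.sum_apply, MvPowerSeries.coeff_mul_C,
    MvPowerSeries.coeff_X, Finsupp.single_left_inj]

lemma exists_inverse_of_series_zero_eq_one {I : Type} [Fintype I] [DecidableEq I]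
    {F : Matrix I I (MvPowerSeries σ ℝ)} (hF : series F 0 = 1) :
    ∃ G : Matrix I I (MvPowerSeries σ ℝ), G * F = 1 ∧ F * G = 1 := by
  have h : IsUnit F.det := by
    rw [MvPowerSeries.isUnit_iff_constantCoeff, RingHom.map_det]
    have : (MvPowerSeries.constantCoeff (σ := σ) (R := ℝ)).mapMatrix F = 1 := hF
    rw [this, det_one]
    exact isUnit_one
  exact ⟨F⁻¹, nonsing_inv_mul _ h, mul_nonsing_inv _ h⟩

/-- A factorization in coordinates whose entries have no constant terms is isomorphic to the one
given by its linear part. -/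
lemma exists_toMF_iso_of_reduced (C : Matrix σ σ ℝ) (hC : C * (B + Bᵀ) = 1) {I₀ I₁ : Type}
    [Fintype I₀] [Fintype I₁] [DecidableEq I₀] [DecidableEq I₁]
    (D₀ : Matrix I₁ I₀ (MvPowerSeries σ ℝ)) (D₁ : Matrix I₀ I₁ (MvPowerSeries σ ℝ))
    (h₁₀ : D₁ * D₀ = quadraticSeries B • 1) (h₀₁ : D₀ * D₁ = quadraticSeries B • 1)
    (hD₀ : series D₀ 0 = 0) (hD₁ : series D₁ 0 = 0) :
    ∃ V : CliffordData B, Nonempty (V.toMF ≅ ofMatrix D₀ D₁ h₁₀ h₀₁) := by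
  let V : CliffordData B :=
    { I₀ := I₀
      I₁ := I₁
      γ₀ i := series D₀ (Finsupp.single i 1)
      γ₁ i := series D₁ (Finsupp.single i 1)
      rel₀ := linear_coeff_rel h₁₀ hD₁ hD₀
      rel₁ := linear_coeff_rel h₀₁ hD₀ hD₁ }
  obtain ⟨H, π, hH, hH'⟩ := exists_koszul_homotopy (gradedCommutator V V)
    (gradedAnticommutator V V C) (gradedCommutator_anticomm V V)
    (gradedCommutator_gradedAnticommutator V V C hC)
  set D := koszul (gradedCommutator V V) with hD
  have hDD := koszul_koszul _ (gradedCommutator_anticomm V V)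
  set L := linearForm V.γ with hL
  set d : Matrix (I₀ ⊕ I₁) (I₀ ⊕ I₁) (MvPowerSeries σ ℝ) := fromBlocks 0 D₁ D₀ 0 with hd
  have hdd : d * d = quadraticSeries B • 1 := by
    rw [hd, fromBlocks_multiply, ← fromBlocks_one, fromBlocks_smul]
    simp [h₁₀, h₀₁]
  have hLL : L * L = quadraticSeries B • 1 := linearForm_mul_linearForm_eq _ _ V.γ_mul_γ
  have hatd : hat d = -d := by simp [hd, hat_fromBlocks, fromBlocks_neg]
  have hatL : hat L = -L := by
    rw [hL, linearForm_γ]; simp [hat_fromBlocks, fromBlocks_neg]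
  have hs (M) : series (L * M - hat M * L) = D (series M) := series_linearForm_γ_mul_sub V V M
  -- L is the linear part of d, so δ has order at least 2. The aim is an invertible φ with `d * φ =
  -- hat φ * L`, that is D φ = -δ φ, where D is the Koszul differential.
  set δ := d - L with hδ
  have hδ2 : OrderGE (series δ) 2 := by
    intro e he
    rw [hδ, map_sub, Pi.sub_apply, sub_eq_zero]
    by_cases he0 : e = 0
    · subst he0
      have h1 : series d 0 = fromBlocks 0 (series D₁ 0) (series D₀ 0) 0 := by
        rw [hd]; ext (a | a) (b | b) <;> simp [series_apply]
      rw [h1, hD₀, hD₁, hL, series_linearForm_zero, fromBlocks_zero]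
    · obtain ⟨i, e', rfl⟩ := MvPowerSeries.exists_eq_single_add he0
      rw [map_add, Finsupp.degree_single] at he
      have he' : e' = 0 := (Finsupp.degree_eq_zero_iff e').1 (by omega)
      rw [he', add_zero, hL, series_linearForm_single, hd]
      ext (a | a) (b | b) <;> simp [series_apply, γ, V]
  have hδM (M : Matrix (I₀ ⊕ I₁) (I₀ ⊕ I₁) (MvPowerSeries σ ℝ)) (k : ℕ)
      (hM : OrderGE (series M) k) : OrderGE (series (δ * M)) (k + 2) := by
    intro e he
    rw [series_mul]
    refine Finset.sum_eq_zero fun p hp => ?_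
    rw [Finset.HasAntidiagonal.mem_antidiagonal] at hp
    have := congrArg Finsupp.degree hp
    rw [map_add] at this
    by_cases h : p.1.degree < 2
    · rw [hδ2 _ h, Matrix.zero_mul]
    · rw [hM _ (by omega), Matrix.mul_zero]
  -- A solution of D φ = -δ φ is sought in the form φ = 1 - H (δ φ). Multiplication by δ gains two
  -- degrees and H loses at most one, so ψ ↦ -H (δ ψ) raises the order and the fixed point exists.
  let T : ((σ →₀ ℕ) → Matrix (I₀ ⊕ I₁) (I₀ ⊕ I₁) ℝ) →+
      ((σ →₀ ℕ) → Matrix (I₀ ⊕ I₁) (I₀ ⊕ I₁) ℝ) :=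
    { toFun ψ := -H (series (δ * series.symm ψ))
      map_zero' := by simp
      map_add' ψ ψ' := by simp only [map_add, Matrix.mul_add]; abel }
  have hT (ψ k) (hψ : OrderGE ψ k) : OrderGE (T ψ) (k + 1) := by
    intro e he
    change -_ = (0 : Matrix _ _ ℝ)
    rw [hH' _ (k + 1) (hδM (series.symm ψ) k (by rwa [LinearEquiv.apply_symm_apply])) e he,
      neg_zero]
  obtain ⟨f, hf⟩ := exists_eq_add_apply T hT (series 1)
  set φ := series.symm f with hφ
  have hφf : series φ = f := LinearEquiv.apply_symm_apply _ _
  have hφ0 : series φ 0 = 1 := by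
    rw [hφf, hf, Pi.add_apply, hT f 0 (fun e he => absurd he (Nat.not_lt_zero _)) 0 (by simp),
      add_zero]
    ext a b
    by_cases hab : a = b
    · subst hab; simp [series_apply]
    · simp [series_apply, hab]
  set c := d * φ - hat φ * L with hc
  have hDδ : c - δ * φ = L * φ - hat φ * L := by
    rw [hc, hδ, Matrix.sub_mul]; abel
  -- The fixed point satisfies D φ = -D H (δ φ). Since δ φ has no constant term, the homotopy
  -- formula leaves c = D φ + δ φ = H D (δ φ).
  have e₁ : series c = H (D (series (δ * φ))) := by
    have h1 : D (series 1) = 0 := by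
      rw [← hs, hat_one, Matrix.mul_one, Matrix.one_mul, sub_self, map_zero]
    have h2 : f = series 1 - H (series (δ * φ)) := by
      conv_lhs => rw [hf]
      rw [sub_eq_add_neg]; rfl
    have h3 : series (c - δ * φ) = -D (H (series (δ * φ))) := by
      rw [hDδ, hs, hφf, h2, map_sub, h1, zero_sub]
    have h4 := hH (series (δ * φ))
    rw [hδM φ 0 (fun e he => absurd he (Nat.not_lt_zero _)) 0 (by simp), map_zero,
      Pi.single_zero, sub_zero] at h4
    rw [map_sub, sub_eq_iff_eq_add] at h3
    rw [h3]
    nth_rewrite 2 [← h4]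
    abel
  -- As D² = 0, D (δ φ) = D c. Both d and L square to the same scalar, so `d * c = hat c * L`.
  -- Replacing d by L + δ gives D c = -δ c.
  have e₂ : D (series (δ * φ)) = -series (δ * c) := by
    have h1 : series (δ * φ) = series c - D (series φ) := by
      rw [← hs, ← hDδ, ← map_sub]; congr 1; abel
    rw [h1, map_sub, hDD, sub_zero, ← hs, ← map_neg]
    have h2 : hat c = -(d * hat φ) + φ * L := by
      rw [hc, hat_sub, hat_mul, hat_mul, hat_hat, hatd, hatL]
      simp only [Matrix.neg_mul, Matrix.mul_neg, sub_neg_eq_add]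
    have h3 : d * c - hat c * L = 0 := by
      rw [h2, hc, Matrix.mul_sub, ← Matrix.mul_assoc, hdd, Matrix.add_mul, Matrix.mul_assoc φ, hLL,
        Matrix.smul_mul, Matrix.mul_smul, Matrix.one_mul, Matrix.mul_one, Matrix.neg_mul,
        Matrix.mul_assoc]
      abel
    congr 1
    rw [hδ, Matrix.sub_mul, neg_sub, sub_right_inj]
    exact (sub_eq_zero.1 h3).symm
  -- Together, c = -H (δ c) = T c, and an order raising operator has no nonzero fixed point.
  have hc0 : c = 0 := by
    apply series.injective
    rw [map_zero]
    refine eq_zero_of_eq_apply T hT ?_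
    change _ = -H (series (δ * series.symm (series c)))
    rw [LinearEquiv.symm_apply_apply]
    nth_rewrite 1 [e₁]
    rw [e₂, map_neg]
  rw [hc, sub_eq_zero, ← fromBlocks_toBlocks φ, hat_fromBlocks, hL, linearForm_γ, hd,
    fromBlocks_multiply, fromBlocks_multiply, fromBlocks_inj] at hc0
  simp only [Matrix.zero_mul, Matrix.mul_zero, zero_add, add_zero] at hc0
  obtain ⟨-, H₁, H₀, -⟩ := hc0
  -- Only the diagonal blocks of φ are used. They form an even morphism and have constant term 1,
  -- hence are invertible.
  obtain ⟨G₀, hG₀, hG₀'⟩ := exists_inverse_of_series_zero_eq_one (F := φ.toBlocks₁₁) (by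
    ext a b
    have := congrFun (congrFun hφ0 (Sum.inl a)) (Sum.inl b)
    exact this.trans (by simp [one_apply]))
  obtain ⟨G₁, hG₁, hG₁'⟩ := exists_inverse_of_series_zero_eq_one (F := φ.toBlocks₂₂) (by
    ext a b
    have := congrFun (congrFun hφ0 (Sum.inr a)) (Sum.inr b)
    exact this.trans (by simp [one_apply]))
  exact ⟨V, ⟨ofMatrixIso φ.toBlocks₁₁ φ.toBlocks₂₂ H₀ H₁ G₀ G₁ hG₀ hG₀' hG₁ hG₁'⟩⟩

end CliffordData

end

/-! ### Splitting off contractible summands. -/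

noncomputable section

namespace MatrixFactorization

section Split

variable {R : Type u} [CommRing R] [IsLocalRing R] [IsDomain R] {w : R}

/-- Projection along x makes the kernel a direct summand, hence projective and finite, hence free
over a local ring. The rank drops because the quotient by the kernel is R. -/
lemma free_ker_of_apply_eq_one {X : Type*} [AddCommGroup X] [Module R X] [Module.Free R X]
    [Module.Finite R X] (μ : X →ₗ[R] R) {x : X} (hx : μ x = 1) :
    Module.Free R (LinearMap.ker μ) ∧ Module.Finite R (LinearMap.ker μ) ∧
      Module.finrank R (LinearMap.ker μ) < Module.finrank R X := by
  let s : X →ₗ[R] LinearMap.ker μ := LinearMap.codRestrict _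
    (LinearMap.id - (LinearMap.toSpanSingleton R X x) ∘ₗ μ) fun y => by simp [hx]
  have hs : s ∘ₗ (LinearMap.ker μ).subtype = LinearMap.id := by
    ext y
    have := LinearMap.mem_ker.1 y.2
    simp [s, this]
  have := Module.Projective.of_split _ _ hs
  have : Module.Finite R (LinearMap.ker μ) :=
    Module.Finite.of_surjective s fun y => ⟨y, LinearMap.congr_fun hs y⟩
  have : Module.Free R (LinearMap.ker μ) := Module.free_of_flat_of_isLocalRing
  refine ⟨inferInstance, inferInstance, ?_⟩
  have := Submodule.finrank_quotient_add_finrank (LinearMap.ker μ)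
  rw [(μ.quotKerEquivOfSurjective fun r => ⟨r • x, by simp [hx]⟩).finrank_eq,
    Module.finrank_self] at this
  omega

/-- A vector whose differential is part of a basis spans a contractible direct summand. -/
lemma exists_iso_of_apply_d₀_eq_one (X : MatrixFactorization R w) (l : X.X₁ →ₗ[R] R) (x : X.X₀)
    (hx : l (X.d₀ x) = 1) : ∃ Y : MatrixFactorization R w,
      Nonempty ((HMF.quotient R w).obj Y ≅ (HMF.quotient R w).obj X) ∧
      Module.finrank R Y.X₀ + Module.finrank R Y.X₁ <
        Module.finrank R X.X₀ + Module.finrank R X.X₁ := by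
  -- The summand spanned by x and d x is contractible. The kernels of l ∘ d and of l form a
  -- complement stable under the differential, since μ (d y) = w · l y.
  let μ : X.X₀ →ₗ[R] R := l ∘ₗ X.d₀
  have hμ : μ x = 1 := hx
  obtain ⟨_, _, h₀⟩ := free_ker_of_apply_eq_one μ hμ
  obtain ⟨_, _, h₁⟩ := free_ker_of_apply_eq_one l hx
  have hμd (y) : μ (X.d₁ y) = w * l y := by simp [μ]
  let Y : MatrixFactorization R w :=
    { X₀ := LinearMap.ker μ
      X₁ := LinearMap.ker l
      d₀ := X.d₀.restrict fun y hy => hy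
      d₁ := X.d₁.restrict fun y hy => by
        rw [LinearMap.mem_ker] at hy ⊢
        rw [hμd, hy, mul_zero]
      d₁_d₀ y := Subtype.ext (X.d₁_d₀ y)
      d₀_d₁ y := Subtype.ext (X.d₀_d₁ y) }
  let i : Y ⟶ X :=
    { f₀ := (LinearMap.ker μ).subtype
      f₁ := (LinearMap.ker l).subtype
      comm₀ _ := rfl
      comm₁ _ := rfl }
  let p : X ⟶ Y :=
    { f₀ := LinearMap.codRestrict _ (LinearMap.id - (LinearMap.toSpanSingleton R _ x) ∘ₗ μ)
        fun y => by simp [hμ]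
      f₁ := LinearMap.codRestrict _ (LinearMap.id - (LinearMap.toSpanSingleton R _ (X.d₀ x)) ∘ₗ l)
        fun y => by simp [hx]
      comm₀ y := Subtype.ext (by
        change X.d₀ (y - μ y • x) = X.d₀ y - l (X.d₀ y) • X.d₀ x
        rw [map_sub, map_smul]; rfl)
      comm₁ y := Subtype.ext (by
        change X.d₁ (y - l y • X.d₀ x) = X.d₁ y - μ (X.d₁ y) • x
        rw [map_sub, map_smul, X.d₁_d₀, hμd, mul_comm, mul_smul]) }
  refine ⟨Y, ⟨⟨(HMF.quotient R w).map i, (HMF.quotient R w).map p, ?_, ?_⟩⟩, add_lt_add h₀ h₁⟩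
  · rw [← Functor.map_comp, ← CategoryTheory.Functor.map_id]
    congr 1
    refine hom_ext (fun y => Subtype.ext ?_) (fun y => Subtype.ext ?_)
    · change (y : X.X₀) - μ y • x = y
      rw [LinearMap.mem_ker.1 y.2, zero_smul, sub_zero]
    · change (y : X.X₁) - l y • X.d₀ x = y
      rw [LinearMap.mem_ker.1 y.2, zero_smul, sub_zero]
  · rw [← Functor.map_comp, ← CategoryTheory.Functor.map_id, eq_comm, HMF.quotient_map_eq_iff]
    -- Identity minus projection is the boundary of y ↦ l(y) x, the contraction of the split
    -- summand.
    refine ⟨0, LinearMap.toSpanSingleton R _ x ∘ₗ l, fun y => ?_, fun y => ?_⟩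
    · change y - (y - μ y • x) = X.d₁ 0 + l (X.d₀ y) • x
      rw [map_zero, zero_add, sub_sub_cancel]; rfl
    · change y - (y - l y • X.d₀ x) = X.d₀ (l y • x) + 0
      rw [add_zero, sub_sub_cancel, map_smul]

/-- This is the preceding case for ΣX, shifted back. The differential of ΣX is negated, hence the
functional -l. -/
lemma exists_iso_of_apply_d₁_eq_one (X : MatrixFactorization R w) (l : X.X₀ →ₗ[R] R) (x : X.X₁)
    (hx : l (X.d₁ x) = 1) : ∃ Y : MatrixFactorization R w,
      Nonempty ((HMF.quotient R w).obj Y ≅ (HMF.quotient R w).obj X) ∧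
      Module.finrank R Y.X₀ + Module.finrank R Y.X₁ <
        Module.finrank R X.X₀ + Module.finrank R X.X₁ := by
  obtain ⟨Y, ⟨e⟩, hY⟩ := exists_iso_of_apply_d₀_eq_one ((sigma w).obj X) (-l) x (by
    change -l (-X.d₁ x) = 1
    rw [map_neg, neg_neg, hx])
  refine ⟨(sigma w).obj Y, ⟨?_⟩, ?_⟩
  · exact ((HMF.quotient R w).commShiftIso (1 : ℤ)).app Y ≪≫
      (shiftFunctor (HMF R w) (1 : ℤ)).mapIso e ≪≫
      (((HMF.quotient R w).commShiftIso (1 : ℤ)).app ((sigma w).obj X)).symm ≪≫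
      (HMF.quotient R w).mapIso ((sigmaSigma w).app X).symm
  · change Module.finrank R Y.X₁ + Module.finrank R Y.X₀ < _
    rw [add_comm, add_comm (Module.finrank R X.X₀)]
    exact hY

end Split

section Coordinates

variable {R : Type u} [CommRing R] {w : R} {I₀ I₁ : Type}
  [Fintype I₀] [Fintype I₁] [DecidableEq I₀] [DecidableEq I₁]

/-- A choice of bases puts a factorization in coordinates. -/
lemma exists_iso_ofMatrix (X : MatrixFactorization R w) (b₀ : Module.Basis I₀ R X.X₀)
    (b₁ : Module.Basis I₁ R X.X₁) :
    ∃ (h₁₀ : LinearMap.toMatrix b₁ b₀ X.d₁ * LinearMap.toMatrix b₀ b₁ X.d₀ = w • 1)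
      (h₀₁ : LinearMap.toMatrix b₀ b₁ X.d₀ * LinearMap.toMatrix b₁ b₀ X.d₁ = w • 1),
      Nonempty (X ≅ ofMatrix _ _ h₁₀ h₀₁) := by
  refine ⟨?_, ?_, ⟨isoMk b₀.equivFun b₁.equivFun (fun x => ?_) (fun x => ?_)⟩⟩
  · rw [← LinearMap.toMatrix_comp, ← LinearMap.toMatrix_id b₀, ← map_smul]
    congr 1
    ext x
    simp
  · rw [← LinearMap.toMatrix_comp, ← LinearMap.toMatrix_id b₁, ← map_smul]
    congr 1
    ext x
    simp
  · exact LinearMap.toMatrix_mulVec_repr b₀ b₁ X.d₀ x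
  · exact LinearMap.toMatrix_mulVec_repr b₁ b₀ X.d₁ x

end Coordinates

end MatrixFactorization

open MatrixFactorization

namespace CliffordData

variable {σ : Type} [Fintype σ] [DecidableEq σ] {B : Matrix σ σ ℝ}

/-- Every factorization is homotopy equivalent to that of a Clifford module. -/
lemma exists_toMF_iso (C : Matrix σ σ ℝ) (hC : C * (B + B.transpose) = 1)
    (X : MatrixFactorization (MvPowerSeries σ ℝ) (quadraticSeries B)) :
    ∃ V : CliffordData B, Nonempty ((HMF.quotient _ _).obj V.toMF ≅ (HMF.quotient _ _).obj X) := by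
  -- Induction on the total rank: as long as some entry of the differential is a unit, a
  -- contractible summand splits off and the rank drops.
  induction hk : Module.finrank (MvPowerSeries σ ℝ) X.X₀ + Module.finrank (MvPowerSeries σ ℝ) X.X₁
    using Nat.strong_induction_on generalizing X with
  | _ k ih =>
  subst hk
  have : IsDomain (MvPowerSeries σ ℝ) := NoZeroDivisors.to_isDomain _
  let b₀ := Module.finBasis (MvPowerSeries σ ℝ) X.X₀
  let b₁ := Module.finBasis (MvPowerSeries σ ℝ) X.X₁
  have of_iso (Y : MatrixFactorization (MvPowerSeries σ ℝ) (quadraticSeries B))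
      (e : Nonempty ((HMF.quotient _ _).obj Y ≅ (HMF.quotient _ _).obj X))
      (hY : Module.finrank (MvPowerSeries σ ℝ) Y.X₀ + Module.finrank (MvPowerSeries σ ℝ) Y.X₁ <
        Module.finrank (MvPowerSeries σ ℝ) X.X₀ + Module.finrank (MvPowerSeries σ ℝ) X.X₁) :
      ∃ V : CliffordData B,
        Nonempty ((HMF.quotient _ _).obj V.toMF ≅ (HMF.quotient _ _).obj X) := by
    obtain ⟨V, ⟨e'⟩⟩ := ih _ hY Y rfl
    exact ⟨V, e.map fun e => e' ≪≫ e⟩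
  have unit {r : MvPowerSeries σ ℝ} (h : MvPowerSeries.constantCoeff r ≠ 0) : ∃ s, s * r = 1 :=
    (MvPowerSeries.isUnit_iff_constantCoeff.2 h.isUnit).exists_left_inv
  -- A power series with nonzero constant term is a unit. Scaling the coordinate functional by its
  -- inverse s makes the entry equal to 1.
  by_cases h₀ : ∃ i j, MvPowerSeries.constantCoeff (b₁.repr (X.d₀ (b₀ i)) j) ≠ 0
  · obtain ⟨i, j, h⟩ := h₀
    obtain ⟨s, hs⟩ := unit h
    obtain ⟨Y, e, hY⟩ := exists_iso_of_apply_d₀_eq_one X (s • b₁.coord j) (b₀ i) hs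
    exact of_iso Y e hY
  by_cases h₁ : ∃ i j, MvPowerSeries.constantCoeff (b₀.repr (X.d₁ (b₁ i)) j) ≠ 0
  · obtain ⟨i, j, h⟩ := h₁
    obtain ⟨s, hs⟩ := unit h
    obtain ⟨Y, e, hY⟩ := exists_iso_of_apply_d₁_eq_one X (s • b₀.coord j) (b₁ i) hs
    exact of_iso Y e hY
  push Not at h₀ h₁
  obtain ⟨h₁₀, h₀₁, ⟨e⟩⟩ := exists_iso_ofMatrix X b₀ b₁
  obtain ⟨V, ⟨e'⟩⟩ := exists_toMF_iso_of_reduced C hC _ _ h₁₀ h₀₁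
    (by
      ext j i
      simpa [Matrix.series_apply, LinearMap.toMatrix_apply] using h₀ i j)
    (by
      ext j i
      simpa [Matrix.series_apply, LinearMap.toMatrix_apply] using h₁ i j)
  exact ⟨V, ⟨(HMF.quotient _ _).mapIso (e' ≪≫ e.symm)⟩⟩

end CliffordData

end

/-! ### Octonions, the spinor module and a dimension count for intertwiners. -/

noncomputable section

open Matrix

section Octonion

/-- The parity of the sign in the product of two octonion units. -/
def octonionSign (i a : Fin 8) : Bool :=
  -- Bit a of the i-th mask is set exactly when eᵢ eₐ = -e_c, where c is the bitwise sum of i and a.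
  -- Otherwise the sign is plus.
  Nat.testBit (![0, 106, 198, 172, 30, 116, 216, 178] i) a

/-- The sign form of LᵢᵀLⱼ + LⱼᵀLᵢ = 0: both products have their nonzero entries in the same places,
and for i ≠ j with opposite signs. It is a finite check. -/
lemma octonionSign_xor : ∀ i j a : Fin 8, i ≠ j →
    (octonionSign j a ^^ octonionSign i (a ^^^ i ^^^ j)) =
      !(octonionSign i a ^^ octonionSign j (a ^^^ i ^^^ j)) := by
  decide

lemma eq_xor_of_xor_eq : ∀ i j a b : Fin 8, a ^^^ i = b ^^^ j ↔ b = a ^^^ i ^^^ j := by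
  decide

lemma xor_xor_comm_fin : ∀ i j a : Fin 8, a ^^^ i ^^^ j = a ^^^ j ^^^ i := by
  decide

/-- Left multiplication by an octonion unit. -/
def octonionUnit (i : Fin 8) : Matrix (Fin 8) (Fin 8) ℝ :=
  of fun k a => if k = a ^^^ i then bif octonionSign i a then -1 else 1 else 0

lemma octonionUnit_transpose_mul_apply (i j a b : Fin 8) :
    ((octonionUnit i)ᵀ * octonionUnit j) a b = if b = a ^^^ i ^^^ j then
      (bif octonionSign i a ^^ octonionSign j (a ^^^ i ^^^ j) then -1 else 1) else 0 := by
  simp only [mul_apply, transpose_apply, octonionUnit, of_apply, ite_mul, zero_mul,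
    Finset.sum_ite_eq', Finset.mem_univ, if_true]
  simp only [eq_xor_of_xor_eq]
  split_ifs with h
  · subst h
    cases octonionSign i a <;> cases octonionSign j (a ^^^ i ^^^ j) <;> simp
  · simp

lemma octonionUnit_transpose_mul_self (i : Fin 8) : (octonionUnit i)ᵀ * octonionUnit i = 1 := by
  ext a b
  have h : a ^^^ i ^^^ i = a := ((eq_xor_of_xor_eq i i a a).1 rfl).symm
  rw [octonionUnit_transpose_mul_apply, h, Bool.xor_self, one_apply]
  simp [eq_comm]

lemma octonionUnit_transpose_mul_add {i j : Fin 8} (hij : i ≠ j) :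
    (octonionUnit i)ᵀ * octonionUnit j + (octonionUnit j)ᵀ * octonionUnit i = 0 := by
  ext a b
  rw [Matrix.add_apply, octonionUnit_transpose_mul_apply, octonionUnit_transpose_mul_apply,
    xor_xor_comm_fin j i, octonionSign_xor i j a hij]
  split_ifs
  · cases (octonionSign i a ^^ octonionSign j (a ^^^ i ^^^ j)) <;> simp
  · simp

/-- Conjugating LᵢᵀLⱼ + LⱼᵀLᵢ = 0 by the orthogonal matrix Lᵢ moves the transposes to the other
side. -/
lemma octonionUnit_mul_transpose_add {i j : Fin 8} (hij : i ≠ j) :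
    octonionUnit i * (octonionUnit j)ᵀ + octonionUnit j * (octonionUnit i)ᵀ = 0 := by
  have hi := mul_eq_one_comm.1 (octonionUnit_transpose_mul_self i)
  have hj := mul_eq_one_comm.1 (octonionUnit_transpose_mul_self j)
  have h := octonionUnit_transpose_mul_add hij
  have h' := congrArg (fun M => octonionUnit i * M * (octonionUnit i)ᵀ) h
  simp only [Matrix.mul_add, Matrix.add_mul, Matrix.mul_zero, Matrix.zero_mul] at h'
  rw [← Matrix.mul_assoc, hi, Matrix.one_mul, Matrix.mul_assoc, Matrix.mul_assoc, hi,
    Matrix.mul_one] at h'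
  rw [add_comm]
  exact h'

end Octonion

namespace CliffordData

/-- The graded spinor module of the positive definite form in eight variables: multiplication of
octonions. -/
def spinor : CliffordData (1 : Matrix (Fin 8) (Fin 8) ℝ) where
  I₀ := Fin 8
  I₁ := Fin 8
  γ₀ := octonionUnit
  γ₁ i := (octonionUnit i)ᵀ
  rel₀ i j := by
    by_cases hij : i = j
    · subst hij
      rw [octonionUnit_transpose_mul_self, one_apply_eq, add_smul, one_smul]
    · rw [octonionUnit_transpose_mul_add hij, one_apply_ne hij, one_apply_ne (Ne.symm hij),
        add_zero, zero_smul]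
  rel₁ i j := by
    by_cases hij : i = j
    · subst hij
      rw [mul_eq_one_comm.1 (octonionUnit_transpose_mul_self i), one_apply_eq, add_smul, one_smul]
    · rw [octonionUnit_mul_transpose_add hij, one_apply_ne hij, one_apply_ne (Ne.symm hij),
        add_zero, zero_smul]

end CliffordData

section CommonKernel

variable {E : Type*} [AddCommGroup E] [Module ℝ E] {m : Type*} (ι ε : m → E →ₗ[ℝ] E)

/-- The common kernel of some of the operators `ι`. -/
def commonKer (s : Finset m) : Submodule ℝ E := ⨅ i ∈ s, LinearMap.ker (ι i)

lemma mem_commonKer {s : Finset m} {x : E} : x ∈ commonKer ι s ↔ ∀ i ∈ s, ι i x = 0 := by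
  simp [commonKer]

variable {ι ε} [DecidableEq m]

/-- ιₐ squares to zero, so its image lies in its own kernel, and by anticommutation it preserves the
other kernels. -/
lemma apply_mem_commonKer_insert (hι : ∀ i j x, ι i (ι j x) = -ι j (ι i x)) {s : Finset m} (a : m)
    {x : E} (hx : x ∈ commonKer ι s) : ι a x ∈ commonKer ι (insert a s) := by
  rw [mem_commonKer] at hx ⊢
  intro i hi
  obtain rfl | hi := Finset.mem_insert.1 hi
  · have : IsAddTorsionFree E := .of_isTorsionFree ℝ _
    exact self_eq_neg.1 (hι i i x)
  · rw [hι, hx i hi, map_zero, neg_zero]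

lemma apply_mem_commonKer (hε : ∀ i j x, ι i (ε j x) + ε j (ι i x) = if i = j then x else 0)
    {s : Finset m} {a : m} (ha : a ∉ s) {x : E} (hx : x ∈ commonKer ι s) :
    ε a x ∈ commonKer ι s := by
  rw [mem_commonKer] at hx ⊢
  intro i hi
  have := hε i a x
  rwa [hx i hi, map_zero, add_zero, if_neg (ne_of_mem_of_not_mem hi ha)] at this

/-- A subspace which is stable under the operators `ε` and contains their common kernel is
everything. -/
lemma commonKer_le (hι : ∀ i j x, ι i (ι j x) = -ι j (ι i x))
    (hε : ∀ i j x, ι i (ε j x) + ε j (ι i x) = if i = j then x else 0) (P : Submodule ℝ E)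
    (hP : ∀ i, ∀ x ∈ P, ε i x ∈ P) {s : Finset m}
    (h : commonKer ι s ≤ P) : P = ⊤ := by
  induction s using Finset.induction_on with
  | empty => exact top_unique fun x _ => h ((mem_commonKer ι).2 (by simp))
  | insert a s ha ih =>
    refine ih fun x hx => ?_
    -- x = ιₐ εₐ x + εₐ ιₐ x, and both ιₐ εₐ x and ιₐ x lie in the smaller common kernel, hence in
    -- P.
    have := hε a a x
    rw [if_pos rfl] at this
    rw [← this]
    exact P.add_mem (h (apply_mem_commonKer_insert hι a (apply_mem_commonKer hε ha hx)))
      (hP a _ (h (apply_mem_commonKer_insert hι a hx)))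

/-- Restricted to the common kernel for s, ιₐ has the common kernel for `insert a s` both as kernel
and as image: there x = ιₐ εₐ x. Rank and nullity are therefore equal. -/
lemma finrank_commonKer_insert [FiniteDimensional ℝ E] (hι : ∀ i j x, ι i (ι j x) = -ι j (ι i x))
    (hε : ∀ i j x, ι i (ε j x) + ε j (ι i x) = if i = j then x else 0) {s : Finset m} {a : m}
    (ha : a ∉ s) : Module.finrank ℝ (commonKer ι s) =
      2 * Module.finrank ℝ (commonKer ι (insert a s)) := by
  have hle : commonKer ι (insert a s) ≤ commonKer ι s := fun x hx =>
    (mem_commonKer ι).2 fun i hi => (mem_commonKer ι).1 hx i (Finset.mem_insert_of_mem hi)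
  let f : commonKer ι s →ₗ[ℝ] E := (ι a).domRestrict (commonKer ι s)
  have hker : LinearMap.ker f = (commonKer ι (insert a s)).comap (commonKer ι s).subtype := by
    ext ⟨x, hx⟩
    rw [LinearMap.mem_ker, Submodule.mem_comap, mem_commonKer]
    simp only [Finset.forall_mem_insert]
    exact (and_iff_left ((mem_commonKer ι).1 hx)).symm
  have hrange : LinearMap.range f = commonKer ι (insert a s) := by
    apply le_antisymm
    · rintro _ ⟨x, rfl⟩
      exact apply_mem_commonKer_insert hι a x.2
    · intro x hx
      refine ⟨⟨ε a x, apply_mem_commonKer hε ha (hle hx)⟩, ?_⟩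
      have := hε a a x
      rwa [(mem_commonKer ι).1 hx a (Finset.mem_insert_self a s), map_zero, add_zero,
        if_pos rfl] at this
  have := LinearMap.finrank_range_add_finrank_ker f
  rw [hrange, hker, (Submodule.comapSubtypeEquivOfLe hle).finrank_eq] at this
  omega

lemma finrank_eq_two_pow_mul [FiniteDimensional ℝ E] (hι : ∀ i j x, ι i (ι j x) = -ι j (ι i x))
    (hε : ∀ i j x, ι i (ε j x) + ε j (ι i x) = if i = j then x else 0) (s : Finset m) :
    Module.finrank ℝ E = 2 ^ s.card * Module.finrank ℝ (commonKer ι s) := by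
  induction s using Finset.induction_on with
  | empty =>
    have : commonKer ι (∅ : Finset m) = ⊤ := by simp [commonKer]
    rw [this, finrank_top, Finset.card_empty, pow_zero, one_mul]
  | insert a s ha ih =>
    rw [ih, finrank_commonKer_insert hι hε ha, Finset.card_insert_of_notMem ha, pow_succ, mul_assoc]

end CommonKernel

namespace CliffordData

section Intertwiners

variable (U : CliffordData (1 : Matrix (Fin 8) (Fin 8) ℝ))

/-- The matrices from the spinor module which graded commute with the Clifford action. -/
def intertwiners : Submodule ℝ (Matrix (U.I₀ ⊕ U.I₁) (spinor.I₀ ⊕ spinor.I₁) ℝ) :=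
  commonKer (gradedCommutator spinor U) Finset.univ

variable {U}

lemma mem_intertwiners {φ} : φ ∈ intertwiners U ↔ ∀ i, U.γ i * φ = hat φ * spinor.γ i := by
  simp [intertwiners, mem_commonKer, gradedCommutator_apply, sub_eq_zero]

lemma half_smul_one_mul : ((1 / 2 : ℝ) • 1 : Matrix (Fin 8) (Fin 8) ℝ) *
    ((1 : Matrix (Fin 8) (Fin 8) ℝ) + (1 : Matrix (Fin 8) (Fin 8) ℝ)ᵀ) = 1 := by
  rw [transpose_one, Matrix.smul_mul, Matrix.one_mul, ← two_smul ℝ, smul_smul]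
  norm_num

variable (U) in
-- The space of matrices S → U has dimension 16 · dim U, and the eight conditions halve it eight
-- times. So 16 · dim U = 2⁸ · dim of the intertwiners.
lemma card_eq_mul_finrank_intertwiners :
    Fintype.card U.I₀ + Fintype.card U.I₁ = 16 * Module.finrank ℝ (intertwiners U) := by
  have := finrank_eq_two_pow_mul (gradedCommutator_anticomm spinor U)
    (gradedCommutator_gradedAnticommutator spinor U _ half_smul_one_mul) Finset.univ
  rw [Module.finrank_matrix, Module.finrank_self, Fintype.card_sum, Fintype.card_sum] at this
  change _ * (8 + 8) * 1 = _ at this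
  rw [Finset.card_univ, Fintype.card_fin] at this
  change _ = 2 ^ 8 * Module.finrank ℝ (intertwiners U) at this
  omega

/-- A Schur lemma over ℝ, even and odd parts at once: for U = S the count reads 16 = 16 · dim, so
the identity spans. -/
lemma exists_eq_smul_one {φ} (hφ : φ ∈ intertwiners spinor) : ∃ r : ℝ, φ = r • 1 := by
  have h := card_eq_mul_finrank_intertwiners spinor
  change 8 + 8 = _ at h
  have h1 : (1 : Matrix (spinor.I₀ ⊕ spinor.I₁) (spinor.I₀ ⊕ spinor.I₁) ℝ) ∈
      intertwiners spinor := by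
    rw [mem_intertwiners]
    intro i
    rw [hat_one, Matrix.one_mul, Matrix.mul_one]
  have h0 : (⟨1, h1⟩ : intertwiners spinor) ≠ 0 := by
    intro h
    have := congrFun (congrFun (congrArg Subtype.val h) (Sum.inl (0 : Fin 8))) (Sum.inl (0 : Fin 8))
    exact one_ne_zero ((one_apply_eq _).symm.trans this)
  have h2 : Module.finrank ℝ (intertwiners spinor) = 1 := by omega
  obtain ⟨r, hr⟩ := exists_smul_eq_of_finrank_eq_one h2 h0 ⟨φ, hφ⟩
  exact ⟨r, (congrArg Subtype.val hr).symm⟩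

lemma hat_mem_intertwiners {φ} (hφ : φ ∈ intertwiners U) : hat φ ∈ intertwiners U := by
  rw [mem_intertwiners] at hφ ⊢
  intro i
  have := congrArg hat (hφ i)
  rw [hat_mul, hat_mul, hat_hat, hat_γ, hat_γ, Matrix.neg_mul, Matrix.mul_neg, neg_inj] at this
  rw [hat_hat, this]

/-- The Clifford module is generated by the images of intertwiners. -/
lemma span_intertwiners_mul : Submodule.span ℝ {M : Matrix (U.I₀ ⊕ U.I₁) (spinor.I₀ ⊕ spinor.I₁) ℝ |
    ∃ φ ∈ intertwiners U,
      ∃ X : Matrix (spinor.I₀ ⊕ spinor.I₁) (spinor.I₀ ⊕ spinor.I₁) ℝ, M = φ * X} = ⊤ := by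
  set P := Submodule.span ℝ {M : Matrix (U.I₀ ⊕ U.I₁) (spinor.I₀ ⊕ spinor.I₁) ℝ |
    ∃ φ ∈ intertwiners U,
      ∃ X : Matrix (spinor.I₀ ⊕ spinor.I₁) (spinor.I₀ ⊕ spinor.I₁) ℝ, M = φ * X} with hP
  -- γᵢ passes an intertwiner φ at the cost of replacing φ by `hat φ`, again an intertwiner, and is
  -- absorbed into X. With the same for right multiplication, P is stable under the ε operators. It
  -- contains the common kernel of the ι, so `commonKer_le` applies.
  have hγ (i) (M) (hM : M ∈ P) : U.γ i * M ∈ P := by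
    induction hM using Submodule.span_induction with
    | mem M h =>
      obtain ⟨φ, hφ, X, rfl⟩ := h
      refine Submodule.subset_span ⟨hat φ, hat_mem_intertwiners hφ, spinor.γ i * X, ?_⟩
      rw [← Matrix.mul_assoc, mem_intertwiners.1 hφ, Matrix.mul_assoc]
    | zero => rw [Matrix.mul_zero]; exact P.zero_mem
    | add M N _ _ h h' => rw [Matrix.mul_add]; exact P.add_mem h h'
    | smul r M _ h => rw [Matrix.mul_smul]; exact P.smul_mem r h
  have hΓ (i) (M) (hM : M ∈ P) : hat M * spinor.γ i ∈ P := by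
    induction hM using Submodule.span_induction with
    | mem M h =>
      obtain ⟨φ, hφ, X, rfl⟩ := h
      refine Submodule.subset_span ⟨hat φ, hat_mem_intertwiners hφ, hat X * spinor.γ i, ?_⟩
      rw [hat_mul, Matrix.mul_assoc]
    | zero =>
      have : hat (0 : Matrix (U.I₀ ⊕ U.I₁) (spinor.I₀ ⊕ spinor.I₁) ℝ) = 0 := by
        simpa using hat_sub (0 : Matrix (U.I₀ ⊕ U.I₁) (spinor.I₀ ⊕ spinor.I₁) ℝ) 0
      rw [this, Matrix.zero_mul]; exact P.zero_mem
    | add M N _ _ h h' => rw [hat_add, Matrix.add_mul]; exact P.add_mem h h'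
    | smul r M _ h => rw [hat_smul, Matrix.smul_mul]; exact P.smul_mem r h
  refine commonKer_le (gradedCommutator_anticomm spinor U)
    (gradedCommutator_gradedAnticommutator spinor U _ half_smul_one_mul) P ?_
    (s := Finset.univ) ?_
  · intro i M hM
    exact P.smul_mem _ (P.sum_mem fun j _ => P.smul_mem _ (P.add_mem (hγ j M hM) (hΓ j M hM)))
  · intro φ hφ
    exact Submodule.subset_span ⟨φ, hφ, 1, (Matrix.mul_one φ).symm⟩

end Intertwiners

end CliffordData

end

/-! ### Graded tensor products of Clifford modules and additional variables. -/

noncomputable section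

open Matrix
open scoped Kronecker

namespace CliffordData

section Tensor

variable {σ : Type} {B₁ B₂ : Matrix σ σ ℝ}

/-- The graded tensor product of Clifford modules for `B₁` and `B₂` is one for `B₁ + B₂`. -/
def tensor (V : CliffordData B₁) (D : CliffordData B₂) : CliffordData (B₁ + B₂) where
  I₀ := D.I₀ × V.I₀ ⊕ D.I₁ × V.I₁
  I₁ := D.I₀ × V.I₁ ⊕ D.I₁ × V.I₀
  -- The generators of D carry the sign of the parity of V. This makes them anticommute with those
  -- of V, so the mixed terms in the relations cancel.
  γ₀ i := fromBlocks (1 ⊗ₖ V.γ₀ i) (-(D.γ₁ i ⊗ₖ 1)) (D.γ₀ i ⊗ₖ 1) (1 ⊗ₖ V.γ₁ i)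
  γ₁ i := fromBlocks (1 ⊗ₖ V.γ₁ i) (D.γ₁ i ⊗ₖ 1) (-(D.γ₀ i ⊗ₖ 1)) (1 ⊗ₖ V.γ₀ i)
  rel₀ i j := by
    simp only [fromBlocks_multiply, fromBlocks_add, Matrix.neg_mul, Matrix.mul_neg, neg_neg,
      ← mul_kronecker_mul, Matrix.one_mul, Matrix.mul_one]
    rw [← fromBlocks_one, fromBlocks_smul, fromBlocks_inj]
    refine ⟨?_, by rw [smul_zero]; abel, by rw [smul_zero]; abel, ?_⟩
    · rw [add_add_add_comm, ← kronecker_add, ← add_kronecker, V.rel₀, D.rel₀, kronecker_smul,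
        smul_kronecker, one_kronecker_one, ← add_smul]
      congr 1
      simp only [Matrix.add_apply]; ring
    · rw [add_add_add_comm, ← kronecker_add, ← add_kronecker, V.rel₁, D.rel₁, kronecker_smul,
        smul_kronecker, one_kronecker_one, ← add_smul]
      congr 1
      simp only [Matrix.add_apply]; ring
  rel₁ i j := by
    simp only [fromBlocks_multiply, fromBlocks_add, Matrix.neg_mul, Matrix.mul_neg, neg_neg,
      ← mul_kronecker_mul, Matrix.one_mul, Matrix.mul_one]
    rw [← fromBlocks_one, fromBlocks_smul, fromBlocks_inj]
    refine ⟨?_, by rw [smul_zero]; abel, by rw [smul_zero]; abel, ?_⟩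
    · rw [add_add_add_comm, ← kronecker_add, ← add_kronecker, V.rel₁, D.rel₀, kronecker_smul,
        smul_kronecker, one_kronecker_one, ← add_smul]
      congr 1
      simp only [Matrix.add_apply]; ring
    · rw [add_add_add_comm, ← kronecker_add, ← add_kronecker, V.rel₀, D.rel₁, kronecker_smul,
        smul_kronecker, one_kronecker_one, ← add_smul]
      congr 1
      simp only [Matrix.add_apply]; ring

/-- The tensor product of a morphism with an identity. -/
def Hom.tensor {V W : CliffordData B₁} (c : V.Hom W) (D : CliffordData B₂) :
    (V.tensor D).Hom (W.tensor D) where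
  c₀ := fromBlocks (1 ⊗ₖ c.c₀) 0 0 (1 ⊗ₖ c.c₁)
  c₁ := fromBlocks (1 ⊗ₖ c.c₁) 0 0 (1 ⊗ₖ c.c₀)
  comm₀ i := by
    refine (fromBlocks_multiply _ _ _ _ _ _ _ _).trans
      (Eq.trans ?_ (fromBlocks_multiply _ _ _ _ _ _ _ _).symm)
    simp only [neg_zero, Matrix.mul_zero, Matrix.zero_mul,
      Matrix.neg_mul, Matrix.mul_neg, add_zero, zero_add, ← mul_kronecker_mul, Matrix.one_mul,
      Matrix.mul_one, c.comm₀, c.comm₁]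
  comm₁ i := by
    refine (fromBlocks_multiply _ _ _ _ _ _ _ _).trans
      (Eq.trans ?_ (fromBlocks_multiply _ _ _ _ _ _ _ _).symm)
    simp only [neg_zero, Matrix.mul_zero, Matrix.zero_mul,
      Matrix.neg_mul, Matrix.mul_neg, add_zero, zero_add, ← mul_kronecker_mul, Matrix.one_mul,
      Matrix.mul_one, c.comm₀, c.comm₁]

lemma one_kronecker_injective {κ I J : Type} [DecidableEq κ] [Nonempty κ] {M N : Matrix J I ℝ}
    (h : (1 : Matrix κ κ ℝ) ⊗ₖ M = 1 ⊗ₖ N) : M = N := by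
  ext j i
  obtain ⟨a⟩ := ‹Nonempty κ›
  simpa using congrFun (congrFun h (a, j)) (a, i)

end Tensor

section Extend

variable {n m : ℕ}

/-- A bilinear form in the first variables. -/
def leftForm (B : Matrix (Fin n) (Fin n) ℝ) (m : ℕ) : Matrix (Fin (n + m)) (Fin (n + m)) ℝ :=
  (fromBlocks B 0 0 0).submatrix finSumFinEquiv.symm finSumFinEquiv.symm

/-- A bilinear form in the last variables. -/
def rightForm (n : ℕ) (B : Matrix (Fin m) (Fin m) ℝ) : Matrix (Fin (n + m)) (Fin (n + m)) ℝ :=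
  (fromBlocks 0 0 0 B).submatrix finSumFinEquiv.symm finSumFinEquiv.symm

/-- The additional variables act by zero. -/
def extendLeft {B : Matrix (Fin n) (Fin n) ℝ} (V : CliffordData B) (m : ℕ) :
    CliffordData (leftForm B m) where
  I₀ := V.I₀
  I₁ := V.I₁
  γ₀ := Fin.addCases V.γ₀ 0
  γ₁ := Fin.addCases V.γ₁ 0
  rel₀ i j := by
    refine Fin.addCases (fun i => ?_) (fun i => ?_) i <;>
      refine Fin.addCases (fun j => ?_) (fun j => ?_) j <;> simp [leftForm, V.rel₀]
  rel₁ i j := by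
    refine Fin.addCases (fun i => ?_) (fun i => ?_) i <;>
      refine Fin.addCases (fun j => ?_) (fun j => ?_) j <;> simp [leftForm, V.rel₁]

/-- The additional variables act by zero. -/
def extendRight {B : Matrix (Fin m) (Fin m) ℝ} (V : CliffordData B) (n : ℕ) :
    CliffordData (rightForm n B) where
  I₀ := V.I₀
  I₁ := V.I₁
  γ₀ := Fin.addCases 0 V.γ₀
  γ₁ := Fin.addCases 0 V.γ₁
  rel₀ i j := by
    refine Fin.addCases (fun i => ?_) (fun i => ?_) i <;>
      refine Fin.addCases (fun j => ?_) (fun j => ?_) j <;> simp [rightForm, V.rel₀]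
  rel₁ i j := by
    refine Fin.addCases (fun i => ?_) (fun i => ?_) i <;>
      refine Fin.addCases (fun j => ?_) (fun j => ?_) j <;> simp [rightForm, V.rel₁]

/-- Restriction to the last variables. -/
def restrictRight {B : Matrix (Fin n) (Fin n) ℝ} {B' : Matrix (Fin m) (Fin m) ℝ}
    (V : CliffordData (leftForm B m + rightForm n B')) : CliffordData B' where
  I₀ := V.I₀
  I₁ := V.I₁
  γ₀ i := V.γ₀ (Fin.natAdd n i)
  γ₁ i := V.γ₁ (Fin.natAdd n i)
  rel₀ i j := by simp [V.rel₀, leftForm, rightForm]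
  rel₁ i j := by simp [V.rel₁, leftForm, rightForm]

/-- A morphism is also one for the modules on which additional variables act by zero. -/
def Hom.extendLeft {B : Matrix (Fin n) (Fin n) ℝ} {V W : CliffordData B} (c : V.Hom W) (m : ℕ) :
    (V.extendLeft m).Hom (W.extendLeft m) where
  c₀ := c.c₀
  c₁ := c.c₁
  comm₀ i := by
    refine Fin.addCases (fun i => ?_) (fun i => ?_) i
    · simp only [CliffordData.extendLeft, Fin.addCases_left]
      exact c.comm₀ i
    · simp only [CliffordData.extendLeft, Fin.addCases_right]
      exact (Matrix.zero_mul _).trans (Matrix.mul_zero _).symm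
  comm₁ i := by
    refine Fin.addCases (fun i => ?_) (fun i => ?_) i
    · simp only [CliffordData.extendLeft, Fin.addCases_left]
      exact c.comm₁ i
    · simp only [CliffordData.extendLeft, Fin.addCases_right]
      exact (Matrix.zero_mul _).trans (Matrix.mul_zero _).symm

variable {B : Matrix (Fin n) (Fin n) ℝ}

/-- The tensor product with the spinor module in eight more variables. -/
def tensorSpinor (V : CliffordData B) : CliffordData (leftForm B 8 + rightForm n 1) :=
  (V.extendLeft 8).tensor (spinor.extendRight n)

/-- The tensor product of a morphism with the identity of the spinor module. -/
def Hom.tensorSpinor {V W : CliffordData B} (c : V.Hom W) : V.tensorSpinor.Hom W.tensorSpinor :=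
  (c.extendLeft 8).tensor (spinor.extendRight n)

lemma Hom.tensorSpinor_injective {V W : CliffordData B} {c c' : V.Hom W}
    (h : c.tensorSpinor = c'.tensorSpinor) : c = c' := by
  have h' : fromBlocks _ _ _ _ = fromBlocks _ _ _ _ := congrArg Hom.c₀ h
  rw [fromBlocks_inj] at h'
  have : Nonempty (spinor.extendRight n).I₀ := ⟨(0 : Fin 8)⟩
  have : Nonempty (spinor.extendRight n).I₁ := ⟨(0 : Fin 8)⟩
  exact Hom.ext (one_kronecker_injective h'.1) (one_kronecker_injective h'.2.2.2)

end Extend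

section Block

variable {κ κ' κ'' J J' : Type}

/-- The coefficient of a pair of indices in a matrix on a tensor product. -/
def block (M : Matrix (κ' × J') (κ × J) ℝ) (j' : J') (j : J) : Matrix κ' κ ℝ :=
  M.submatrix (·, j') (·, j)

/-- Matrices of the form A ⊗ 1 act on each block separately, so relations with spinor operators
reduce to relations between 8 × 8 matrices. -/
lemma block_kronecker_mul [Fintype κ'] [Fintype J'] [DecidableEq J'] (A : Matrix κ'' κ' ℝ)
    (M : Matrix (κ' × J') (κ × J) ℝ) (j' : J') (j : J) :
    block (A ⊗ₖ (1 : Matrix J' J' ℝ) * M) j' j = A * block M j' j := by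
  ext a b
  simp [block, mul_apply, Fintype.sum_prod_type, one_apply]

lemma block_mul_kronecker [Fintype κ] [Fintype J] [DecidableEq J]
    (M : Matrix (κ' × J') (κ × J) ℝ) (A : Matrix κ κ'' ℝ) (j' : J') (j : J) :
    block (M * A ⊗ₖ (1 : Matrix J J ℝ)) j' j = block M j' j * A := by
  ext a b
  simp [block, mul_apply, Fintype.sum_prod_type, one_apply]

lemma block_neg (M : Matrix (κ' × J') (κ × J) ℝ) (j' : J') (j : J) :
    block (-M) j' j = -block M j' j := rfl

lemma ext_block {M N : Matrix (κ' × J') (κ × J) ℝ} (h : ∀ j' j, block M j' j = block N j' j) :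
    M = N := by
  ext ⟨a, j'⟩ ⟨b, j⟩
  exact congrFun (congrFun (h j' j) a) b

end Block

end CliffordData

end

/-! ### Morphisms between tensor products with the spinor module. -/

noncomputable section

open Matrix
open scoped Kronecker

namespace CliffordData

section Full

lemma exists_eq_smul_one_of_commute {φ : Matrix (Fin 8 ⊕ Fin 8) (Fin 8 ⊕ Fin 8) ℝ}
    (hφ : ∀ i, fromBlocks 0 (octonionUnit i)ᵀ (octonionUnit i) 0 * φ =
      hat φ * fromBlocks 0 (octonionUnit i)ᵀ (octonionUnit i) 0) : ∃ r : ℝ, φ = r • 1 := by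
  obtain ⟨r, hr⟩ := exists_eq_smul_one (mem_intertwiners.2 hφ)
  refine ⟨r, hr.trans ?_⟩
  rfl

lemma exists_eq_smul_one_of_even {P Q : Matrix (Fin 8) (Fin 8) ℝ}
    (h₀ : ∀ i, octonionUnit i * P = Q * octonionUnit i)
    (h₁ : ∀ i, (octonionUnit i)ᵀ * Q = P * (octonionUnit i)ᵀ) :
    ∃ r : ℝ, P = r • 1 ∧ Q = r • 1 := by
  obtain ⟨r, hr⟩ := exists_eq_smul_one_of_commute (φ := fromBlocks P 0 0 Q) (fun i => by
    simp [hat_fromBlocks, fromBlocks_multiply, h₀, h₁])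
  rw [← fromBlocks_one, fromBlocks_smul, fromBlocks_inj] at hr
  exact ⟨r, hr.1, hr.2.2.2⟩

/-- An odd graded endomorphism of the spinor module is a scalar matrix by the Schur lemma, and a
scalar matrix has no off-diagonal blocks. -/
lemma eq_zero_of_odd {P Q : Matrix (Fin 8) (Fin 8) ℝ}
    (h₀ : ∀ i, octonionUnit i * P = -(Q * (octonionUnit i)ᵀ))
    (h₁ : ∀ i, (octonionUnit i)ᵀ * Q = -(P * octonionUnit i)) : P = 0 ∧ Q = 0 := by
  obtain ⟨r, hr⟩ := exists_eq_smul_one_of_commute (φ := fromBlocks 0 P Q 0) (fun i => by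
    simp [hat_fromBlocks, fromBlocks_multiply, h₀, h₁])
  rw [← fromBlocks_one, fromBlocks_smul, fromBlocks_inj, smul_zero] at hr
  exact ⟨hr.2.1, hr.2.2.1⟩

variable {n : ℕ} {B : Matrix (Fin n) (Fin n) ℝ}

/-- The even Clifford action of the last variables on a tensor product. -/
lemma tensorSpinor_γ₀_natAdd (V : CliffordData B) (i : Fin 8) :
    V.tensorSpinor.γ₀ (Fin.natAdd n i) =
      fromBlocks 0 (-((octonionUnit i)ᵀ ⊗ₖ (1 : Matrix V.I₁ V.I₁ ℝ)))
        (octonionUnit i ⊗ₖ (1 : Matrix V.I₀ V.I₀ ℝ)) 0 := by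
  change fromBlocks _ _ _ _ = _
  simp only [extendLeft, extendRight, Fin.addCases_right, Pi.zero_apply]
  congr 1
  · exact kronecker_zero _
  · exact kronecker_zero _

lemma tensorSpinor_γ₁_natAdd (V : CliffordData B) (i : Fin 8) :
    V.tensorSpinor.γ₁ (Fin.natAdd n i) =
      fromBlocks 0 ((octonionUnit i)ᵀ ⊗ₖ (1 : Matrix V.I₀ V.I₀ ℝ))
        (-(octonionUnit i ⊗ₖ (1 : Matrix V.I₁ V.I₁ ℝ))) 0 := by
  change fromBlocks _ _ _ _ = _
  simp only [extendLeft, extendRight, Fin.addCases_right, Pi.zero_apply]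
  congr 1
  · exact kronecker_zero _
  · exact kronecker_zero _

lemma tensorSpinor_γ₀_castAdd (V : CliffordData B) (i : Fin n) :
    V.tensorSpinor.γ₀ (Fin.castAdd 8 i) =
      fromBlocks ((1 : Matrix (Fin 8) (Fin 8) ℝ) ⊗ₖ V.γ₀ i) 0 0
        ((1 : Matrix (Fin 8) (Fin 8) ℝ) ⊗ₖ V.γ₁ i) := by
  change fromBlocks _ _ _ _ = _
  simp only [extendLeft, extendRight, Fin.addCases_left, Pi.zero_apply]
  congr 1
  · exact neg_eq_zero.2 (zero_kronecker _)
  · exact zero_kronecker _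

lemma tensorSpinor_γ₁_castAdd (V : CliffordData B) (i : Fin n) :
    V.tensorSpinor.γ₁ (Fin.castAdd 8 i) =
      fromBlocks ((1 : Matrix (Fin 8) (Fin 8) ℝ) ⊗ₖ V.γ₁ i) 0 0
        ((1 : Matrix (Fin 8) (Fin 8) ℝ) ⊗ₖ V.γ₀ i) := by
  change fromBlocks _ _ _ _ = _
  simp only [extendLeft, extendRight, Fin.addCases_left, Pi.zero_apply]
  congr 1
  · exact zero_kronecker _
  · exact neg_eq_zero.2 (zero_kronecker _)

/-- Every block is an even endomorphism of the spinor module, hence a scalar, and these scalars are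
the entries of M. -/
lemma exists_eq_kronecker {J J' : Type} {P Q : Matrix (Fin 8 × J') (Fin 8 × J) ℝ}
    (h₀ : ∀ i j' j, octonionUnit i * block P j' j = block Q j' j * octonionUnit i)
    (h₁ : ∀ i j' j, (octonionUnit i)ᵀ * block Q j' j = block P j' j * (octonionUnit i)ᵀ) :
    ∃ M : Matrix J' J ℝ, P = 1 ⊗ₖ M ∧ Q = 1 ⊗ₖ M := by
  choose r hr hr' using fun j' j => exists_eq_smul_one_of_even
      (P := block P j' j) (Q := block Q j' j)
    (fun i => h₀ i j' j) (fun i => h₁ i j' j)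
  have h (j' j) : block ((1 : Matrix (Fin 8) (Fin 8) ℝ) ⊗ₖ of r) j' j = r j' j • 1 := by
    ext a b
    simp [block, mul_comm]
  exact ⟨of r, ext_block fun j' j => by rw [hr, h], ext_block fun j' j => by rw [hr', h]⟩

lemma blocks_eq_zero {J J' : Type} {P Q : Matrix (Fin 8 × J') (Fin 8 × J) ℝ}
    (h₀ : ∀ i j' j, octonionUnit i * block P j' j = -(block Q j' j * (octonionUnit i)ᵀ))
    (h₁ : ∀ i j' j, (octonionUnit i)ᵀ * block Q j' j = -(block P j' j * octonionUnit i)) :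
    P = 0 ∧ Q = 0 :=
  ⟨ext_block fun j' j => (eq_zero_of_odd (h₀ · j' j) (h₁ · j' j)).1,
    ext_block fun j' j => (eq_zero_of_odd (h₀ · j' j) (h₁ · j' j)).2⟩

lemma fromBlocks_mul_fromBlocks_eq_iff {I I' J J' K K' L L' : Type} [Fintype J] [Fintype J']
    [Fintype L] [Fintype L'] {A : Matrix K J ℝ} {B : Matrix K J' ℝ} {C : Matrix K' J ℝ}
    {D : Matrix K' J' ℝ} {A' : Matrix J I ℝ} {B' : Matrix J I' ℝ} {C' : Matrix J' I ℝ}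
    {D' : Matrix J' I' ℝ} {E : Matrix K L ℝ} {F : Matrix K L' ℝ} {G : Matrix K' L ℝ}
    {H : Matrix K' L' ℝ} {E' : Matrix L I ℝ} {F' : Matrix L I' ℝ} {G' : Matrix L' I ℝ}
    {H' : Matrix L' I' ℝ} :
    fromBlocks A B C D * fromBlocks A' B' C' D' = fromBlocks E F G H * fromBlocks E' F' G' H' ↔
      A * A' + B * C' = E * E' + F * G' ∧ A * B' + B * D' = E * F' + F * H' ∧
      C * A' + D * C' = G * E' + H * G' ∧ C * B' + D * D' = G * F' + H * H' := by
  rw [fromBlocks_multiply, fromBlocks_multiply, fromBlocks_inj]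

/-- Morphisms between tensor products with the spinor module come from the first factor. -/
lemma exists_eq_tensorSpinor {V W : CliffordData B} (c : V.tensorSpinor.Hom W.tensorSpinor) :
    ∃ ψ : V.Hom W, c = ψ.tensorSpinor := by
  obtain ⟨p, r, s, q, hc₀⟩ : ∃ (p : Matrix (Fin 8 × W.I₀) (Fin 8 × V.I₀) ℝ)
      (r : Matrix (Fin 8 × W.I₀) (Fin 8 × V.I₁) ℝ) (s : Matrix (Fin 8 × W.I₁) (Fin 8 × V.I₀) ℝ)
      (q : Matrix (Fin 8 × W.I₁) (Fin 8 × V.I₁) ℝ), c.c₀ = fromBlocks p r s q :=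
    ⟨_, _, _, _, (fromBlocks_toBlocks c.c₀).symm⟩
  obtain ⟨p', r', s', q', hc₁⟩ : ∃ (p : Matrix (Fin 8 × W.I₁) (Fin 8 × V.I₁) ℝ)
      (r : Matrix (Fin 8 × W.I₁) (Fin 8 × V.I₀) ℝ) (s : Matrix (Fin 8 × W.I₀) (Fin 8 × V.I₁) ℝ)
      (q : Matrix (Fin 8 × W.I₀) (Fin 8 × V.I₀) ℝ), c.c₁ = fromBlocks p r s q :=
    ⟨_, _, _, _, (fromBlocks_toBlocks c.c₁).symm⟩
  -- The last eight variables determine the shape of c. The first n variables, used below, show that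
  -- the remaining factor is Clifford linear.
  have k₀ (i : Fin 8) := by
    have := c.comm₀ (Fin.natAdd n i)
    rw [hc₀, hc₁, tensorSpinor_γ₀_natAdd, tensorSpinor_γ₀_natAdd] at this
    exact fromBlocks_mul_fromBlocks_eq_iff.1 this
  have k₁ (i : Fin 8) := by
    have := c.comm₁ (Fin.natAdd n i)
    rw [hc₀, hc₁, tensorSpinor_γ₁_natAdd, tensorSpinor_γ₁_natAdd] at this
    exact fromBlocks_mul_fromBlocks_eq_iff.1 this
  have l₀ (i : Fin n) := by
    have := c.comm₀ (Fin.castAdd 8 i)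
    rw [hc₀, hc₁, tensorSpinor_γ₀_castAdd, tensorSpinor_γ₀_castAdd] at this
    exact fromBlocks_mul_fromBlocks_eq_iff.1 this
  have l₁ (i : Fin n) := by
    have := c.comm₁ (Fin.castAdd 8 i)
    rw [hc₀, hc₁, tensorSpinor_γ₁_castAdd, tensorSpinor_γ₁_castAdd] at this
    exact fromBlocks_mul_fromBlocks_eq_iff.1 this
  simp only [Matrix.zero_mul, Matrix.mul_zero, zero_add, add_zero, Matrix.neg_mul,
    Matrix.mul_neg, neg_inj] at k₀ k₁ l₀ l₁
  obtain ⟨ψ₀, rfl, rfl⟩ := exists_eq_kronecker (P := p) (Q := q')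
    (fun i j' j => by
      have := congrArg (block · j' j) (k₀ i).2.2.1
      simpa only [block_kronecker_mul, block_mul_kronecker] using this)
    (fun i j' j => by
      have := congrArg (block · j' j) (k₁ i).2.1
      simpa only [block_kronecker_mul, block_mul_kronecker] using this)
  obtain ⟨ψ₁, rfl, rfl⟩ := exists_eq_kronecker (P := p') (Q := q)
    (fun i j' j => by
      have := congrArg (block · j' j) (k₁ i).2.2.1
      simpa only [block_kronecker_mul, block_mul_kronecker] using this)
    (fun i j' j => by
      have := congrArg (block · j' j) (k₀ i).2.1
      simpa only [block_kronecker_mul, block_mul_kronecker] using this)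
  -- The off-diagonal blocks of an even map on the tensor product consist of odd maps between
  -- spinors, which vanish.
  obtain ⟨rfl, rfl⟩ := blocks_eq_zero (P := r) (Q := s')
    (fun i j' j => by
      have := congrArg (block · j' j) (k₀ i).2.2.2
      simpa only [block_kronecker_mul, block_mul_kronecker, block_neg] using this)
    (fun i j' j => by
      have := congrArg (block · j' j) (k₁ i).1
      simpa only [block_kronecker_mul, block_mul_kronecker, block_neg] using this)
  obtain ⟨rfl, rfl⟩ := blocks_eq_zero (P := r') (Q := s)
    (fun i j' j => by
      have := congrArg (block · j' j) (k₁ i).2.2.2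
      simpa only [block_kronecker_mul, block_mul_kronecker, block_neg, neg_eq_iff_eq_neg]
        using this)
    (fun i j' j => by
      have := congrArg (block · j' j) (k₀ i).1
      simpa only [block_kronecker_mul, block_mul_kronecker, block_neg, neg_eq_iff_eq_neg]
        using this)
  refine ⟨⟨ψ₀, ψ₁, fun i => one_kronecker_injective (κ := Fin 8) ?_,
    fun i => one_kronecker_injective (κ := Fin 8) ?_⟩, Hom.ext hc₀ hc₁⟩
  · have := (l₀ i).1
    rwa [← mul_kronecker_mul, ← mul_kronecker_mul, Matrix.one_mul] at this
  · have := (l₁ i).1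
    rwa [← mul_kronecker_mul, ← mul_kronecker_mul, Matrix.one_mul] at this

end Full

end CliffordData

end

/-! ### The Clifford module of maps from the spinor module. -/

noncomputable section

open Matrix
open scoped Kronecker

namespace CliffordData

section Parts

variable {X₀ X₁ κ J J' : Type} {K : Submodule ℝ (Matrix X₀ κ ℝ × Matrix X₁ κ ℝ)}
  {K' : Submodule ℝ (Matrix X₀ κ ℝ × Matrix X₁ κ ℝ)}

/-- The matrix of the evaluation map on the first components of a space of pairs of matrices. -/
def part₀ (b : Module.Basis J ℝ K) : Matrix X₀ (κ × J) ℝ := of fun r p => (b p.2).1.1 r p.1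

/-- The matrix of the evaluation map on the second components of a space of pairs of matrices. -/
def part₁ (b : Module.Basis J ℝ K) : Matrix X₁ (κ × J) ℝ := of fun r p => (b p.2).1.2 r p.1

lemma part₀_mul_kronecker_one [Fintype κ] [Fintype J] [DecidableEq J] (b : Module.Basis J ℝ K)
    (M : Matrix κ κ ℝ) (r : X₀) (a : κ) (j : J) :
    (part₀ b * (M ⊗ₖ (1 : Matrix J J ℝ))) r (a, j) = ((b j).1.1 * M) r a := by
  simp [part₀, mul_apply, Fintype.sum_prod_type, one_apply]

lemma part₁_mul_kronecker_one [Fintype κ] [Fintype J] [DecidableEq J] (b : Module.Basis J ℝ K)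
    (M : Matrix κ κ ℝ) (r : X₁) (a : κ) (j : J) :
    (part₁ b * (M ⊗ₖ (1 : Matrix J J ℝ))) r (a, j) = ((b j).1.2 * M) r a := by
  simp [part₁, mul_apply, Fintype.sum_prod_type, one_apply]

lemma sum_fst_mul_repr [Fintype J] (b : Module.Basis J ℝ K) (x : K) (r : X₀) (a : κ) :
    ∑ j, (b j).1.1 r a * b.repr x j = x.1.1 r a := by
  let l : K →ₗ[ℝ] ℝ :=
    { toFun x := x.1.1 r a
      map_add' _ _ := rfl
      map_smul' _ _ := rfl }
  have h := congrArg l (b.sum_repr x)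
  rw [map_sum] at h
  refine Eq.trans (Finset.sum_congr rfl fun j _ => ?_) h
  rw [map_smul, smul_eq_mul, mul_comm]
  rfl

lemma part₀_mul_one_kronecker [Fintype κ] [DecidableEq κ] [Fintype J] [DecidableEq J] [Fintype J']
    (b : Module.Basis J ℝ K) (b' : Module.Basis J' ℝ K') (f : K →ₗ[ℝ] K') (r : X₀) (a : κ) (j : J) :
    (part₀ b' * ((1 : Matrix κ κ ℝ) ⊗ₖ LinearMap.toMatrix b b' f)) r (a, j) =
      (f (b j)).1.1 r a := by
  rw [← sum_fst_mul_repr b']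
  simp [part₀, mul_apply, Fintype.sum_prod_type, one_apply, LinearMap.toMatrix_apply]

lemma fst_mulVec_mem_range [Fintype κ] [Fintype J] (b : Module.Basis J ℝ K) {x} (hx : x ∈ K)
    (y : κ → ℝ) : x.1 *ᵥ y ∈ LinearMap.range (part₀ b).mulVecLin := by
  refine ⟨fun p => b.repr ⟨x, hx⟩ p.2 * y p.1, ?_⟩
  ext r
  simp only [mulVecLin_apply, mulVec, dotProduct]
  rw [Fintype.sum_prod_type]
  refine Finset.sum_congr rfl fun a _ => ?_
  rw [← sum_fst_mul_repr b ⟨x, hx⟩, Finset.sum_mul]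
  exact Finset.sum_congr rfl fun j _ => (mul_assoc _ _ _).symm

lemma sum_snd_mul_repr [Fintype J] (b : Module.Basis J ℝ K) (x : K) (r : X₁) (a : κ) :
    ∑ j, (b j).1.2 r a * b.repr x j = x.1.2 r a := by
  let l : K →ₗ[ℝ] ℝ :=
    { toFun x := x.1.2 r a
      map_add' _ _ := rfl
      map_smul' _ _ := rfl }
  have h := congrArg l (b.sum_repr x)
  rw [map_sum] at h
  refine Eq.trans (Finset.sum_congr rfl fun j _ => ?_) h
  rw [map_smul, smul_eq_mul, mul_comm]
  rfl

lemma part₁_mul_one_kronecker [Fintype κ] [DecidableEq κ] [Fintype J] [DecidableEq J] [Fintype J']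
    (b : Module.Basis J ℝ K) (b' : Module.Basis J' ℝ K') (f : K →ₗ[ℝ] K') (r : X₁) (a : κ) (j : J) :
    (part₁ b' * ((1 : Matrix κ κ ℝ) ⊗ₖ LinearMap.toMatrix b b' f)) r (a, j) =
      (f (b j)).1.2 r a := by
  rw [← sum_snd_mul_repr b']
  simp [part₁, mul_apply, Fintype.sum_prod_type, one_apply, LinearMap.toMatrix_apply]

lemma snd_mulVec_mem_range [Fintype κ] [Fintype J] (b : Module.Basis J ℝ K) {x} (hx : x ∈ K)
    (y : κ → ℝ) : x.2 *ᵥ y ∈ LinearMap.range (part₁ b).mulVecLin := by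
  refine ⟨fun p => b.repr ⟨x, hx⟩ p.2 * y p.1, ?_⟩
  ext r
  simp only [mulVecLin_apply, mulVec, dotProduct]
  rw [Fintype.sum_prod_type]
  refine Finset.sum_congr rfl fun a _ => ?_
  rw [← sum_snd_mul_repr b ⟨x, hx⟩, Finset.sum_mul]
  exact Finset.sum_congr rfl fun j _ => (mul_assoc _ _ _).symm

end Parts

variable {n : ℕ} {B : Matrix (Fin n) (Fin n) ℝ}
  (V : CliffordData (leftForm B 8 + rightForm n (1 : Matrix (Fin 8) (Fin 8) ℝ)))

/-- The even maps from the spinor module which commute with the action of the last variables. -/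
def evenHoms : Submodule ℝ (Matrix V.I₀ (Fin 8) ℝ × Matrix V.I₁ (Fin 8) ℝ) where
  carrier := {x | ∀ i, V.γ₀ (Fin.natAdd n i) * x.1 = x.2 * octonionUnit i ∧
    V.γ₁ (Fin.natAdd n i) * x.2 = x.1 * (octonionUnit i)ᵀ}
  zero_mem' i := by simp
  add_mem' {x y} hx hy i := by
    simp only [Prod.fst_add, Prod.snd_add, Matrix.mul_add, Matrix.add_mul, hx i, hy i, and_self]
  smul_mem' r x hx i := by
    simp only [Prod.smul_fst, Prod.smul_snd, Matrix.mul_smul, Matrix.smul_mul, hx i, and_self]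

/-- The odd maps from the spinor module which graded commute with the action of the last
variables. -/
def oddHoms : Submodule ℝ (Matrix V.I₀ (Fin 8) ℝ × Matrix V.I₁ (Fin 8) ℝ) where
  carrier := {x | ∀ i, V.γ₀ (Fin.natAdd n i) * x.1 = -(x.2 * (octonionUnit i)ᵀ) ∧
    V.γ₁ (Fin.natAdd n i) * x.2 = -(x.1 * octonionUnit i)}
  zero_mem' i := by simp
  add_mem' {x y} hx hy i := by
    simp only [Prod.fst_add, Prod.snd_add, Matrix.mul_add, Matrix.add_mul, hx i, hy i, neg_add,
      and_self]
  smul_mem' r x hx i := by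
    simp only [Prod.smul_fst, Prod.smul_snd, Matrix.mul_smul, Matrix.smul_mul, hx i, smul_neg,
      and_self]

lemma fromBlocks_mem_intertwiners_iff (P Q R S) :
    (fromBlocks P Q R S : Matrix (V.I₀ ⊕ V.I₁) (Fin 8 ⊕ Fin 8) ℝ) ∈ intertwiners V.restrictRight ↔
      (P, S) ∈ evenHoms V ∧ (Q, R) ∈ oddHoms V := by
  have h : (fromBlocks P Q R S : Matrix (V.I₀ ⊕ V.I₁) (Fin 8 ⊕ Fin 8) ℝ) ∈
      intertwiners V.restrictRight ↔
      ∀ i, fromBlocks 0 (V.γ₁ (Fin.natAdd n i)) (V.γ₀ (Fin.natAdd n i)) 0 * fromBlocks P Q R S =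
        fromBlocks P (-Q) (-R) S * fromBlocks 0 (octonionUnit i)ᵀ (octonionUnit i) 0 :=
    mem_intertwiners
  rw [h]
  simp only [fromBlocks_mul_fromBlocks_eq_iff, Matrix.zero_mul, Matrix.mul_zero, zero_add, add_zero,
    Matrix.neg_mul]
  constructor
  · exact fun h => ⟨fun i => ⟨(h i).2.2.1, (h i).2.1⟩, fun i => ⟨(h i).2.2.2, (h i).1⟩⟩
  · exact fun h i => ⟨(h.2 i).2, (h.1 i).2, (h.1 i).1, (h.2 i).1⟩

/-- Graded homomorphisms are sums of even and odd ones. -/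
def intertwinersEquiv : (evenHoms V × oddHoms V) ≃ₗ[ℝ] intertwiners V.restrictRight where
  toFun x := ⟨fromBlocks x.1.1.1 x.2.1.1 x.2.1.2 x.1.1.2,
    (fromBlocks_mem_intertwiners_iff V _ _ _ _).2 ⟨x.1.2, x.2.2⟩⟩
  invFun φ := ⟨⟨(toBlocks₁₁ φ.1, toBlocks₂₂ φ.1), ((fromBlocks_mem_intertwiners_iff V _ _ _ _).1
    ((fromBlocks_toBlocks φ.1).symm ▸ φ.2)).1⟩, ⟨(toBlocks₁₂ φ.1, toBlocks₂₁ φ.1),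
    ((fromBlocks_mem_intertwiners_iff V _ _ _ _).1
    ((fromBlocks_toBlocks φ.1).symm ▸ φ.2)).2⟩⟩
  left_inv _ := rfl
  right_inv φ := Subtype.ext (fromBlocks_toBlocks φ.1)
  map_add' _ _ := Subtype.ext (fromBlocks_add _ _ _ _ _ _ _ _).symm
  map_smul' _ _ := Subtype.ext (fromBlocks_smul _ _ _ _ _).symm

/-- The action of one of the first variables. -/
def actHoms (i : Fin n) : (Matrix V.I₀ (Fin 8) ℝ × Matrix V.I₁ (Fin 8) ℝ) →ₗ[ℝ]
    (Matrix V.I₀ (Fin 8) ℝ × Matrix V.I₁ (Fin 8) ℝ) where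
  toFun x := (V.γ₁ (Fin.castAdd 8 i) * x.2, V.γ₀ (Fin.castAdd 8 i) * x.1)
  map_add' x y := by simp only [Prod.fst_add, Prod.snd_add, Matrix.mul_add, Prod.mk_add_mk]
  map_smul' r x := by
    simp only [Prod.smul_fst, Prod.smul_snd, Matrix.mul_smul, RingHom.id_apply, Prod.smul_mk]

/-- The form is block diagonal, so generators from the two groups of variables anticommute. -/
lemma γ₁_mul_γ₀_castAdd (i : Fin n) (k : Fin 8) :
    V.γ₁ (Fin.natAdd n k) * V.γ₀ (Fin.castAdd 8 i) =
      -(V.γ₁ (Fin.castAdd 8 i) * V.γ₀ (Fin.natAdd n k)) :=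
  eq_neg_of_add_eq_zero_left ((V.rel₀ _ _).trans (by simp [leftForm, rightForm]))

lemma γ₀_mul_γ₁_castAdd (i : Fin n) (k : Fin 8) :
    V.γ₀ (Fin.natAdd n k) * V.γ₁ (Fin.castAdd 8 i) =
      -(V.γ₀ (Fin.castAdd 8 i) * V.γ₁ (Fin.natAdd n k)) :=
  eq_neg_of_add_eq_zero_left ((V.rel₁ _ _).trans (by simp [leftForm, rightForm]))

variable {V} in
-- Composing with a generator of the first group, which anticommutes with the last eight, turns maps
-- that commute with the spinor action into maps that anticommute with it.
lemma actHoms_mem_oddHoms (i : Fin n) {x} (hx : x ∈ evenHoms V) : actHoms V i x ∈ oddHoms V := by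
  intro k
  simp only [actHoms, LinearMap.coe_mk, AddHom.coe_mk]
  rw [← Matrix.mul_assoc, ← Matrix.mul_assoc, γ₀_mul_γ₁_castAdd, γ₁_mul_γ₀_castAdd, Matrix.neg_mul,
    Matrix.neg_mul, Matrix.mul_assoc, (hx k).2, Matrix.mul_assoc _ _ x.1, (hx k).1,
    Matrix.mul_assoc, Matrix.mul_assoc]
  exact ⟨rfl, rfl⟩

variable {V} in
lemma actHoms_mem_evenHoms (i : Fin n) {x} (hx : x ∈ oddHoms V) : actHoms V i x ∈ evenHoms V := by
  intro k
  simp only [actHoms, LinearMap.coe_mk, AddHom.coe_mk]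
  rw [← Matrix.mul_assoc, ← Matrix.mul_assoc, γ₀_mul_γ₁_castAdd, γ₁_mul_γ₀_castAdd, Matrix.neg_mul,
    Matrix.neg_mul, Matrix.mul_assoc, (hx k).2, Matrix.mul_assoc _ _ x.1, (hx k).1, Matrix.mul_neg,
    neg_neg, Matrix.mul_neg, neg_neg, Matrix.mul_assoc, Matrix.mul_assoc]
  exact ⟨rfl, rfl⟩

lemma actHoms_actHoms (i j : Fin n) (x) :
    actHoms V i (actHoms V j x) + actHoms V j (actHoms V i x) = (B i j + B j i) • x := by
  have h₀ := V.rel₀ (Fin.castAdd 8 i) (Fin.castAdd 8 j)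
  have h₁ := V.rel₁ (Fin.castAdd 8 i) (Fin.castAdd 8 j)
  simp [leftForm, rightForm] at h₀ h₁
  refine Prod.ext ?_ ?_
  · change _ * (_ * x.1) + _ * (_ * x.1) = (B i j + B j i) • x.1
    rw [← Matrix.mul_assoc, ← Matrix.mul_assoc, ← Matrix.add_mul, h₀, Matrix.smul_mul,
      Matrix.one_mul]
  · change _ * (_ * x.2) + _ * (_ * x.2) = (B i j + B j i) • x.2
    rw [← Matrix.mul_assoc, ← Matrix.mul_assoc, ← Matrix.add_mul, h₁, Matrix.smul_mul,
      Matrix.one_mul]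

lemma toMatrix_mul_add_toMatrix_mul {E E' J J' : Type} [AddCommGroup E] [Module ℝ E]
    [AddCommGroup E'] [Module ℝ E'] [Fintype J] [DecidableEq J] [Fintype J'] [DecidableEq J']
    (b : Module.Basis J ℝ E) (b' : Module.Basis J' ℝ E') (f g : E →ₗ[ℝ] E') (f' g' : E' →ₗ[ℝ] E)
    (r : ℝ) (h : ∀ x, f' (g x) + g' (f x) = r • x) :
    LinearMap.toMatrix b' b f' * LinearMap.toMatrix b b' g +
      LinearMap.toMatrix b' b g' * LinearMap.toMatrix b b' f = r • 1 := by
  rw [← LinearMap.toMatrix_comp, ← LinearMap.toMatrix_comp, ← map_add, ← LinearMap.toMatrix_id b,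
    ← map_smul]
  congr 1
  exact LinearMap.ext h

/-- The action of one of the first variables on even maps. -/
def actEven (i : Fin n) : evenHoms V →ₗ[ℝ] oddHoms V :=
  (actHoms V i).restrict fun _ => actHoms_mem_oddHoms i

/-- The action of one of the first variables on odd maps. -/
def actOdd (i : Fin n) : oddHoms V →ₗ[ℝ] evenHoms V :=
  (actHoms V i).restrict fun _ => actHoms_mem_evenHoms i

lemma actOdd_actEven (i j : Fin n) (x : evenHoms V) :
    actOdd V i (actEven V j x) + actOdd V j (actEven V i x) = (B i j + B j i) • x :=
  Subtype.ext (actHoms_actHoms V i j x)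

lemma actEven_actOdd (i j : Fin n) (x : oddHoms V) :
    actEven V i (actOdd V j x) + actEven V j (actOdd V i x) = (B i j + B j i) • x :=
  Subtype.ext (actHoms_actHoms V i j x)

/-- The Clifford module of maps from the spinor module. -/
def spinorHoms : CliffordData B where
  I₀ := Fin (Module.finrank ℝ (evenHoms V))
  I₁ := Fin (Module.finrank ℝ (oddHoms V))
  γ₀ i := LinearMap.toMatrix (Module.finBasis ℝ (evenHoms V)) (Module.finBasis ℝ (oddHoms V))
    (actEven V i)
  γ₁ i := LinearMap.toMatrix (Module.finBasis ℝ (oddHoms V)) (Module.finBasis ℝ (evenHoms V))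
    (actOdd V i)
  rel₀ i j := toMatrix_mul_add_toMatrix_mul _ _ _ _ _ _ _ (actOdd_actEven V i j)
  rel₁ i j := toMatrix_mul_add_toMatrix_mul _ _ _ _ _ _ _ (actEven_actOdd V i j)

end CliffordData

end

/-! ### Evaluation of maps from the spinor module is an isomorphism. -/

noncomputable section

open Matrix
open scoped Kronecker

namespace CliffordData

variable {n : ℕ} {B : Matrix (Fin n) (Fin n) ℝ}
  (V : CliffordData (leftForm B 8 + rightForm n (1 : Matrix (Fin 8) (Fin 8) ℝ)))

/-- A basis of the even maps. -/
abbrev evenBasis : Module.Basis (Fin (Module.finrank ℝ (evenHoms V))) ℝ (evenHoms V) :=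
  Module.finBasis ℝ (evenHoms V)

/-- A basis of the odd maps. -/
abbrev oddBasis : Module.Basis (Fin (Module.finrank ℝ (oddHoms V))) ℝ (oddHoms V) :=
  Module.finBasis ℝ (oddHoms V)

/-- The even indices of the tensor product of the spinor module with its maps. -/
abbrev EvalIndex₀ : Type := Fin 8 × Fin (Module.finrank ℝ (evenHoms V)) ⊕
  Fin 8 × Fin (Module.finrank ℝ (oddHoms V))

/-- The odd indices of the tensor product of the spinor module with its maps. -/
abbrev EvalIndex₁ : Type := Fin 8 × Fin (Module.finrank ℝ (oddHoms V)) ⊕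
  Fin 8 × Fin (Module.finrank ℝ (evenHoms V))

/-- The even part of the evaluation map. -/
def eval₀ : Matrix V.I₀ (EvalIndex₀ V) ℝ :=
  fromCols (part₀ (evenBasis V)) (part₀ (oddBasis V))

/-- The odd part of the evaluation map. -/
def eval₁ : Matrix V.I₁ (EvalIndex₁ V) ℝ :=
  fromCols (part₁ (oddBasis V)) (part₁ (evenBasis V))

lemma mul_part₀_apply {J X : Type} (M : Matrix X V.I₀ ℝ)
    {K : Submodule ℝ (Matrix V.I₀ (Fin 8) ℝ × Matrix V.I₁ (Fin 8) ℝ)} (b : Module.Basis J ℝ K)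
    (r : X) (a : Fin 8) (j : J) : (M * part₀ b) r (a, j) = (M * (b j).1.1) r a := rfl

lemma mul_part₁_apply {J X : Type} (M : Matrix X V.I₁ ℝ)
    {K : Submodule ℝ (Matrix V.I₀ (Fin 8) ℝ × Matrix V.I₁ (Fin 8) ℝ)} (b : Module.Basis J ℝ K)
    (r : X) (a : Fin 8) (j : J) : (M * part₁ b) r (a, j) = (M * (b j).1.2) r a := rfl

lemma fromCols_mul_fromBlocks_diagonal {X J J' K K' : Type} [Fintype J] [Fintype J']
    (A : Matrix X J ℝ) (A' : Matrix X J' ℝ) (M : Matrix J K ℝ) (N : Matrix J' K' ℝ) :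
    fromCols A A' * fromBlocks M 0 0 N = fromCols (A * M) (A' * N) := by
  rw [fromCols_mul_fromBlocks, Matrix.mul_zero, Matrix.mul_zero, zero_add, add_zero]

/-- Column by column these are the defining relations of `evenHoms` and `oddHoms`. The minus sign
for odd maps matches the Koszul sign in the tensor product. -/
lemma γ₀_mul_eval₀_natAdd (i : Fin 8) : V.γ₀ (Fin.natAdd n i) * eval₀ V =
    eval₁ V * (fromBlocks 0 (-((octonionUnit i)ᵀ ⊗ₖ 1)) (octonionUnit i ⊗ₖ 1) 0 :
      Matrix (EvalIndex₁ V) (EvalIndex₀ V) ℝ) := by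
  rw [eval₀, eval₁, mul_fromCols, fromCols_mul_fromBlocks, Matrix.mul_zero, Matrix.mul_zero,
    zero_add, add_zero]
  refine congrArg₂ fromCols ?_ ?_
  · ext r ⟨a, j⟩
    rw [part₁_mul_kronecker_one, mul_part₀_apply, ((evenBasis V j).2 i).1]
  · ext r ⟨a, j⟩
    rw [Matrix.mul_neg, Matrix.neg_apply, part₁_mul_kronecker_one, mul_part₀_apply,
      ((oddBasis V j).2 i).1]
    rfl

lemma γ₁_mul_eval₁_natAdd (i : Fin 8) : V.γ₁ (Fin.natAdd n i) * eval₁ V =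
    eval₀ V * (fromBlocks 0 ((octonionUnit i)ᵀ ⊗ₖ 1) (-(octonionUnit i ⊗ₖ 1)) 0 :
      Matrix (EvalIndex₀ V) (EvalIndex₁ V) ℝ) := by
  rw [eval₀, eval₁, mul_fromCols, fromCols_mul_fromBlocks, Matrix.mul_zero, Matrix.mul_zero,
    zero_add, add_zero]
  refine congrArg₂ fromCols ?_ ?_
  · ext r ⟨a, j⟩
    rw [Matrix.mul_neg, Matrix.neg_apply, part₀_mul_kronecker_one, mul_part₁_apply,
      ((oddBasis V j).2 i).2]
    rfl
  · ext r ⟨a, j⟩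
    rw [part₀_mul_kronecker_one, mul_part₁_apply, ((evenBasis V j).2 i).2]

/-- Here the action on the space of maps is composition with γᵢ, written in a basis. -/
lemma γ₀_mul_eval₀_castAdd (i : Fin n) : V.γ₀ (Fin.castAdd 8 i) * eval₀ V =
    eval₁ V * (fromBlocks (1 ⊗ₖ LinearMap.toMatrix (evenBasis V) (oddBasis V) (actEven V i)) 0 0
      (1 ⊗ₖ LinearMap.toMatrix (oddBasis V) (evenBasis V) (actOdd V i)) :
      Matrix (EvalIndex₁ V) (EvalIndex₀ V) ℝ) := by
  rw [eval₀, eval₁, mul_fromCols, fromCols_mul_fromBlocks_diagonal]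
  refine congrArg₂ fromCols ?_ ?_
  · ext r ⟨a, j⟩
    refine Eq.trans ?_ (part₁_mul_one_kronecker (evenBasis V) (oddBasis V) (actEven V i) r a j).symm
    rfl
  · ext r ⟨a, j⟩
    refine Eq.trans ?_ (part₁_mul_one_kronecker (oddBasis V) (evenBasis V) (actOdd V i) r a j).symm
    rfl

lemma γ₁_mul_eval₁_castAdd (i : Fin n) : V.γ₁ (Fin.castAdd 8 i) * eval₁ V =
    eval₀ V * (fromBlocks (1 ⊗ₖ LinearMap.toMatrix (oddBasis V) (evenBasis V) (actOdd V i)) 0 0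
      (1 ⊗ₖ LinearMap.toMatrix (evenBasis V) (oddBasis V) (actEven V i)) :
      Matrix (EvalIndex₀ V) (EvalIndex₁ V) ℝ) := by
  rw [eval₀, eval₁, mul_fromCols, fromCols_mul_fromBlocks_diagonal]
  refine congrArg₂ fromCols ?_ ?_
  · ext r ⟨a, j⟩
    refine Eq.trans ?_ (part₀_mul_one_kronecker (oddBasis V) (evenBasis V) (actOdd V i) r a j).symm
    rfl
  · ext r ⟨a, j⟩
    refine Eq.trans ?_ (part₀_mul_one_kronecker (evenBasis V) (oddBasis V) (actEven V i) r a j).symm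
    rfl

/-- Evaluation of maps from the spinor module. -/
def eval : (spinorHoms V).tensorSpinor.Hom V where
  c₀ := eval₀ V
  c₁ := eval₁ V
  comm₀ i := by
    refine Fin.addCases (fun i => ?_) (fun i => ?_) i
    · rw [tensorSpinor_γ₀_castAdd]
      exact γ₀_mul_eval₀_castAdd V i
    · rw [tensorSpinor_γ₀_natAdd]
      exact γ₀_mul_eval₀_natAdd V i
  comm₁ i := by
    refine Fin.addCases (fun i => ?_) (fun i => ?_) i
    · rw [tensorSpinor_γ₁_castAdd]
      exact γ₁_mul_eval₁_castAdd V i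
    · rw [tensorSpinor_γ₁_natAdd]
      exact γ₁_mul_eval₁_natAdd V i

lemma mem_range_fromCols {X J J' : Type} [Fintype J] [Fintype J'] (M : Matrix X J ℝ)
    (N : Matrix X J' ℝ) {x y : X → ℝ} (hx : x ∈ LinearMap.range M.mulVecLin)
    (hy : y ∈ LinearMap.range N.mulVecLin) : x + y ∈ LinearMap.range (fromCols M N).mulVecLin := by
  obtain ⟨x, rfl⟩ := hx
  obtain ⟨y, rfl⟩ := hy
  exact ⟨Sum.elim x y, by simp⟩

/-- By `span_intertwiners_mul` it suffices to treat M = φ X. Then M x = φ (X x) is a value of the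
even and odd parts of φ, hence lies in the image of evaluation. -/
lemma mulVec_mem_range_eval (M : Matrix (V.I₀ ⊕ V.I₁) (Fin 8 ⊕ Fin 8) ℝ) (x : Fin 8 ⊕ Fin 8 → ℝ) :
    (M *ᵥ x) ∘ Sum.inl ∈ LinearMap.range (eval₀ V).mulVecLin ∧
      (M *ᵥ x) ∘ Sum.inr ∈ LinearMap.range (eval₁ V).mulVecLin := by
  have hM : M ∈ Submodule.span ℝ {M : Matrix (V.I₀ ⊕ V.I₁) (Fin 8 ⊕ Fin 8) ℝ |
      ∃ φ : Matrix (V.I₀ ⊕ V.I₁) (Fin 8 ⊕ Fin 8) ℝ, φ ∈ intertwiners V.restrictRight ∧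
        ∃ X : Matrix (Fin 8 ⊕ Fin 8) (Fin 8 ⊕ Fin 8) ℝ, M = φ * X} :=
    Submodule.eq_top_iff'.1 (span_intertwiners_mul (U := V.restrictRight)) M
  induction hM using Submodule.span_induction with
  | mem M h =>
    obtain ⟨φ, hφ, X, rfl⟩ := h
    obtain ⟨P, Q, R, S, rfl⟩ : ∃ P Q R S,
        φ = (fromBlocks P Q R S : Matrix (V.I₀ ⊕ V.I₁) (Fin 8 ⊕ Fin 8) ℝ) :=
      ⟨_, _, _, _, (fromBlocks_toBlocks φ).symm⟩
    obtain ⟨h₀, h₁⟩ := (fromBlocks_mem_intertwiners_iff V P Q R S).1 hφ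
    rw [← mulVec_mulVec, fromBlocks_mulVec, Sum.elim_comp_inl, Sum.elim_comp_inr]
    constructor
    · exact mem_range_fromCols _ _ (fst_mulVec_mem_range _ h₀ _) (fst_mulVec_mem_range _ h₁ _)
    · exact mem_range_fromCols _ _ (snd_mulVec_mem_range _ h₁ _) (snd_mulVec_mem_range _ h₀ _)
  | zero =>
    rw [zero_mulVec]
    exact ⟨Submodule.zero_mem _, Submodule.zero_mem _⟩
  | add M N _ _ h h' =>
    rw [add_mulVec]
    exact ⟨Submodule.add_mem _ h.1 h'.1, Submodule.add_mem _ h.2 h'.2⟩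
  | smul r M _ h =>
    rw [smul_mulVec]
    exact ⟨Submodule.smul_mem _ r h.1, Submodule.smul_mem _ r h.2⟩

lemma eval₀_surjective : Function.Surjective (eval₀ V).mulVec := by
  intro y
  -- The matrix all of whose columns are (y, 0), applied to a basis vector, has even part y.
  obtain ⟨x, hx⟩ := (mulVec_mem_range_eval V (of fun r _ => Sum.elim y 0 r)
    (Pi.single (Sum.inl 0) 1)).1
  refine ⟨x, hx.trans ?_⟩
  ext r
  simp

lemma eval₁_surjective : Function.Surjective (eval₁ V).mulVec := by
  intro y
  obtain ⟨x, hx⟩ := (mulVec_mem_range_eval V (of fun r _ => Sum.elim 0 y r)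
    (Pi.single (Sum.inl 0) 1)).2
  refine ⟨x, hx.trans ?_⟩
  ext r
  simp

lemma card_le_of_mulVec_surjective {X J : Type} [Fintype X] [Fintype J] {M : Matrix X J ℝ}
    (hM : Function.Surjective M.mulVec) : Fintype.card X ≤ Fintype.card J := by
  have := LinearMap.finrank_le_finrank_of_surjective (f := M.mulVecLin) hM
  simpa using this

lemma card_eq_finrank : Fintype.card V.I₀ + Fintype.card V.I₁ =
    16 * (Module.finrank ℝ (evenHoms V) + Module.finrank ℝ (oddHoms V)) := by
  rw [← Module.finrank_prod, (intertwinersEquiv V).finrank_eq]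
  exact card_eq_mul_finrank_intertwiners V.restrictRight

/-- Every module is, up to isomorphism, a tensor product with the spinor module. -/
lemma exists_inverse_eval : ∃ (G₀ : Matrix (spinorHoms V).tensorSpinor.I₀ V.I₀ ℝ)
    (G₁ : Matrix (spinorHoms V).tensorSpinor.I₁ V.I₁ ℝ),
    G₀ * (eval V).c₀ = 1 ∧ (eval V).c₀ * G₀ = 1 ∧ G₁ * (eval V).c₁ = 1 ∧ (eval V).c₁ * G₁ = 1 := by
  have h := card_eq_finrank V
  have h₀ := card_le_of_mulVec_surjective (eval₀_surjective V)
  have h₁ := card_le_of_mulVec_surjective (eval₁_surjective V)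
  obtain ⟨G₀, hG₀⟩ := mulVec_surjective_iff_exists_right_inverse.1 (eval₀_surjective V)
  obtain ⟨G₁, hG₁⟩ := mulVec_surjective_iff_exists_right_inverse.1 (eval₁_surjective V)
  -- Surjectivity bounds the even and the odd dimension of V separately by those of the tensor
  -- product. The totals agree by `card_eq_finrank`, so both bounds are equalities and the one-sided
  -- inverses are two-sided.
  have k₀ : Fintype.card V.I₀ = Fintype.card (EvalIndex₀ V) := by
    simp only [Fintype.card_sum, Fintype.card_prod, Fintype.card_fin] at h₀ h₁ ⊢
    omega
  have k₁ : Fintype.card V.I₁ = Fintype.card (EvalIndex₁ V) := by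
    simp only [Fintype.card_sum, Fintype.card_prod, Fintype.card_fin] at h₀ h₁ ⊢
    omega
  have l₀ := (mul_eq_one_comm_of_card_eq _ _ _ k₀).1 hG₀
  have l₁ := (mul_eq_one_comm_of_card_eq _ _ _ k₁).1 hG₁
  refine ⟨G₀, G₁, l₀.trans ?_, hG₀, l₁.trans ?_, hG₁⟩
  · congr!
  · congr!

end CliffordData

end

/-! ### Coordinates on tensor products of coordinate factorizations. -/

noncomputable section

open Matrix
open scoped Kronecker TensorProduct

section TupleCoordinates

variable {R S : Type*} [CommRing R] [CommRing S] [Algebra R S] {κ J J' J₀ J₁ : Type}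
  [Fintype κ] [DecidableEq κ] [Fintype J] [DecidableEq J] [Fintype J'] [DecidableEq J']
  [Fintype J₀] [DecidableEq J₀] [Fintype J₁] [DecidableEq J₁]

variable (R S κ J) in
/-- Coordinates on tuples of elements of the base change of a coordinate space. -/
def tupleCoord : (κ → S ⊗[R] (J → R)) ≃ₗ[S] (κ × J → S) :=
  LinearEquiv.piCongrRight (fun _ => TensorProduct.piScalarRight R S S J) ≪≫ₗ
    (LinearEquiv.curry S S κ J).symm

lemma tupleCoord_apply (x : κ → S ⊗[R] (J → R)) (p : κ × J) :
    tupleCoord R S κ J x p = TensorProduct.piScalarRight R S S J (x p.1) p.2 := rfl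

lemma piScalarRight_baseChange (M : Matrix J' J R) (x : S ⊗[R] (J → R)) :
    TensorProduct.piScalarRight R S S J' (M.mulVecLin.baseChange S x) =
      M.map (algebraMap R S) *ᵥ TensorProduct.piScalarRight R S S J x := by
  induction x using TensorProduct.induction_on with
  | zero => simp
  | tmul s v =>
    ext j
    simp [mulVec, dotProduct, Algebra.smul_def, Finset.sum_mul, mul_assoc]
  | add x y hx hy => rw [map_add, map_add, map_add, mulVec_add, hx, hy]

lemma tupleCoord_tupleBaseChange (M : Matrix J' J R) (x : κ → S ⊗[R] (J → R)) :
    tupleCoord R S κ J' (M.mulVecLin.tupleBaseChange S κ x) =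
      ((1 : Matrix κ κ S) ⊗ₖ M.map (algebraMap R S)) *ᵥ tupleCoord R S κ J x := by
  ext ⟨a, j⟩
  rw [tupleCoord_apply]
  change TensorProduct.piScalarRight R S S J' (M.mulVecLin.baseChange S (x a)) j = _
  rw [piScalarRight_baseChange]
  simp [mulVec, dotProduct, Fintype.sum_prod_type, one_apply, tupleCoord_apply]

lemma tupleCoord_tupleMap (A : Matrix κ κ S) (x : κ → S ⊗[R] (J → R)) :
    tupleCoord R S κ J (A.tupleMap _ x) =
      (A ⊗ₖ (1 : Matrix J J S)) *ᵥ tupleCoord R S κ J x := by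
  ext ⟨a, j⟩
  rw [tupleCoord_apply, Matrix.tupleMap_apply, map_sum, Finset.sum_apply]
  simp only [map_smul]
  simp [mulVec, dotProduct, Fintype.sum_prod_type, one_apply, tupleCoord_apply]

variable (R S κ J₀ J₁) in
/-- Coordinates on pairs of tuples. -/
def tuplePairCoord :
    ((κ → S ⊗[R] (J₀ → R)) × (κ → S ⊗[R] (J₁ → R))) ≃ₗ[S] (κ × J₀ ⊕ κ × J₁ → S) :=
  (tupleCoord R S κ J₀).prodCongr (tupleCoord R S κ J₁) ≪≫ₗ
    (LinearEquiv.sumArrowLequivProdArrow _ _ S S).symm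

lemma tuplePairCoord_apply (x) : tuplePairCoord R S κ J₀ J₁ x =
    Sum.elim (tupleCoord R S κ J₀ x.1) (tupleCoord R S κ J₁ x.2) := rfl

/-- In coordinates the twisted differential has the block shape of the Clifford action on a graded
tensor product, which is how the functor is compared with `tensorSpinor`. -/
lemma tuplePairCoord_twistDiff (B A : Matrix κ κ S) (M₀ : Matrix J₁ J₀ R) (M₁ : Matrix J₀ J₁ R)
    (x) : tuplePairCoord R S κ J₁ J₀ (twistDiff B A M₀.mulVecLin M₁.mulVecLin x) =
      fromBlocks ((1 : Matrix κ κ S) ⊗ₖ M₀.map (algebraMap R S)) (B ⊗ₖ (1 : Matrix J₁ J₁ S))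
        (A ⊗ₖ (1 : Matrix J₀ J₀ S)) ((1 : Matrix κ κ S) ⊗ₖ M₁.map (algebraMap R S)) *ᵥ
        tuplePairCoord R S κ J₀ J₁ x := by
  rw [twistDiff_apply, tuplePairCoord_apply, tuplePairCoord_apply, fromBlocks_mulVec,
    Sum.elim_comp_inl, Sum.elim_comp_inr, map_add, map_add, tupleCoord_tupleBaseChange,
    tupleCoord_tupleBaseChange, tupleCoord_tupleMap, tupleCoord_tupleMap]

lemma tuplePairCoord_prodMap {J₀' J₁' : Type} [Fintype J₀'] [DecidableEq J₀'] [Fintype J₁']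
    [DecidableEq J₁'] (M₀ : Matrix J₀' J₀ R) (M₁ : Matrix J₁' J₁ R) (x) :
    tuplePairCoord R S κ J₀' J₁' ((M₀.mulVecLin.tupleBaseChange S κ).prodMap
      (M₁.mulVecLin.tupleBaseChange S κ) x) =
      fromBlocks ((1 : Matrix κ κ S) ⊗ₖ M₀.map (algebraMap R S)) 0 0
        ((1 : Matrix κ κ S) ⊗ₖ M₁.map (algebraMap R S)) *ᵥ tuplePairCoord R S κ J₀ J₁ x := by
  rw [LinearMap.prodMap_apply, tuplePairCoord_apply, tuplePairCoord_apply, fromBlocks_mulVec,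
    Sum.elim_comp_inl, Sum.elim_comp_inr, tupleCoord_tupleBaseChange, tupleCoord_tupleBaseChange,
    zero_mulVec, zero_mulVec, add_zero, zero_add]

end TupleCoordinates

namespace Matrix

variable {σ I J κ κ' : Type} [Fintype σ]

lemma linearForm_one_kronecker [DecidableEq κ] (g : σ → Matrix J I ℝ) :
    linearForm (fun i => (1 : Matrix κ κ ℝ) ⊗ₖ g i) = 1 ⊗ₖ linearForm g := by
  ext ⟨a, j⟩ ⟨b, i⟩
  by_cases h : a = b
  · subst h
    simp [linearForm, Matrix.sum_apply]
  · simp [linearForm, Matrix.sum_apply, h]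

lemma linearForm_kronecker_one [DecidableEq J] (g : σ → Matrix κ' κ ℝ) :
    linearForm (fun i => g i ⊗ₖ (1 : Matrix J J ℝ)) = linearForm g ⊗ₖ 1 := by
  ext ⟨a, j⟩ ⟨b, i⟩
  by_cases h : j = i
  · subst h
    simp [linearForm, Matrix.sum_apply]
  · simp [linearForm, Matrix.sum_apply, h]

lemma linearForm_neg (g : σ → Matrix J I ℝ) : linearForm (fun i => -g i) = -linearForm g := by
  ext j i
  simp [linearForm, Matrix.sum_apply]

end Matrix

lemma quadraticSeries_add {σ : Type} [Fintype σ] (B B' : Matrix σ σ ℝ) :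
    quadraticSeries (B + B') = quadraticSeries B + quadraticSeries B' := by
  simp only [quadraticSeries, Matrix.add_apply, map_add, add_mul, Finset.sum_add_distrib]

section Rename

variable {n m : ℕ} [Algebra (MvPowerSeries (Fin n) ℝ) (MvPowerSeries (Fin (n + m)) ℝ)]

lemma map_linearForm
    (hX : ∀ i, algebraMap (MvPowerSeries (Fin n) ℝ) (MvPowerSeries (Fin (n + m)) ℝ)
      (MvPowerSeries.X i) = MvPowerSeries.X (Fin.castAdd m i))
    (hC : ∀ r : ℝ, algebraMap (MvPowerSeries (Fin n) ℝ) (MvPowerSeries (Fin (n + m)) ℝ)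
      (MvPowerSeries.C r) = MvPowerSeries.C r) {I J : Type}
    (g : Fin n → Matrix J I ℝ) :
    (linearForm g).map (algebraMap (MvPowerSeries (Fin n) ℝ) (MvPowerSeries (Fin (n + m)) ℝ)) =
      linearForm (Fin.addCases g 0) := by
  ext1 j i
  simp [linearForm, Matrix.sum_apply, Fin.sum_univ_add, hX, hC]

lemma algebraMap_quadraticSeries
    (hX : ∀ i, algebraMap (MvPowerSeries (Fin n) ℝ) (MvPowerSeries (Fin (n + m)) ℝ)
      (MvPowerSeries.X i) = MvPowerSeries.X (Fin.castAdd m i))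
    (hC : ∀ r : ℝ, algebraMap (MvPowerSeries (Fin n) ℝ) (MvPowerSeries (Fin (n + m)) ℝ)
      (MvPowerSeries.C r) = MvPowerSeries.C r)
    (B : Matrix (Fin n) (Fin n) ℝ) :
    algebraMap (MvPowerSeries (Fin n) ℝ) (MvPowerSeries (Fin (n + m)) ℝ) (quadraticSeries B) =
      quadraticSeries (CliffordData.leftForm B m) := by
  simp [quadraticSeries, Fin.sum_univ_add, hX, hC, CliffordData.leftForm]

end Rename

end

/-! ### The octonion twist on factorizations of Clifford modules. -/

noncomputable section

open Matrix MatrixFactorization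
open scoped Kronecker TensorProduct

lemma Matrix.linearForm_neg_kronecker_one {σ J κ κ' : Type} [Fintype σ] [DecidableEq J]
    (g : σ → Matrix κ' κ ℝ) :
    linearForm (fun i => -(g i ⊗ₖ (1 : Matrix J J ℝ))) = (-linearForm g) ⊗ₖ 1 := by
  rw [linearForm_neg, linearForm_kronecker_one]
  ext p q
  simp

namespace CliffordData

variable {n : ℕ}

/-- The action of the last eight variables on the even spinors. -/
def octonionAction (n : ℕ) : Fin (n + 8) → Matrix (Fin 8) (Fin 8) ℝ :=
  Fin.addCases 0 octonionUnit

/-- The action of the last eight variables on the odd spinors. -/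
def octonionActionTranspose (n : ℕ) : Fin (n + 8) → Matrix (Fin 8) (Fin 8) ℝ :=
  Fin.addCases 0 fun i => (octonionUnit i)ᵀ

/-- The quadratic form with the sum of eight more squares. -/
abbrev addEight (B : Matrix (Fin n) (Fin n) ℝ) : Matrix (Fin (n + 8)) (Fin (n + 8)) ℝ :=
  leftForm B 8 + rightForm n (1 : Matrix (Fin 8) (Fin 8) ℝ)

section TensorSpinor

variable {B : Matrix (Fin n) (Fin n) ℝ} (V : CliffordData B)

/-- Written in the block shape that `tuplePairCoord_twistDiff` produces. -/
lemma linearForm_tensorSpinor_γ₀ : linearForm V.tensorSpinor.γ₀ = fromBlocks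
    ((1 : Matrix (Fin 8) (Fin 8) _) ⊗ₖ linearForm (V.extendLeft 8).γ₀)
    ((-linearForm (octonionActionTranspose n)) ⊗ₖ (1 : Matrix V.I₁ V.I₁ _))
    (linearForm (octonionAction n) ⊗ₖ (1 : Matrix V.I₀ V.I₀ _))
    ((1 : Matrix (Fin 8) (Fin 8) _) ⊗ₖ linearForm (V.extendLeft 8).γ₁) :=
  (linearForm_fromBlocks _ _ _ _).trans (fromBlocks_inj.2 ⟨linearForm_one_kronecker _,
    linearForm_neg_kronecker_one _, linearForm_kronecker_one _, linearForm_one_kronecker _⟩)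

lemma linearForm_tensorSpinor_γ₁ : linearForm V.tensorSpinor.γ₁ = fromBlocks
    ((1 : Matrix (Fin 8) (Fin 8) _) ⊗ₖ linearForm (V.extendLeft 8).γ₁)
    (linearForm (octonionActionTranspose n) ⊗ₖ (1 : Matrix V.I₀ V.I₀ _))
    ((-linearForm (octonionAction n)) ⊗ₖ (1 : Matrix V.I₁ V.I₁ _))
    ((1 : Matrix (Fin 8) (Fin 8) _) ⊗ₖ linearForm (V.extendLeft 8).γ₀) :=
  (linearForm_fromBlocks _ _ _ _).trans (fromBlocks_inj.2 ⟨linearForm_one_kronecker _,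
    linearForm_kronecker_one _, linearForm_neg_kronecker_one _, linearForm_one_kronecker _⟩)

end TensorSpinor

section Twist

variable [Algebra (MvPowerSeries (Fin n) ℝ) (MvPowerSeries (Fin (n + 8)) ℝ)]
  (hX : ∀ i, algebraMap (MvPowerSeries (Fin n) ℝ) (MvPowerSeries (Fin (n + 8)) ℝ)
    (MvPowerSeries.X i) = MvPowerSeries.X (Fin.castAdd 8 i))
  (hC : ∀ r : ℝ, algebraMap (MvPowerSeries (Fin n) ℝ) (MvPowerSeries (Fin (n + 8)) ℝ)
    (MvPowerSeries.C r) = MvPowerSeries.C r)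
  (B : Matrix (Fin n) (Fin n) ℝ)

/-- The factorization of the sum of eight squares by the multiplication of octonions. -/
def octonionTwist : TwistData (quadraticSeries B) (quadraticSeries (addEight B)) (Fin 8) where
  A := linearForm (octonionAction n)
  A' := linearForm (octonionActionTranspose n)
  c := quadraticSeries (rightForm n (1 : Matrix (Fin 8) (Fin 8) ℝ))
  A_mul := linearForm_mul_linearForm_eq _ _ (spinor.extendRight n).rel₁
  mul_A := linearForm_mul_linearForm_eq _ _ (spinor.extendRight n).rel₀
  eq_add := by rw [algebraMap_quadraticSeries hX hC, quadraticSeries_add]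

variable {B}

/-- Tensoring a factorization given by a Clifford module with the octonions is given by tensoring
the module with the spinor module. -/
def octonionTwistIso (V : CliffordData B) :
    (octonionTwist hX hC B).functor.obj V.toMF ≅ V.tensorSpinor.toMF :=
  isoMk
    (tuplePairCoord (MvPowerSeries (Fin n) ℝ) (MvPowerSeries (Fin (n + 8)) ℝ) (Fin 8) V.I₀ V.I₁)
    (tuplePairCoord (MvPowerSeries (Fin n) ℝ) (MvPowerSeries (Fin (n + 8)) ℝ) (Fin 8) V.I₁ V.I₀)
    (fun x => by
      refine Eq.trans ?_ (tuplePairCoord_twistDiff (-linearForm (octonionActionTranspose n))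
        (linearForm (octonionAction n)) (linearForm V.γ₀) (linearForm V.γ₁) x).symm
      rw [map_linearForm hX hC, map_linearForm hX hC]
      exact congrArg (· *ᵥ _) (linearForm_tensorSpinor_γ₀ V))
    (fun x => by
      refine Eq.trans ?_ (tuplePairCoord_twistDiff (linearForm (octonionActionTranspose n))
        (-linearForm (octonionAction n)) (linearForm V.γ₁) (linearForm V.γ₀) x).symm
      rw [map_linearForm hX hC, map_linearForm hX hC]
      exact congrArg (· *ᵥ _) (linearForm_tensorSpinor_γ₁ V))

lemma map_fromBlocks_kronecker {I₀ I₁ J₀ J₁ : Type} (M₀ : Matrix J₀ I₀ ℝ) (M₁ : Matrix J₁ I₁ ℝ) :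
    (fromBlocks ((1 : Matrix (Fin 8) (Fin 8) ℝ) ⊗ₖ M₀) 0 0
      ((1 : Matrix (Fin 8) (Fin 8) ℝ) ⊗ₖ M₁)).map (MvPowerSeries.C (σ := Fin (n + 8))) =
    fromBlocks (1 ⊗ₖ M₀.map (MvPowerSeries.C (σ := Fin (n + 8)))) 0 0
      (1 ⊗ₖ M₁.map (MvPowerSeries.C (σ := Fin (n + 8)))) := by
  have h {I J : Type} (M : Matrix J I ℝ) : ((1 : Matrix (Fin 8) (Fin 8) ℝ) ⊗ₖ M).map
      (MvPowerSeries.C (σ := Fin (n + 8))) = 1 ⊗ₖ M.map (MvPowerSeries.C (σ := Fin (n + 8))) := by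
    ext1 ⟨a, j⟩ ⟨b, i⟩
    by_cases hab : a = b
    · subst hab; simp
    · simp [hab]
  have h0 {I J : Type} : (0 : Matrix J I ℝ).map (MvPowerSeries.C (σ := Fin (n + 8))) = 0 := by
    ext1 j i; simp
  rw [fromBlocks_map, h, h, h0, h0]

/-- Naturality of the comparison. It turns fullness and faithfulness of the twist into statements
about V ↦ S ⊗ V on Clifford modules. -/
lemma map_octonionTwistIso {V W : CliffordData B} (c : V.Hom W) :
    (octonionTwist hX hC B).functor.map c.toMF ≫ (octonionTwistIso hX hC W).hom =
      (octonionTwistIso hX hC V).hom ≫ c.tensorSpinor.toMF := by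
  have hmap {I J : Type} (M : Matrix J I ℝ) : (M.map (MvPowerSeries.C (σ := Fin n))).map
      (algebraMap (MvPowerSeries (Fin n) ℝ) (MvPowerSeries (Fin (n + 8)) ℝ)) =
      M.map (MvPowerSeries.C (σ := Fin (n + 8))) := by
    ext1 j i
    exact hC _
  refine hom_ext (fun x => ?_) (fun x => ?_)
  · refine (tuplePairCoord_prodMap (c.c₀.map (MvPowerSeries.C (σ := Fin n)))
      (c.c₁.map (MvPowerSeries.C (σ := Fin n))) x).trans ?_
    rw [hmap, hmap, ← map_fromBlocks_kronecker]
    rfl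
  · refine (tuplePairCoord_prodMap (c.c₁.map (MvPowerSeries.C (σ := Fin n)))
      (c.c₀.map (MvPowerSeries.C (σ := Fin n))) x).trans ?_
    rw [hmap, hmap, ← map_fromBlocks_kronecker]
    rfl

end Twist

end CliffordData

end

/-! ### The equivalence and the translation to quadratic polynomials. -/

noncomputable section

open Matrix MatrixFactorization
open scoped Kronecker TensorProduct

section Family

variable {C D : Type*} [Category* C] [Category* D] (F : C ⥤ D) {ι : Type*} (P : ι → C)

/-- A functor is full if it is so on representatives of the isomorphism classes. -/
lemma CategoryTheory.Functor.full_of_representatives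
    (hP : ∀ X, ∃ v, Nonempty (P v ≅ X))
    (h : ∀ v w, Function.Surjective (F.map : (P v ⟶ P w) → _)) : F.Full where
  map_surjective {X Y} g := by
    obtain ⟨v, ⟨i⟩⟩ := hP X
    obtain ⟨w, ⟨j⟩⟩ := hP Y
    obtain ⟨f, hf⟩ := h v w (F.map i.hom ≫ g ≫ F.map j.inv)
    refine ⟨i.inv ≫ f ≫ j.hom, ?_⟩
    rw [F.map_comp, F.map_comp, hf]
    simp [← F.map_comp, ← F.map_comp_assoc]

/-- A functor is faithful if it is so on representatives of the isomorphism classes. -/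
lemma CategoryTheory.Functor.faithful_of_representatives
    (hP : ∀ X, ∃ v, Nonempty (P v ≅ X))
    (h : ∀ v w, Function.Injective (F.map : (P v ⟶ P w) → _)) : F.Faithful where
  map_injective {X Y} f g hfg := by
    obtain ⟨v, ⟨i⟩⟩ := hP X
    obtain ⟨w, ⟨j⟩⟩ := hP Y
    have := h v w (a₁ := i.hom ≫ f ≫ j.inv) (a₂ := i.hom ≫ g ≫ j.inv) (by simp [hfg])
    simpa using this

end Family

namespace CliffordData

variable {n : ℕ}

/-- A Clifford module for the form with eight more squares gives the same factorization as the
tensor product of its spinor components with the spinor module. -/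
lemma nonempty_evalIso {B : Matrix (Fin n) (Fin n) ℝ} (V : CliffordData (addEight B)) :
    Nonempty ((spinorHoms V).tensorSpinor.toMF ≅ V.toMF) := by
  obtain ⟨G₀, G₁, h₀, h₀', h₁, h₁'⟩ := exists_inverse_eval V
  have h {I J : Type} [Fintype I] [DecidableEq I] [Fintype J] {M : Matrix I J ℝ}
      {N : Matrix J I ℝ} (h : M * N = 1) : M.map (MvPowerSeries.C (σ := Fin (n + 8))) *
        N.map (MvPowerSeries.C (σ := Fin (n + 8))) = 1 := by
    rw [← Matrix.map_mul, h, Matrix.map_one _ (map_zero _) (map_one _)]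
  refine ⟨ofMatrixIso ((eval V).c₀.map (MvPowerSeries.C (σ := Fin (n + 8))))
    ((eval V).c₁.map (MvPowerSeries.C (σ := Fin (n + 8)))) ?_ ?_
    (G₀.map (MvPowerSeries.C (σ := Fin (n + 8)))) (G₁.map (MvPowerSeries.C (σ := Fin (n + 8))))
    (h h₀) (h h₀') (h h₁) (h h₁')⟩
  · rw [linearForm_mul_map, map_mul_linearForm]
    simp only [(eval V).comm₀]
  · rw [linearForm_mul_map, map_mul_linearForm]
    simp only [(eval V).comm₁]

lemma leftForm_add_rightForm {m : ℕ} (B : Matrix (Fin n) (Fin n) ℝ) (D : Matrix (Fin m) (Fin m) ℝ) :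
    leftForm B m + rightForm n D =
      (fromBlocks B 0 0 D).submatrix finSumFinEquiv.symm finSumFinEquiv.symm := by
  refine (congrArg (fun M => M.submatrix finSumFinEquiv.symm finSumFinEquiv.symm)
    (fromBlocks_add B 0 0 0 0 0 0 D)).trans ?_
  simp

/-- B + Bᵀ becomes block diagonal with second block 2 · 1. The new form is again nondegenerate, so
the Clifford description applies in n + 8 variables too. -/
lemma exists_mul_addEight_eq_one {B C : Matrix (Fin n) (Fin n) ℝ} (hC : C * (B + Bᵀ) = 1) :
    ∃ C', C' * (addEight B + (addEight B)ᵀ) = 1 := by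
  have h : ((1 / 2 : ℝ) • 1 : Matrix (Fin 8) (Fin 8) ℝ) * (1 + 1) = 1 := by
    rw [← two_smul ℝ (1 : Matrix (Fin 8) (Fin 8) ℝ), smul_mul_smul]
    norm_num
  have e : addEight B + (addEight B)ᵀ = (fromBlocks (B + Bᵀ) 0 0 (1 + 1)).submatrix
      finSumFinEquiv.symm finSumFinEquiv.symm := by
    rw [addEight, leftForm_add_rightForm, transpose_submatrix, fromBlocks_transpose]
    refine (congrArg (fun M => M.submatrix finSumFinEquiv.symm finSumFinEquiv.symm)
      (fromBlocks_add B 0 0 (1 : Matrix (Fin 8) (Fin 8) ℝ) Bᵀ 0ᵀ 0ᵀ 1ᵀ)).trans ?_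
    simp
  refine ⟨(fromBlocks C 0 0 ((1 / 2 : ℝ) • 1)).submatrix
    finSumFinEquiv.symm finSumFinEquiv.symm, ?_⟩
  rw [e, submatrix_mul_equiv, fromBlocks_multiply, hC, h]
  simp

section Equivalence

variable [Algebra (MvPowerSeries (Fin n) ℝ) (MvPowerSeries (Fin (n + 8)) ℝ)]
  (hX : ∀ i, algebraMap (MvPowerSeries (Fin n) ℝ) (MvPowerSeries (Fin (n + 8)) ℝ)
    (MvPowerSeries.X i) = MvPowerSeries.X (Fin.castAdd 8 i))
  (hC : ∀ r : ℝ, algebraMap (MvPowerSeries (Fin n) ℝ) (MvPowerSeries (Fin (n + 8)) ℝ)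
    (MvPowerSeries.C r) = MvPowerSeries.C r)
  {B D : Matrix (Fin n) (Fin n) ℝ}

lemma hmf_map_toMF {V W : CliffordData B} (c : V.Hom W) :
    (octonionTwist hX hC B).hmf.map ((HMF.quotient _ _).map c.toMF) =
      (HMF.quotient _ _).map ((octonionTwistIso hX hC V).hom ≫ c.tensorSpinor.toMF ≫
        (octonionTwistIso hX hC W).inv) :=
  congrArg (HMF.quotient _ _).map
    ((Iso.eq_comp_inv _).2 (map_octonionTwistIso hX hC c) |>.trans (Category.assoc _ _ _))

/-- After transport to S ⊗ V and S ⊗ W, a morphism is homotopic to a Clifford morphism in n + 8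
variables, and this comes from V → W because spinor endomorphisms are scalars. -/
lemma hmf_map_surjective (hD : D * (B + Bᵀ) = 1) (V W : CliffordData B) : Function.Surjective
    ((octonionTwist hX hC B).hmf.map :
      ((HMF.quotient _ _).obj V.toMF ⟶ (HMF.quotient _ _).obj W.toMF) → _) := by
  intro g
  obtain ⟨g, rfl⟩ := (HMF.quotient _ _).map_surjective
    (X := (octonionTwist hX hC B).functor.obj V.toMF)
    (Y := (octonionTwist hX hC B).functor.obj W.toMF) g
  obtain ⟨D', hD'⟩ := exists_mul_addEight_eq_one hD
  obtain ⟨c, hc⟩ := exists_homotopic_toMF D' hD'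
    ((octonionTwistIso hX hC V).inv ≫ g ≫ (octonionTwistIso hX hC W).hom)
  obtain ⟨ψ, rfl⟩ := exists_eq_tensorSpinor c
  refine ⟨(HMF.quotient _ _).map ψ.toMF, ?_⟩
  rw [hmf_map_toMF, Functor.map_comp, Functor.map_comp, ← (HMF.quotient_map_eq_iff _ _).2 hc,
    ← Functor.map_comp, ← Functor.map_comp]
  congr 1
  simp

/-- Both morphisms are represented by Clifford morphisms. If their images are homotopic, then the
constant matrices 1 ⊗ c and 1 ⊗ c' agree, and so do c and c'. -/
lemma hmf_map_injective (hD : D * (B + Bᵀ) = 1) (V W : CliffordData B) : Function.Injective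
    ((octonionTwist hX hC B).hmf.map :
      ((HMF.quotient _ _).obj V.toMF ⟶ (HMF.quotient _ _).obj W.toMF) → _) := by
  intro f g h
  obtain ⟨f, rfl⟩ := (HMF.quotient _ _).map_surjective f
  obtain ⟨g, rfl⟩ := (HMF.quotient _ _).map_surjective g
  obtain ⟨c, hc⟩ := exists_homotopic_toMF D hD f
  obtain ⟨c', hc'⟩ := exists_homotopic_toMF D hD g
  rw [(HMF.quotient_map_eq_iff _ _).2 hc, (HMF.quotient_map_eq_iff _ _).2 hc', hmf_map_toMF,
    hmf_map_toMF] at h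
  rw [(HMF.quotient_map_eq_iff _ _).2 hc, (HMF.quotient_map_eq_iff _ _).2 hc']
  have h' : (HMF.quotient _ _).map c.tensorSpinor.toMF =
      (HMF.quotient _ _).map c'.tensorSpinor.toMF := by
    have := congrArg (fun k => (HMF.quotient _ _).map (octonionTwistIso hX hC V).inv ≫ k ≫
      (HMF.quotient _ _).map (octonionTwistIso hX hC W).hom) h
    simpa only [← Functor.map_comp, Category.assoc, Iso.inv_hom_id_assoc, Iso.inv_hom_id,
      Category.comp_id] using this
  rw [Hom.tensorSpinor_injective (Hom.eq_of_homotopic ((HMF.quotient_map_eq_iff _ _).1 h'))]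

/-- Tensoring with the octonions is an equivalence of homotopy categories. -/
lemma isEquivalence_octonionTwist (hD : D * (B + Bᵀ) = 1) :
    (octonionTwist hX hC B).hmf.IsEquivalence where
  full := Functor.full_of_representatives _ (fun V : CliffordData B =>
    (HMF.quotient _ _).obj V.toMF) (fun X => exists_toMF_iso D hD X.as)
    (hmf_map_surjective hX hC hD)
  faithful := Functor.faithful_of_representatives _ (fun V : CliffordData B =>
    (HMF.quotient _ _).obj V.toMF) (fun X => exists_toMF_iso D hD X.as)
    (hmf_map_injective hX hC hD)
  essSurj := ⟨fun Y => by
    obtain ⟨D', hD'⟩ := exists_mul_addEight_eq_one hD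
    obtain ⟨V, ⟨e⟩⟩ := exists_toMF_iso D' hD' Y.as
    obtain ⟨i⟩ := nonempty_evalIso V
    exact ⟨(HMF.quotient _ _).obj (spinorHoms V).toMF,
      ⟨(HMF.quotient _ _).mapIso (octonionTwistIso hX hC _ ≪≫ i) ≪≫ e⟩⟩⟩

end Equivalence

/-- Knörrer type periodicity for the addition of eight squares. -/
lemma exists_equivalence_addEight {B D : Matrix (Fin n) (Fin n) ℝ} (hD : D * (B + Bᵀ) = 1) :
    ∃ (e : HMF (MvPowerSeries (Fin n) ℝ) (quadraticSeries B) ≌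
        HMF (MvPowerSeries (Fin (n + 8)) ℝ) (quadraticSeries (addEight B)))
      (_ : e.functor.CommShift ℤ), e.functor.IsTriangulated ∧ e.functor.Linear ℝ := by
  -- The larger power series ring is an algebra over the smaller one through the inclusion of the
  -- first n variables.
  let _ := (MvPowerSeries.rename (R := ℝ) (Fin.castAdd 8 : Fin n → Fin (n + 8))).toRingHom.toAlgebra
  have hX (i) : algebraMap (MvPowerSeries (Fin n) ℝ) (MvPowerSeries (Fin (n + 8)) ℝ)
      (MvPowerSeries.X i) = MvPowerSeries.X (Fin.castAdd 8 i) := MvPowerSeries.rename_X _ i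
  have hC (r : ℝ) : algebraMap (MvPowerSeries (Fin n) ℝ) (MvPowerSeries (Fin (n + 8)) ℝ)
      (MvPowerSeries.C r) = MvPowerSeries.C r := MvPowerSeries.rename_C _ r
  have : IsScalarTower ℝ (MvPowerSeries (Fin n) ℝ) (MvPowerSeries (Fin (n + 8)) ℝ) :=
    .of_algebraMap_eq fun r => (hC r).symm
  have := isEquivalence_octonionTwist hX hC hD
  exact ⟨(octonionTwist hX hC B).hmf.asEquivalence,
    inferInstanceAs ((octonionTwist hX hC B).hmf.CommShift ℤ),
    inferInstanceAs (octonionTwist hX hC B).hmf.IsTriangulated,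
    (octonionTwist hX hC B).hmf_linear ℝ⟩

end CliffordData

section Polynomials

open CliffordData

variable {n : ℕ} (q : QuadraticForm ℝ (Fin n → ℝ))

lemma coe_quadraticPolynomial :
    (quadraticPolynomial q : MvPowerSeries (Fin n) ℝ) = quadraticSeries q.toMatrix' := by
  change MvPolynomial.coeToMvPowerSeries.ringHom (quadraticPolynomial q) = _
  simp only [quadraticPolynomial, map_sum, map_mul]
  simp [quadraticSeries]

lemma coe_quadraticPolynomialAddEight :
    (quadraticPolynomialAddEight q : MvPowerSeries (Fin (n + 8)) ℝ) =
      quadraticSeries (addEight q.toMatrix') := by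
  change MvPolynomial.coeToMvPowerSeries.ringHom (quadraticPolynomialAddEight q) = _
  simp only [quadraticPolynomialAddEight, quadraticPolynomial, map_sum, map_mul, map_add, map_pow]
  rw [addEight, leftForm_add_rightForm]
  simp [quadraticSeries, Fin.sum_univ_add, one_apply, sq]

variable {q}

/-- `toMatrix'` represents half of the polar form, so adding its transpose gives the matrix of the
polar form, which is invertible by nondegeneracy. -/
lemma exists_mul_toMatrix'_eq_one (hq : (QuadraticMap.polarBilin q).Nondegenerate) :
    ∃ D, D * (q.toMatrix' + q.toMatrix'ᵀ) = 1 := by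
  have h : q.toMatrix' + q.toMatrix'ᵀ =
      LinearMap.toMatrix₂' ℝ (QuadraticMap.polarBilin q) := by
    ext i j
    simp [QuadraticForm.toMatrix', LinearMap.toMatrix₂'_apply, QuadraticMap.associated_apply,
      QuadraticMap.polar, add_comm]
    ring
  rw [h]
  exact ⟨_, nonsing_inv_mul _ (isUnit_iff_ne_zero.2
    (Matrix.nondegenerate_iff_det_ne_zero.1 (LinearMap.Nondegenerate.toMatrix₂' hq)))⟩

end Polynomials

end

theorem mainTheorem10 (n : ℕ) (q : QuadraticForm ℝ (Fin n → ℝ))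
    (hq : (QuadraticMap.polarBilin q).Nondegenerate) :
    ∃ (e : HMF (MvPowerSeries (Fin n) ℝ) (quadraticPolynomial q : MvPowerSeries (Fin n) ℝ) ≌
        HMF (MvPowerSeries (Fin (n + 8)) ℝ)
          (quadraticPolynomialAddEight q : MvPowerSeries (Fin (n + 8)) ℝ))
      (_ : e.functor.CommShift ℤ),
      e.functor.IsTriangulated ∧ e.functor.Linear ℝ := by
  obtain ⟨D, hD⟩ := exists_mul_toMatrix'_eq_one hq
  rw [coe_quadraticPolynomial, coe_quadraticPolynomialAddEight]
  exact CliffordData.exists_equivalence_addEight hD
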